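/- Let $p$ be a prime, $k$ a field of characteristic $p$, and for $n\ge 1$ let $\mathrm{Rep}(\mathbb Z/p^n)$ be the category of finite dimensional representations of $\mathbb Z/p^n$ over $k$. Let $G_n$ be its Green ring (the free abelian group on isomorphism classes of objects modulo $[V\oplus W]=[V]+[W]$, with $[V][W]=[V\otimes W]$), and let $\overline G_n$ be the quotient of $G_n$ by the ideal generated by the classes of the negligible indecomposables, i.e. those indecomposable $V$ with $\dim V=0$ in $k$. Let $\mathrm{Ver}_p$ be the Verlinde category, i.e. the semisimplification of $\mathrm{Rep}(\mathbb Z/p)$ (its quotient by the negligible morphisms), and $\mathrm{Gr}(\mathrm{Ver}_p)$ its Grothendieck ring. Let $K_p$ be the commutative ring generated by $X_1$, where $X_0=1$, $X_{i+1}=X_1X_i-X_i-X_{i-1}$ for $1\le i\le p-2$, with the single relation $X_1X_{p-1}=X_{p-2}$. A (commutative, unital) based ring is a commutative ring with a distinguished $\mathbb Z$-basis $B\ni 1$ such that the structure constants are nonnegative and there is an involution $b\mapsto b^*$ of $B$ inducing an anti-automorphism of the ring, such that the coefficient of $1$ in $bc$ is $1$ if $c=b^*$ and $0$ otherwise. An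 isomorphism of based rings is a ring isomorphism which maps the distinguished basis onto the distinguished basis. The distinguished basis of a tensor product over $\mathbb Z$ consists of the tensors of basis elements. Then: 1. $X_0,\dots,X_{p-1}$ is a $\mathbb Z$-basis of $K_p$, it makes $K_p$ a based ring, and $X_0=1$, $X_1X_i=X_{i-1}+X_i+X_{i+1}$ for $1\le i\le p-2$, and $X_1X_{p-1}=X_{p-2}$. 2. For every $n\ge 1$, $\overline G_n$ is a based ring, with distinguished basis the classes of the indecomposable $V$ with $\dim V\ne 0$ in $k$. 3. For every $n\ge 1$ there is an isomorphism of based rings $\overline G_n\otimes_{\mathbb Z}K_p\cong\overline G_{n+1}$ which sends $[V]\otimes 1$ to the class of the inflation of $V$ along $\mathbb Z/p^{n+1}\to\mathbb Z/p^n$, and which sends $1\otimes X_i$ ($0\le i\le p-1$) to the class of an indecomposable representation of dimension $ip^n+1$ if $i$ is even and $(i+1)p^n-1$ if $i$ is odd. 4. $\mathrm{Gr}(\mathrm{Ver}_p)$ is a based ring, with distinguished basis the classes of the simple objects, and there is an isomorphism of based rings $\overline G_1\cong\mathrm{Gr}(\mathrm{Ver}_p)$ which sends the class of each representation $V$ to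 the class of its image in $\mathrm{Ver}_p$. 5. For every $n\ge 1$ there is an isomorphism of based rings $\overline G_n\cong\mathrm{Gr}(\mathrm{Ver}_p)\otimes_{\mathbb Z}K_p^{\otimes (n-1)}$. -/

import Mathlib

open CategoryTheory CategoryTheory.Limits MonoidalCategory
open scoped TensorProduct

noncomputable section

universe u v w

/-! ### Grothendieck rings -/

section SplitGrothendieck

variable (C : Type u) [Category.{v} C] [Preadditive C] [MonoidalCategory C] [BraidedCategory C]
  [HasBinaryBiproducts C]

/-- The relations `[X ⊕ Y] = [X] + [Y]` in the free abelian group `ℤ[Skeleton C]` on the isomorphism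
classes of objects of `C`. This free abelian group is a ring, with multiplication `⊗`. -/
def splitRelations : Ideal (MonoidAlgebra ℤ (Skeleton C)) :=
  Ideal.span {x | ∃ X Y : C, x =
    MonoidAlgebra.of ℤ (Skeleton C) (toSkeleton (X ⊞ Y)) -
      (MonoidAlgebra.of ℤ (Skeleton C) (toSkeleton X) +
        MonoidAlgebra.of ℤ (Skeleton C) (toSkeleton Y))}

/-- The Green ring (split Grothendieck ring) of `C`: the free abelian group on isomorphism classes
of objects modulo `[X ⊕ Y] = [X] + [Y]`, with multiplication `[X][Y] = [X ⊗ Y]`. If `C` is a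
semisimple category, this is also the usual Grothendieck ring `Gr(C)`. -/
def GreenRing : Type u :=
  MonoidAlgebra ℤ (Skeleton C) ⧸ splitRelations C

instance : CommRing (GreenRing C) :=
  inferInstanceAs (CommRing (MonoidAlgebra ℤ (Skeleton C) ⧸ splitRelations C))

variable {C}

/-- The class `[X]` of an object in the Green ring. -/
def GreenRing.cls (X : C) : GreenRing C :=
  Ideal.Quotient.mk (splitRelations C) (MonoidAlgebra.of ℤ (Skeleton C) (toSkeleton X))

end SplitGrothendieck

/-! ### The Green ring modulo the negligible ideal -/

section Negligible

variable (k : Type u) [Field k] (G : Type v) [Monoid G]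

/-- The ideal of the Green ring of `Rep G` generated by the classes of the negligible indecomposable
representations, i.e. of those whose categorical dimension (the image in `k` of the dimension)
vanishes. -/
def negligibleIdeal : Ideal (GreenRing (FDRep k G)) :=
  Ideal.span {x | ∃ V : FDRep k G, Indecomposable V ∧ (Module.finrank k V : k) = 0 ∧
    x = GreenRing.cls V}

/-- The Green ring of `Rep G` modulo the negligible ideal. -/
def GreenBar : Type (max (u + 1) v) := GreenRing (FDRep k G) ⧸ negligibleIdeal k G

instance : CommRing (GreenBar k G) :=
  inferInstanceAs (CommRing (GreenRing (FDRep k G) ⧸ negligibleIdeal k G))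

variable {k G} in
/-- The class of a representation in the Green ring modulo the negligible ideal. -/
def GreenBar.cls (V : FDRep k G) : GreenBar k G :=
  Ideal.Quotient.mk (negligibleIdeal k G) (GreenRing.cls V)

/-- The distinguished basis: classes of the non-negligible indecomposable representations. -/
def GreenBar.basisSet : Set (GreenBar k G) :=
  {x | ∃ V : FDRep k G, Indecomposable V ∧ (Module.finrank k V : k) ≠ 0 ∧ x = GreenBar.cls V}

end Negligible

/-! ### The semisimplification of `Rep G` -/

section Semisimplification

/-- Contraction of the second tensor factor. -/
def partialTrace (k : Type u) [Field k] (X Y Z : Type v) [AddCommGroup X] [AddCommGroup Y]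
    [AddCommGroup Z] [Module k X] [Module k Y] [Module k Z] [FiniteDimensional k X]
    [FiniteDimensional k Y] [FiniteDimensional k Z] :
    (Y ⊗[k] Z →ₗ[k] X ⊗[k] Z) →ₗ[k] (Y →ₗ[k] X) :=
  (TensorProduct.rid k (Y →ₗ[k] X)).toLinearMap ∘ₗ
    (LinearMap.trace k Z).lTensor (Y →ₗ[k] X) ∘ₗ
      (homTensorHomEquiv k Y Z X Z).symm.toLinearMap

section partialTrace

variable {k : Type u} [Field k] {X Y Z : Type v} [AddCommGroup X] [AddCommGroup Y]
    [AddCommGroup Z] [Module k X] [Module k Y] [Module k Z] [FiniteDimensional k X]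
    [FiniteDimensional k Y] [FiniteDimensional k Z]

lemma partialTrace_map (a : Y →ₗ[k] X) (b : Z →ₗ[k] Z) :
    partialTrace k X Y Z (TensorProduct.map a b) = LinearMap.trace k Z b • a := by
  have h : (homTensorHomEquiv k Y Z X Z).symm (TensorProduct.map a b) = a ⊗ₜ b := by
    rw [LinearEquiv.symm_apply_eq]
    simp [homTensorHomEquiv_apply]
  simp [partialTrace, h]

set_option linter.unusedSectionVars false in
lemma hom_tensor_induction {P : (Y ⊗[k] Z →ₗ[k] X ⊗[k] Z) → Prop}
    (h0 : P 0) (hadd : ∀ f g, P f → P g → P (f + g))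
    (hmap : ∀ (a : Y →ₗ[k] X) (b : Z →ₗ[k] Z), P (TensorProduct.map a b))
    (h : Y ⊗[k] Z →ₗ[k] X ⊗[k] Z) : P h := by
  obtain ⟨t, rfl⟩ := (homTensorHomEquiv k Y Z X Z).surjective h
  induction t with
  | zero => simpa using h0
  | add x y hx hy => simpa using hadd _ _ hx hy
  | tmul a b => simpa [homTensorHomEquiv_apply] using hmap a b

lemma trace_comp_partialTrace (f : X →ₗ[k] Y) (h : Y ⊗[k] Z →ₗ[k] X ⊗[k] Z) :
    LinearMap.trace k (X ⊗[k] Z) (h ∘ₗ TensorProduct.map f LinearMap.id) =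
      LinearMap.trace k X (partialTrace k X Y Z h ∘ₗ f) := by
  induction h using hom_tensor_induction with
  | h0 => simp
  | hadd h h' ih ih' => simp [LinearMap.add_comp, ih, ih']
  | hmap a b =>
    rw [← TensorProduct.map_comp, LinearMap.trace_tensorProduct', partialTrace_map]
    simp [LinearMap.smul_comp, mul_comm]

lemma partialTrace_conj (A : X →ₗ[k] X) (A' : Y →ₗ[k] Y) (B B' : Z →ₗ[k] Z)
    (hB : B' ∘ₗ B = LinearMap.id) (h : Y ⊗[k] Z →ₗ[k] X ⊗[k] Z) :
    partialTrace k X Y Z (TensorProduct.map A B ∘ₗ h ∘ₗ TensorProduct.map A' B') =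
      A ∘ₗ partialTrace k X Y Z h ∘ₗ A' := by
  induction h using hom_tensor_induction with
  | h0 => simp
  | hadd h h' ih ih' => simp [LinearMap.add_comp, LinearMap.comp_add, ih, ih']
  | hmap a b =>
    rw [← TensorProduct.map_comp, ← TensorProduct.map_comp, partialTrace_map, partialTrace_map,
      LinearMap.trace_comp_comm', LinearMap.comp_assoc, hB, LinearMap.comp_id]
    simp [LinearMap.smul_comp, LinearMap.comp_smul]

end partialTrace

variable (k : Type u) [Field k] (G : Type v) [Group G]

variable {k G} in
/-- The trace of an endomorphism of a finite dimensional representation. -/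
def FDRep.trace {X : FDRep k G} (f : X ⟶ X) : k :=
  LinearMap.trace k X f.hom.hom.hom

variable {k G} in
/-- A morphism `f : X ⟶ Y` is negligible if `tr (g ∘ f) = 0` for all `g : Y ⟶ X`. -/
def FDRep.IsNegligible {X Y : FDRep k G} (f : X ⟶ Y) : Prop :=
  ∀ g : Y ⟶ X, FDRep.trace (f ≫ g) = 0

/-- Two morphisms are identified in the semisimplification if their difference is negligible. -/
def negligibleRel : HomRel (FDRep k G) := fun _ _ f g => FDRep.IsNegligible (f - g)

namespace FDRep

variable {k G}

lemma trace_comp_comm {X Y : FDRep k G} (f : X ⟶ Y) (g : Y ⟶ X) :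
    trace (f ≫ g) = trace (g ≫ f) :=
  LinearMap.trace_comp_comm' (f.hom.hom.hom) (g.hom.hom.hom)

lemma trace_add {X : FDRep k G} (f g : X ⟶ X) : trace (f + g) = trace f + trace g :=
  map_add (LinearMap.trace k X) f.hom.hom.hom g.hom.hom.hom

lemma trace_neg {X : FDRep k G} (f : X ⟶ X) : trace (-f) = -trace f :=
  map_neg (LinearMap.trace k X) f.hom.hom.hom

lemma IsNegligible.zero {X Y : FDRep k G} : IsNegligible (0 : X ⟶ Y) := fun g => by
  rw [zero_comp]
  exact map_zero (LinearMap.trace k X)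

lemma IsNegligible.add {X Y : FDRep k G} {f g : X ⟶ Y} (hf : IsNegligible f)
    (hg : IsNegligible g) : IsNegligible (f + g) := fun h => by
  rw [Preadditive.add_comp, trace_add, hf, hg, add_zero]

lemma IsNegligible.neg {X Y : FDRep k G} {f : X ⟶ Y} (hf : IsNegligible f) :
    IsNegligible (-f) := fun h => by
  rw [Preadditive.neg_comp, trace_neg, hf, neg_zero]

lemma IsNegligible.comp_left {X Y Z : FDRep k G} (f : X ⟶ Y) {g : Y ⟶ Z}
    (hg : IsNegligible g) : IsNegligible (f ≫ g) := fun h => by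
  rw [Category.assoc, trace_comp_comm, Category.assoc]
  exact hg _

lemma IsNegligible.comp_right {X Y Z : FDRep k G} {f : X ⟶ Y} (hf : IsNegligible f)
    (g : Y ⟶ Z) : IsNegligible (f ≫ g) := fun h => by
  rw [Category.assoc]
  exact hf _

/-- The contraction of an intertwining map is an intertwining map. -/
def contract {X Y : FDRep k G} (Z : FDRep k G) (h : Y ⊗ Z ⟶ X ⊗ Z) : Y ⟶ X where
  hom := FGModuleCat.ofHom (partialTrace k X Y Z h.hom.hom.hom)
  comm g := by
    have hh (a : G) : h.hom.hom.hom ∘ₗ TensorProduct.map (Y.ρ a) (Z.ρ a) =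
        TensorProduct.map (X.ρ a) (Z.ρ a) ∘ₗ h.hom.hom.hom :=
      congrArg (fun t => t.hom.hom) (h.comm a)
    have hinv (V : FDRep k G) : V.ρ g⁻¹ ∘ₗ V.ρ g = LinearMap.id := by
      rw [← Module.End.mul_eq_comp, ← map_mul, inv_mul_cancel, map_one]; rfl
    have h1 : TensorProduct.map (X.ρ g) (Z.ρ g) ∘ₗ h.hom.hom.hom ∘ₗ
        TensorProduct.map (Y.ρ g⁻¹) (Z.ρ g⁻¹) = h.hom.hom.hom := by
      rw [← LinearMap.comp_assoc, ← hh g, LinearMap.comp_assoc, ← TensorProduct.map_comp,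
        ← Module.End.mul_eq_comp, ← Module.End.mul_eq_comp, ← map_mul, ← map_mul,
        mul_inv_cancel, map_one, map_one]
      exact (congrArg _ TensorProduct.map_id).trans (LinearMap.comp_id _)
    have h2 := partialTrace_conj (X.ρ g) (Y.ρ g⁻¹) (Z.ρ g) (Z.ρ g⁻¹) (hinv Z) h.hom.hom.hom
    rw [h1] at h2
    apply FGModuleCat.hom_ext
    change partialTrace k X Y Z h.hom.hom.hom ∘ₗ Y.ρ g =
      X.ρ g ∘ₗ partialTrace k X Y Z h.hom.hom.hom
    conv_lhs => rw [h2]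
    rw [LinearMap.comp_assoc, LinearMap.comp_assoc, hinv Y]
    exact congrArg _ (LinearMap.comp_id _)

lemma IsNegligible.whiskerRight {X Y : FDRep k G} {f : X ⟶ Y} (hf : IsNegligible f)
    (Z : FDRep k G) : IsNegligible (f ▷ Z) := fun h =>
  (trace_comp_partialTrace (k := k) f.hom.hom.hom h.hom.hom.hom).trans (hf (contract Z h))

lemma IsNegligible.whiskerLeft {X Y : FDRep k G} {f : X ⟶ Y} (hf : IsNegligible f)
    (Z : FDRep k G) : IsNegligible (Z ◁ f) := by
  have h : Z ◁ f = (β_ Z X).hom ≫ f ▷ Z ≫ (β_ Z Y).inv := by simp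
  rw [h]
  exact ((hf.whiskerRight Z).comp_right _).comp_left _

end FDRep

instance : Congruence (negligibleRel k G) where
  equivalence :=
    { refl := fun f => by
        change FDRep.IsNegligible (f - f)
        rw [sub_self]
        exact .zero
      symm := fun {f g} h => by
        change FDRep.IsNegligible (g - f)
        rw [← neg_sub]
        exact h.neg
      trans := fun {f g h} h₁ h₂ => by
        change FDRep.IsNegligible (f - h)
        rw [← sub_add_sub_cancel f g h]
        exact h₁.add h₂ }
  comp_left f g g' h := by
    change FDRep.IsNegligible (f ≫ g - f ≫ g')
    rw [← Preadditive.comp_sub]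
    exact h.comp_left f
  comp_right g h := by
    change FDRep.IsNegligible (_ ≫ g - _ ≫ g)
    rw [← Preadditive.sub_comp]
    exact h.comp_right g

/-- The semisimplification of `Rep G`: the quotient of the category of finite dimensional
representations by the ideal of negligible morphisms. -/
abbrev Semisimplification : Type (max (u + 1) v) := CategoryTheory.Quotient (negligibleRel k G)

namespace Semisimplification

/-- The quotient functor to the semisimplification. -/
abbrev functor : FDRep k G ⥤ Semisimplification k G :=
  CategoryTheory.Quotient.functor (negligibleRel k G)

lemma negligibleRel_add ⦃X Y : FDRep k G⦄ (f₁ f₂ g₁ g₂ : X ⟶ Y)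
    (hf : negligibleRel k G f₁ f₂) (hg : negligibleRel k G g₁ g₂) :
    negligibleRel k G (f₁ + g₁) (f₂ + g₂) := by
  change FDRep.IsNegligible (f₁ + g₁ - (f₂ + g₂))
  rw [add_sub_add_comm]
  exact FDRep.IsNegligible.add hf hg

instance : Preadditive (Semisimplification k G) :=
  CategoryTheory.Quotient.preadditive _ (negligibleRel_add k G)

instance : (functor k G).Additive :=
  CategoryTheory.Quotient.functor_additive _ (negligibleRel_add k G)

instance : HasBinaryBiproducts (Semisimplification k G) where
  has_binary_biproduct X Y :=
    HasBinaryBiproduct.mk ⟨(functor k G).mapBinaryBicone (BinaryBiproduct.bicone X.as Y.as),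
      isBinaryBilimitOfTotal _ ((((functor k G).map_add).symm.trans
        (congrArg (functor k G).map (biprod.total (X := X.as) (Y := Y.as)))).trans
          ((functor k G).map_id _))⟩

variable {k G}

lemma negligibleRel_whiskerLeft (X : FDRep k G) {Y Z : FDRep k G} {f g : Y ⟶ Z}
    (h : negligibleRel k G f g) : negligibleRel k G (X ◁ f) (X ◁ g) := by
  change FDRep.IsNegligible ((tensorLeft X).map f - (tensorLeft X).map g)
  rw [← Functor.map_sub]
  exact FDRep.IsNegligible.whiskerLeft h X

lemma negligibleRel_whiskerRight {Y Z : FDRep k G} {f g : Y ⟶ Z}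
    (h : negligibleRel k G f g) (X : FDRep k G) : negligibleRel k G (f ▷ X) (g ▷ X) := by
  change FDRep.IsNegligible ((tensorRight X).map f - (tensorRight X).map g)
  rw [← Functor.map_sub]
  exact FDRep.IsNegligible.whiskerRight h X

/-- Tensoring a morphism of the semisimplification with an object on the left. -/
def whiskerL (X : Semisimplification k G) {Y Z : Semisimplification k G} (f : Y ⟶ Z) :
    (functor k G).obj (X.as ⊗ Y.as) ⟶ (functor k G).obj (X.as ⊗ Z.as) :=
  Quot.lift (fun f => (functor k G).map (X.as ◁ f)) (fun f g h => by
    rw [HomRel.compClosure_iff_self] at h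
    exact CategoryTheory.Quotient.sound _ (negligibleRel_whiskerLeft X.as h)) f

/-- Tensoring a morphism of the semisimplification with an object on the right. -/
def whiskerR {Y Z : Semisimplification k G} (f : Y ⟶ Z) (X : Semisimplification k G) :
    (functor k G).obj (Y.as ⊗ X.as) ⟶ (functor k G).obj (Z.as ⊗ X.as) :=
  Quot.lift (fun f => (functor k G).map (f ▷ X.as)) (fun f g h => by
    rw [HomRel.compClosure_iff_self] at h
    exact CategoryTheory.Quotient.sound _ (negligibleRel_whiskerRight h X.as)) f

/-- The tensor product induced on the semisimplification. -/
instance : MonoidalCategoryStruct (Semisimplification k G) where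
  tensorObj X Y := (functor k G).obj (X.as ⊗ Y.as)
  whiskerLeft X _ _ f := whiskerL X f
  whiskerRight f X := whiskerR f X
  tensorHom f g := whiskerR f _ ≫ whiskerL _ g
  tensorUnit := (functor k G).obj (𝟙_ _)
  associator X Y Z := (functor k G).mapIso (α_ X.as Y.as Z.as)
  leftUnitor X := (functor k G).mapIso (λ_ X.as)
  rightUnitor X := (functor k G).mapIso (ρ_ X.as)

lemma map_whiskerLeft (X : FDRep k G) {Y Z : FDRep k G} (f : Y ⟶ Z) :
    (functor k G).obj X ◁ (functor k G).map f = (functor k G).map (X ◁ f) := rfl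

lemma map_whiskerRight {Y Z : FDRep k G} (f : Y ⟶ Z) (X : FDRep k G) :
    (functor k G).map f ▷ (functor k G).obj X = (functor k G).map (f ▷ X) := rfl

lemma map_tensorHom {X Y Z W : FDRep k G} (f : X ⟶ Y) (g : Z ⟶ W) :
    (functor k G).map f ⊗ₘ (functor k G).map g = (functor k G).map (f ⊗ₘ g) := by
  rw [MonoidalCategory.tensorHom_def f g, Functor.map_comp]
  rfl

instance : MonoidalCategory (Semisimplification k G) where
  tensorHom_def _ _ := rfl
  id_tensorHom_id X Y := (map_tensorHom (𝟙 X.as) (𝟙 Y.as)).trans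
    (congrArg (functor k G).map (MonoidalCategory.id_tensorHom_id X.as Y.as))
  tensorHom_comp_tensorHom := by
    rintro ⟨X₁⟩ ⟨Y₁⟩ ⟨Z₁⟩ ⟨X₂⟩ ⟨Y₂⟩ ⟨Z₂⟩ ⟨f₁⟩ ⟨f₂⟩ ⟨g₁⟩ ⟨g₂⟩
    have h := congrArg (functor k G).map (MonoidalCategory.tensorHom_comp_tensorHom f₁ f₂ g₁ g₂)
    rwa [Functor.map_comp, ← map_tensorHom, ← map_tensorHom, ← map_tensorHom] at h
  whiskerLeft_id X Y := congrArg (functor k G).map (MonoidalCategory.whiskerLeft_id X.as Y.as)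
  id_whiskerRight X Y := congrArg (functor k G).map (MonoidalCategory.id_whiskerRight X.as Y.as)
  associator_naturality := by
    rintro ⟨X₁⟩ ⟨X₂⟩ ⟨X₃⟩ ⟨Y₁⟩ ⟨Y₂⟩ ⟨Y₃⟩ ⟨f₁⟩ ⟨f₂⟩ ⟨f₃⟩
    have h := congrArg (functor k G).map (MonoidalCategory.associator_naturality f₁ f₂ f₃)
    rwa [Functor.map_comp, Functor.map_comp, ← map_tensorHom, ← map_tensorHom, ← map_tensorHom,
      ← map_tensorHom] at h
  leftUnitor_naturality := by
    rintro ⟨X⟩ ⟨Y⟩ ⟨f⟩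
    exact congrArg (functor k G).map (MonoidalCategory.leftUnitor_naturality f)
  rightUnitor_naturality := by
    rintro ⟨X⟩ ⟨Y⟩ ⟨f⟩
    exact congrArg (functor k G).map (MonoidalCategory.rightUnitor_naturality f)
  pentagon W X Y Z := congrArg (functor k G).map
    (MonoidalCategory.pentagon W.as X.as Y.as Z.as)
  triangle X Y := congrArg (functor k G).map (MonoidalCategory.triangle X.as Y.as)

instance : SymmetricCategory (Semisimplification k G) where
  braiding X Y := (functor k G).mapIso (β_ X.as Y.as)
  braiding_naturality_right := by
    rintro ⟨X⟩ ⟨Y⟩ ⟨Z⟩ ⟨f⟩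
    exact congrArg (functor k G).map (BraidedCategory.braiding_naturality_right X f)
  braiding_naturality_left := by
    rintro ⟨X⟩ ⟨Y⟩ ⟨f⟩ ⟨Z⟩
    exact congrArg (functor k G).map (BraidedCategory.braiding_naturality_left f Z)
  hexagon_forward X Y Z := congrArg (functor k G).map
    (BraidedCategory.hexagon_forward X.as Y.as Z.as)
  hexagon_reverse X Y Z := congrArg (functor k G).map
    (BraidedCategory.hexagon_reverse X.as Y.as Z.as)
  symmetry X Y := congrArg (functor k G).map (SymmetricCategory.symmetry X.as Y.as)

end Semisimplification

end Semisimplification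

/-! ### Representations of cyclic `p`-groups and the Verlinde category -/

section Cyclic

variable (k : Type u) [Field k] (p : ℕ)

/-- The cyclic group `ℤ/p^n`, written multiplicatively. -/
abbrev CyclicGrp (n : ℕ) : Type := Multiplicative (ZMod (p ^ n))

/-- The surjection `ℤ/p^(n+1) → ℤ/p^n`. -/
def cyclicProj (n : ℕ) : CyclicGrp p (n + 1) →* CyclicGrp p n :=
  AddMonoidHom.toMultiplicative
    (ZMod.castHom (pow_dvd_pow p n.le_succ) (ZMod (p ^ n))).toAddMonoidHom

variable {k} in
/-- A representation of `ℤ/p^n`, viewed as a representation of `ℤ/p^(n+1)`. -/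
def inflate {n : ℕ} (V : FDRep k (CyclicGrp p n)) : FDRep k (CyclicGrp p (n + 1)) :=
  (Action.res (FGModuleCat k) (cyclicProj p n)).obj V

/-- The Verlinde category: the semisimplification of the category of finite dimensional
representations of `ℤ/p` over a field `k` of characteristic `p`. -/
abbrev Ver : Type (u + 1) := Semisimplification k (CyclicGrp p 1)

/-- The distinguished basis of the Grothendieck ring of the (semisimple) Verlinde category: the
classes of the simple objects. -/
def Ver.basisSet : Set (GreenRing (Ver k p)) :=
  {x | ∃ L : Ver k p, Simple L ∧ x = GreenRing.cls L}

end Cyclic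

/-! ### The ring `K_p` -/

section Kp

open Polynomial

/-- The polynomials `P₀ = 1`, `P₁ = x`, `P_{i+1} = x P_i - P_i - P_{i-1}`, expressing the basis
elements of `K_p` in terms of the generator `X₁`. -/
def kPoly : ℕ → ℤ[X]
  | 0 => 1
  | 1 => X
  | i + 2 => X * kPoly (i + 1) - kPoly (i + 1) - kPoly i

/-- The ring `K_p` generated by `X₁`, with the last relation `X₁ X_{p-1} = X_{p-2}`. -/
def KRing (p : ℕ) : Type := ℤ[X] ⧸ Ideal.span {X * kPoly (p - 1) - kPoly (p - 2)}

instance (p : ℕ) : CommRing (KRing p) :=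
  inferInstanceAs (CommRing (ℤ[X] ⧸ Ideal.span {X * kPoly (p - 1) - kPoly (p - 2)}))

/-- The elements `X_i` of `K_p`; those with `0 ≤ i ≤ p - 1` form the distinguished basis. -/
def KRing.gen (p i : ℕ) : KRing p :=
  Ideal.Quotient.mk (Ideal.span {X * kPoly (p - 1) - kPoly (p - 2)}) (kPoly i)

/-- The distinguished basis of `K_p`. -/
def KRing.basisSet (p : ℕ) : Set (KRing p) := Set.range fun i : Fin p => KRing.gen p i

end Kp

/-! ### Based rings -/

section Based

open Classical in
/-- `B` is the distinguished basis of a (commutative, unital) based ring structure on `A`: it is a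
`ℤ`-basis containing `1`, with nonnegative structure constants, and there is an involution `σ` of
`B` whose linear extension is an anti-involution of the ring `A`, such that the
coefficient of `1` in `x y` is `1` if `y = σ x` and `0` otherwise. -/
def IsBasedRing {A : Type u} [CommRing A] (B : Set A) : Prop :=
  ∃ (b : Module.Basis B ℤ A) (_ : ∀ x : B, b x = x) (h1 : (1 : A) ∈ B),
    (∀ x y z : B, 0 ≤ b.repr (x * y) z) ∧
    ∃ σ : B → B, Function.Involutive σ ∧
      (∀ x y z : B, b.repr (σ y * σ x) (σ z) = b.repr (x * y) z) ∧
      ∀ x y : B, b.repr (x * y) ⟨1, h1⟩ = if y = σ x then 1 else 0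

/-- The distinguished basis of a tensor product of two based rings. -/
def tensorBasisSet {A : Type u} {A' : Type v} [CommRing A] [CommRing A'] (B : Set A)
    (B' : Set A') : Set (A ⊗[ℤ] A') :=
  {x | ∃ b ∈ B, ∃ b' ∈ B', x = b ⊗ₜ[ℤ] b'}

/-- The tensor power `K_p^{⊗ m}`. -/
abbrev KPower (p m : ℕ) : Type := PiTensorProduct ℤ (fun _ : Fin m => KRing p)

/-- The distinguished basis of `K_p^{⊗ m}`. -/
def KPower.basisSet (p m : ℕ) : Set (KPower p m) :=
  {x | ∃ b : Fin m → KRing p, (∀ j, b j ∈ KRing.basisSet p) ∧ x = PiTensorProduct.tprod ℤ b}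

/-- Isomorphism of based rings: a ring isomorphism which restricts to a bijection between the
distinguished bases. -/
def BasedIso {A : Type u} {A' : Type v} [CommRing A] [CommRing A'] (B : Set A) (B' : Set A')
    (e : A ≃+* A') : Prop :=
  e '' B = B'

end Based

end

/-!
# The Green ring of `ℤ/p^n` modulo negligible representations

Write `g` for the generator of `ℤ/p^N`, and `J_m` for the Jordan block of size `m`, realised as
`TruncPoly k m = k[t]/(t^m)` with `g` acting by `1 + t`. Every representation is a direct sum of
blocks with `1 ≤ m ≤ p^N`, and the Jordan type is determined by the ranks of the powers of `g - 1`.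
Hence any additive invariant of a representation can be computed from these ranks
(`exists_jordanType`, `FDRep.additive_eq_of_rk_eq`).

**Products of blocks.** Replacing `J_b` by the isomorphic representation on which `g` acts by
`(1 + t)⁻¹`, one sees that `g - 1` acts on `J_a ⊗ J_b = k[x, y]/(x^a, y^b)` as multiplication by
`z = x - y` up to a unit (`rk_jordan_tensor`). If `x^d z^c` is divisible by `z^(c+1)`, then passing
from `z^c` to `z^(c+1)` lowers the rank by at most `d` (`finrank_range_mulLeft_pow_le`). The total
drop is `ab`, so if these upper bounds are those of a Jordan type of total size `ab`, all of them
are equalities and this is the Jordan type of the product (`rank_eq_of_drop_le`,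
`cls_jordan_mul`). The divisibilities themselves come from `(x - y)^q = x^q - y^q` with `q = p^n`.
With `2 ≤ q`, and modulo blocks of size divisible by `p`, the resulting formulas are
* `J_a J_(iq+1) = J_(iq+a)` and `J_a J_(iq+q-1) = J_(iq+q-a)` for `1 ≤ a < q`;
* `J_(q+1) J_(iq+1) = J_((i+1)q+1) + J_((i-1)q+1) + J_((i+1)q-1)` for `1 ≤ i ≤ p - 2`;
* `J_(q+1) J_((p-1)q+1) = J_((p-2)q+1)`.

**Bases.** An endomorphism of a block is a scalar plus a nilpotent, and a map between blocks of
different sizes is negligible. So in the semisimplification the blocks of size divisible by `p`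
vanish, and the other ones become simple and are separated by the dimensions of their `Hom` spaces.
Therefore the non-negligible blocks are linearly independent there, hence also in `Ḡ_N`, where they
span: they form a basis of both rings, which is the isomorphism `Ḡ_1 ≅ Gr(Ver_p)`
(`linearIndependent_obj_jordan`, `equivSemisimplification`). The coefficient of `1` in `J_a J_b` is
the multiplicity of `J_1` in `J_a ⊗ J_b`, a second difference of the ranks of `1, z, z^2`. For
`a ≤ b` and `p ∤ a` it is read off from the kernel of `z`, and equals `1` if `a = b` and `0`
otherwise (`TruncPoly.finrank_range_sub_sq`). So the basis is self-dual with trivial involution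
(`isSelfDualBasis`).

**The tensor decomposition.** In `Ḡ_{n+1}` put `ω = J_(q-1)`; then `ω^2 = 1`, and the three product
formulas imply that `X_i ↦ ω^i J_(iq+1)` respects the relations of `K_p` (`exists_kHom`). The
image of `X_i` is `J_(iq+1)` or `J_((i+1)q-1)` according to the parity of `i`, and its product with
the inflated block `J_a` is the block of size `foldSize p n i a` (`block_mul_foldSize`). Division
with remainder by `q` shows that every non-negligible block size at level `n + 1` arises exactly
once in this way (`foldSize_bijective`), so the map `Ḡ_n ⊗ K_p → Ḡ_{n+1}` carries basis to basis
(`tensorEquiv`). For `K_p` itself, `X_0, …, X_{p-1}` span by the recursion, and are linearly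
independent because their images in the Green ring of `ℤ/p^2` are distinct blocks
(`linearIndependent_gen`). Iterating `tensorEquiv`, starting from `Ḡ_1 ≅ Gr(Ver_p)`, expresses
`Ḡ_n` as a tensor power (`exists_equiv_tensorPower`).
-/

noncomputable section

/-! ### Representations of cyclic groups -/

namespace FDRep

section Linear

variable {k : Type u} [Field k] {G : Type v} [Monoid G]

/-- The linear map underlying a morphism of representations. -/
abbrev lin {V W : FDRep k G} (f : V ⟶ W) : V →ₗ[k] W := f.hom.hom.hom

lemma lin_comp {U V W : FDRep k G} (f : U ⟶ V) (g : V ⟶ W) : lin (f ≫ g) = lin g ∘ₗ lin f := rfl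

lemma lin_id (V : FDRep k G) : lin (𝟙 V) = LinearMap.id := rfl

lemma lin_add {V W : FDRep k G} (f g : V ⟶ W) : lin (f + g) = lin f + lin g := rfl

lemma lin_injective {V W : FDRep k G} {f g : V ⟶ W} (h : lin f = lin g) : f = g :=
  Action.Hom.ext (FGModuleCat.hom_ext h)

lemma lin_apply_ρ {V W : FDRep k G} (f : V ⟶ W) (g : G) (x : V) :
    lin f (V.ρ g x) = W.ρ g (lin f x) :=
  LinearMap.congr_fun (congrArg (fun t => t.hom.hom) (f.comm g) :
    lin f ∘ₗ V.ρ g = W.ρ g ∘ₗ lin f) x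

/-- The morphism of representations given by an equivariant linear map. -/
def ofLin {V W : FDRep k G} (φ : V →ₗ[k] W) (h : ∀ g, φ ∘ₗ V.ρ g = W.ρ g ∘ₗ φ) : V ⟶ W where
  hom := FGModuleCat.ofHom φ
  comm g := FGModuleCat.hom_ext (h g)

/-- An isomorphism of representations is an isomorphism of vector spaces. -/
def linEquiv {V W : FDRep k G} (e : V ≅ W) : V ≃ₗ[k] W :=
  LinearEquiv.ofLinearMap (lin e.hom) (lin e.inv)
    (by rw [← lin_comp, e.inv_hom_id, lin_id]) (by rw [← lin_comp, e.hom_inv_id, lin_id])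

/-- The vector space underlying a biproduct of representations. -/
def biprodEquiv (V W : FDRep k G) : (V ⊞ W : FDRep k G) ≃ₗ[k] V × W :=
  LinearEquiv.ofLinearMap ((lin biprod.fst).prod (lin biprod.snd))
    ((lin biprod.inl).coprod (lin biprod.inr))
    (by
      apply LinearMap.prod_ext
      · rw [LinearMap.comp_assoc, LinearMap.coprod_inl]
        have h1 := congrArg lin (biprod.inl_fst (X := V) (Y := W))
        have h2 := congrArg lin (biprod.inl_snd (X := V) (Y := W))
        ext x
        · exact LinearMap.congr_fun h1 x
        · exact LinearMap.congr_fun h2 x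
      · rw [LinearMap.comp_assoc, LinearMap.coprod_inr]
        have h1 := congrArg lin (biprod.inr_fst (X := V) (Y := W))
        have h2 := congrArg lin (biprod.inr_snd (X := V) (Y := W))
        ext x
        · exact LinearMap.congr_fun h1 x
        · exact LinearMap.congr_fun h2 x)
    (by
      rw [LinearMap.coprod_comp_prod, ← lin_comp, ← lin_comp, ← lin_add, biprod.total, lin_id])

lemma biprodEquiv_apply (V W : FDRep k G) (x : (V ⊞ W : FDRep k G)) :
    biprodEquiv V W x = (lin (biprod.fst : V ⊞ W ⟶ V) x, lin (biprod.snd : V ⊞ W ⟶ W) x) := rfl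

lemma isZero_of_finrank_eq_zero {V : FDRep k G} (h : Module.finrank k V = 0) : IsZero V := by
  rw [IsZero.iff_id_eq_zero]
  apply lin_injective
  have := Module.finrank_zero_iff.mp h
  ext x
  exact Subsingleton.elim _ _

lemma finrank_eq_zero_of_isZero {V : FDRep k G} (h : IsZero V) : Module.finrank k V = 0 := by
  rw [IsZero.iff_id_eq_zero] at h
  have h1 : (LinearMap.id : V →ₗ[k] V) = 0 := congrArg lin h
  rw [Module.finrank_zero_iff]
  exact ⟨fun x y => (LinearMap.congr_fun h1 x).trans (LinearMap.congr_fun h1 y).symm⟩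

end Linear

end FDRep

lemma LinearMap.finrank_range_pow_eq_of_conj {k M M' : Type*} [Field k] [AddCommGroup M]
    [AddCommGroup M'] [Module k M] [Module k M'] (e : M ≃ₗ[k] M') (f : Module.End k M)
    (g : Module.End k M') (h : ∀ x, e (f x) = g (e x)) (c : ℕ) :
    Module.finrank k (LinearMap.range (f ^ c)) = Module.finrank k (LinearMap.range (g ^ c)) := by
  have hc : ∀ x, e ((f ^ c) x) = (g ^ c) (e x) := by
    induction c with
    | zero => simp
    | succ c ih => intro x; rw [pow_succ, pow_succ, Module.End.mul_apply, Module.End.mul_apply,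
        ih, h]
  rw [← LinearEquiv.finrank_map_eq e]
  suffices (LinearMap.range (f ^ c)).map (e : M →ₗ[k] M') = LinearMap.range (g ^ c) by rw [this]
  ext y
  constructor
  · rintro ⟨_, ⟨x, rfl⟩, rfl⟩
    exact ⟨e x, (hc x).symm⟩
  · rintro ⟨x, rfl⟩
    exact ⟨_, ⟨e.symm x, rfl⟩, by simpa using hc (e.symm x)⟩

namespace FDRep

section Cyclic

variable {k : Type u} [Field k] {p N : ℕ}

/-- The operator `g - 1` on a representation of `ℤ/p^N`, where `g` is the standard generator. -/
def nilp (V : FDRep k (CyclicGrp p N)) : Module.End k V := V.ρ (Multiplicative.ofAdd 1) - 1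

/-- The rank of `(g - 1)^c`, where `g` is the standard generator of `ℤ/p^N`. -/
def rk (V : FDRep k (CyclicGrp p N)) (c : ℕ) : ℕ :=
  Module.finrank k (LinearMap.range (V.nilp ^ c))

lemma rk_zero (V : FDRep k (CyclicGrp p N)) : V.rk 0 = Module.finrank k V := by
  rw [rk, pow_zero, Module.End.one_eq_id, LinearMap.range_id, finrank_top]

lemma nilp_pow_eq_zero_iff (V : FDRep k (CyclicGrp p N)) (c : ℕ) : V.nilp ^ c = 0 ↔ V.rk c = 0 := by
  rw [rk, Submodule.finrank_eq_zero, LinearMap.range_eq_bot]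

lemma lin_nilp {V W : FDRep k (CyclicGrp p N)} (f : V ⟶ W) (x : V) :
    lin f (V.nilp x) = W.nilp (lin f x) := by
  rw [nilp, nilp, LinearMap.sub_apply, map_sub, lin_apply_ρ]
  rfl

lemma rk_eq_of_iso {V W : FDRep k (CyclicGrp p N)} (e : V ≅ W) (c : ℕ) : V.rk c = W.rk c :=
  LinearMap.finrank_range_pow_eq_of_conj (linEquiv e) _ _ (lin_nilp e.hom) c

lemma finrank_eq_of_iso {V W : FDRep k (CyclicGrp p N)} (e : V ≅ W) :
    Module.finrank k V = Module.finrank k W := (linEquiv e).finrank_eq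

lemma rk_biprod (V W : FDRep k (CyclicGrp p N)) (c : ℕ) : (V ⊞ W).rk c = V.rk c + W.rk c := by
  have h : (V ⊞ W).rk c = Module.finrank k (LinearMap.range
      ((V.nilp.prodMap W.nilp : Module.End k (V × W)) ^ c)) :=
    LinearMap.finrank_range_pow_eq_of_conj (biprodEquiv V W) _ _ (fun x => by
      rw [biprodEquiv_apply, lin_nilp, lin_nilp]; rfl) c
  have h2 : (V.nilp.prodMap W.nilp : Module.End k (V × W)) ^ c =
      (V.nilp ^ c).prodMap (W.nilp ^ c) :=
    (map_pow (LinearMap.prodMapRingHom k V W) (V.nilp, W.nilp) c).symm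
  rw [h, h2, LinearMap.range_prodMap, rk, rk, ← Module.finrank_prod]
  exact LinearEquiv.finrank_eq
    { toFun := fun x => (⟨x.1.1, x.2.1⟩, ⟨x.1.2, x.2.2⟩)
      invFun := fun x => ⟨(x.1.1, x.2.1), x.1.2, x.2.2⟩
      map_add' := fun _ _ => rfl
      map_smul' := fun _ _ => rfl }

variable [Fact p.Prime]

lemma eq_generator_pow (g : CyclicGrp p N) :
    g = (Multiplicative.ofAdd 1 : CyclicGrp p N) ^ (ZMod.val g.toAdd) := by
  rw [← ofAdd_nsmul, nsmul_one, ZMod.natCast_zmod_val, ofAdd_toAdd]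

/-- Maps commuting with the action of the generator are morphisms of representations. -/
def ofNilp {V W : FDRep k (CyclicGrp p N)} (φ : V →ₗ[k] W)
    (h : ∀ x, φ (V.nilp x) = W.nilp (φ x)) : V ⟶ W :=
  ofLin φ fun g => by
    have h1 : φ ∘ₗ V.ρ (Multiplicative.ofAdd 1) = W.ρ (Multiplicative.ofAdd 1) ∘ₗ φ := by
      ext x
      have := h x
      rw [nilp, nilp, LinearMap.sub_apply, LinearMap.sub_apply, map_sub] at this
      exact sub_left_injective this
    rw [eq_generator_pow g, map_pow, map_pow]
    induction (ZMod.val g.toAdd) with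
    | zero => rfl
    | succ n ih =>
      rw [pow_succ, pow_succ, Module.End.mul_eq_comp, Module.End.mul_eq_comp,
        ← LinearMap.comp_assoc, ih, LinearMap.comp_assoc, h1, LinearMap.comp_assoc]

/-- `(g - 1)^(p^N) = g^(p^N) - 1 = 0` in characteristic `p`. -/
lemma nilp_pow_eq_zero [CharP k p] (V : FDRep k (CyclicGrp p N)) : V.nilp ^ p ^ N = 0 := by
  have h1 : (Polynomial.X - 1 : Polynomial k) ^ p ^ N = Polynomial.X ^ p ^ N - 1 := by
    rw [sub_pow_char_pow, one_pow]
  have h2 := congrArg (Polynomial.aeval (V.ρ (Multiplicative.ofAdd (1 : ZMod (p ^ N))))) h1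
  simp only [map_pow, map_sub, Polynomial.aeval_X, map_one] at h2
  have h3 : (Multiplicative.ofAdd (1 : ZMod (p ^ N))) ^ p ^ N = 1 := by
    rw [← ofAdd_nsmul, nsmul_one, ZMod.natCast_self, ofAdd_zero]
  rw [nilp, h2, ← map_pow, h3, map_one, sub_self]

/-- The homomorphism from `ℤ/p^N` that sends the generator to an element `u` with `u^(p^N) = 1`. -/
def powHom {A : Type*} [Monoid A] (u : A) (hu : u ^ p ^ N = 1) : CyclicGrp p N →* A where
  toFun g := u ^ ZMod.val g.toAdd
  map_one' := by simp
  map_mul' g h := by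
    rw [toAdd_mul, ZMod.val_add, ← pow_eq_pow_mod _ hu, pow_add]

lemma powHom_generator {A : Type*} [Monoid A] (u : A) (hu : u ^ p ^ N = 1) :
    powHom u hu (Multiplicative.ofAdd 1 : CyclicGrp p N) = u := by
  change u ^ ZMod.val (1 : ZMod (p ^ N)) = u
  rw [ZMod.val_one_eq_one_mod, ← pow_eq_pow_mod _ hu, pow_one]

/-- The representation of `ℤ/p^N` on a commutative algebra in which the generator acts as
multiplication by `u`. -/
def regRep (A : Type u) [CommRing A] [Algebra k A] [Module.Finite k A] (u : A)
    (hu : u ^ p ^ N = 1) : FDRep k (CyclicGrp p N) :=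
  FDRep.of (V := A) (((Algebra.lmul k A : A →ₐ[k] Module.End k A) : A →* Module.End k A).comp
    (powHom u hu))

variable {A : Type u} [CommRing A] [Algebra k A] [Module.Finite k A] (u : A)
    (hu : u ^ p ^ N = 1)

lemma regRep_ρ_generator :
    (regRep (k := k) A u hu).ρ (Multiplicative.ofAdd 1) = LinearMap.mulLeft k u := by
  change Algebra.lmul k A (powHom u hu _) = _
  rw [powHom_generator]
  rfl

lemma regRep_nilp : (regRep (k := k) A u hu).nilp = LinearMap.mulLeft k (u - 1) := by
  rw [nilp, regRep_ρ_generator]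
  refine LinearMap.ext fun (x : A) => ?_
  change u * x - x = (u - 1) * x
  ring

lemma regRep_rk (c : ℕ) : (regRep (k := k) A u hu).rk c =
    Module.finrank k (LinearMap.range (LinearMap.mulLeft k ((u - 1) ^ c))) := by
  rw [← LinearMap.pow_mulLeft, rk, regRep_nilp]
  rfl

lemma regRep_tensor_rk {A B : Type u} [CommRing A] [Algebra k A] [Module.Finite k A]
    [CommRing B] [Algebra k B] [Module.Finite k B] (u : A) (hu : u ^ p ^ N = 1) (v : B)
    (hv : v ^ p ^ N = 1) (c : ℕ) :
    (regRep (k := k) A u hu ⊗ regRep (k := k) B v hv).rk c =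
      Module.finrank k (LinearMap.range (LinearMap.mulLeft k ((u ⊗ₜ[k] v - 1) ^ c))) := by
  have h1 : (regRep (k := k) A u hu ⊗ regRep (k := k) B v hv).ρ
      (Multiplicative.ofAdd 1) =
        TensorProduct.map (LinearMap.mulLeft k u) (LinearMap.mulLeft k v) :=
    congrArg₂ (fun f g => TensorProduct.map f g) (regRep_ρ_generator u hu)
      (regRep_ρ_generator v hv)
  have h2 : (regRep (k := k) A u hu ⊗ regRep (k := k) B v hv).nilp =
      LinearMap.mulLeft k (u ⊗ₜ[k] v - 1) := by
    rw [nilp, h1]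
    refine LinearMap.ext fun (x : A ⊗[k] B) => ?_
    change TensorProduct.map (LinearMap.mulLeft k u) (LinearMap.mulLeft k v) x - x =
      (u ⊗ₜ[k] v - 1) * x
    rw [sub_mul, one_mul]
    congr 1
    induction x with
    | zero => simp
    | add x y hx hy => rw [map_add, hx, hy, mul_add]
    | tmul x y => simp
  rw [← LinearMap.pow_mulLeft, rk, h2]
  rfl

end Cyclic

end FDRep

/-! ### Jordan types from rank bounds -/

lemma Multiset.sum_map_sub_succ (S : Multiset ℕ) (c : ℕ) :
    (S.map fun s => s - c).sum =
      (S.map fun s => s - (c + 1)).sum + (S.map fun s => if c < s then 1 else 0).sum := by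
  rw [← Multiset.sum_map_add]
  congr 1
  refine Multiset.map_congr rfl fun s _ => ?_
  split_ifs <;> omega

/-- Let `r` be the sequence of ranks of the powers of a nilpotent operator on a space of dimension
`∑ S`. If each of the drops `r c - r (c + 1)` is at most the one for Jordan type `S`, then the drops
agree, since both sequences have the same total drop. -/
lemma rank_eq_of_drop_le {r : ℕ → ℕ} {S : Multiset ℕ} {M : ℕ} (h0 : r 0 = S.sum)
    (hM : ∀ c, M ≤ c → r c = 0)
    (hr : ∀ c, r c ≤ r (c + 1) + (S.map fun s => if c < s then 1 else 0).sum) (c : ℕ) :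
    r c = (S.map fun s => s - c).sum := by
  have hmono : ∀ c d, (S.map fun s => s - (c + d)).sum + r c ≤
      (S.map fun s => s - c).sum + r (c + d) := by
    intro c d
    induction d with
    | zero => simp
    | succ d ih =>
      have := Multiset.sum_map_sub_succ S (c + d)
      have := hr (c + d)
      rw [← add_assoc]
      omega
  have h1 := hmono c M
  have h3 := hM (c + M) (by omega)
  have h2 := hmono 0 c
  simp only [Nat.sub_zero, Multiset.map_id', h0, zero_add] at h2
  omega

/-- If modulo `z` every element of `A` is a polynomial in `x`, and `x^d z^c` is divisible by
`z^(c+1)`, then `z^c A / z^(c+1) A` is spanned by `z^c, x z^c, …, x^(d-1) z^c`. -/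
lemma finrank_range_mulLeft_pow_le {k A : Type*} [Field k] [CommRing A] [Algebra k A]
    [Module.Finite k A] {x z : A} (hgen : ∀ a : A, ∃ (f : Polynomial k) (w : A),
      a = Polynomial.aeval x f + z * w) {c d : ℕ} (h : z ^ (c + 1) ∣ x ^ d * z ^ c) :
    Module.finrank k (LinearMap.range (LinearMap.mulLeft k (z ^ c))) ≤
      Module.finrank k (LinearMap.range (LinearMap.mulLeft k (z ^ (c + 1)))) + d := by
  classical
  set B : Submodule k A := LinearMap.range (LinearMap.mulLeft k (z ^ (c + 1))) with hB
  have hmem : ∀ w, z ^ (c + 1) ∣ w → w ∈ B := by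
    rintro _ ⟨w, rfl⟩
    exact ⟨w, rfl⟩
  set E : Finset A := (Finset.range d).image fun e => x ^ e * z ^ c with hE
  have hpow : ∀ e, x ^ e * z ^ c ∈ B ⊔ Submodule.span k (E : Set A) := by
    intro e
    by_cases hed : e < d
    · refine Submodule.mem_sup_right (Submodule.subset_span ?_)
      rw [hE]
      exact Finset.mem_coe.mpr (Finset.mem_image_of_mem _ (Finset.mem_range.mpr hed))
    · refine Submodule.mem_sup_left (hmem _ ?_)
      obtain ⟨e, rfl⟩ := Nat.exists_eq_add_of_le (not_lt.mp hed)
      rw [pow_add x, mul_assoc, mul_left_comm]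
      exact h.mul_left _
  have hle : LinearMap.range (LinearMap.mulLeft k (z ^ c)) ≤
      B ⊔ Submodule.span k (E : Set A) := by
    rintro _ ⟨a, rfl⟩
    obtain ⟨f, w, rfl⟩ := hgen a
    rw [LinearMap.mulLeft_apply, mul_add]
    refine Submodule.add_mem _ ?_ (Submodule.mem_sup_left (hmem _ ⟨w, by ring⟩))
    rw [Polynomial.aeval_eq_sum_range, Finset.mul_sum]
    refine Submodule.sum_mem _ fun e _ => ?_
    rw [mul_smul_comm, mul_comm]
    exact Submodule.smul_mem _ _ (hpow e)
  calc _ ≤ Module.finrank k ↥(B ⊔ Submodule.span k (E : Set A)) := Submodule.finrank_mono hle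
    _ ≤ Module.finrank k B + Module.finrank k (Submodule.span k (E : Set A)) :=
      Submodule.finrank_add_le_finrank_add_finrank _ _
    _ ≤ _ := by
      gcongr
      refine (finrank_span_finset_le_card E).trans (Finset.card_image_le.trans ?_)
      simp

/-! ### Jordan blocks -/

/-- The truncated polynomial algebra `k[t]/(t^m)`. -/
abbrev TruncPoly (k : Type u) [Field k] (m : ℕ) : Type u :=
  AdjoinRoot (Polynomial.X ^ m : Polynomial k)

namespace TruncPoly

variable (k : Type u) [Field k] (m : ℕ)

/-- The class of `t` in `k[t]/(t^m)`. -/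
abbrev t : TruncPoly k m := AdjoinRoot.root _

lemma t_pow : t k m ^ m = 0 := by
  have h := AdjoinRoot.mk_self (f := (Polynomial.X ^ m : Polynomial k))
  rwa [map_pow, AdjoinRoot.mk_X] at h

/-- The basis `1, t, …, t^(m-1)` of `k[t]/(t^m)`. -/
def basis : Module.Basis (Fin m) k (TruncPoly k m) :=
  ((AdjoinRoot.powerBasis' (Polynomial.monic_X_pow m)).basis).reindex
    (finCongr (by simp))

lemma basis_apply (i : Fin m) : basis k m i = t k m ^ (i : ℕ) := by
  rw [basis, Module.Basis.reindex_apply, PowerBasis.coe_basis]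
  simp [t]

instance : Module.Finite k (TruncPoly k m) := Module.Finite.of_basis (basis k m)

lemma finrank_eq : Module.finrank k (TruncPoly k m) = m := by
  rw [Module.finrank_eq_card_basis (basis k m), Fintype.card_fin]

lemma exists_aeval (a : TruncPoly k m) : ∃ f : Polynomial k, a = Polynomial.aeval (t k m) f := by
  obtain ⟨f, rfl⟩ := AdjoinRoot.mk_surjective a
  exact ⟨f, (AdjoinRoot.aeval_eq f).symm⟩

variable {k m}

lemma one_add_t_pow {p N : ℕ} [Fact p.Prime] [CharP k p] (h : m ≤ p ^ N) :
    (1 + t k m) ^ p ^ N = 1 := by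
  have h1 : (1 + Polynomial.X : Polynomial k) ^ p ^ N = 1 + Polynomial.X ^ p ^ N := by
    rw [add_pow_char_pow, one_pow]
  have h2 := congrArg (Polynomial.aeval (t k m)) h1
  simp only [map_pow, map_add, Polynomial.aeval_X, map_one] at h2
  rw [h2, pow_eq_zero_of_le h (t_pow k m), add_zero]

end TruncPoly

section Jordan

variable (k : Type u) [Field k] (p N : ℕ) [Fact p.Prime] [CharP k p]

/-- The indecomposable representation of `ℤ/p^N` of dimension `m`, where `1 ≤ m ≤ p^N`: the
generator acts as multiplication by `1 + t` on `k[t]/(t^m)`. For larger `m` the dimension is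
truncated to `p^N`. -/
def jordan (m : ℕ) : FDRep k (CyclicGrp p N) :=
  FDRep.regRep (TruncPoly k (min m (p ^ N))) (1 + TruncPoly.t k _)
    (TruncPoly.one_add_t_pow (min_le_right _ _))

/-- The representation on `k[t]/(t^m)` in which the generator acts as multiplication by
`(1 + t)⁻¹`. It has the same class as `jordan k p N m`. -/
def jordanInv (m : ℕ) : FDRep k (CyclicGrp p N) :=
  FDRep.regRep (TruncPoly k (min m (p ^ N))) ((1 + TruncPoly.t k _) ^ (p ^ N - 1)) (by
    rw [pow_right_comm, TruncPoly.one_add_t_pow (min_le_right _ _), one_pow])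

variable {N} {m : ℕ}

lemma jordan_eq (h : m ≤ p ^ N) : jordan k p N m =
    FDRep.regRep (k := k) (TruncPoly k m) (1 + TruncPoly.t k m)
      (TruncPoly.one_add_t_pow h) := by
  have : ∀ m' (_ : m' = m) (hu : (1 + TruncPoly.t k m') ^ p ^ N = 1),
      FDRep.regRep (k := k) (TruncPoly k m') (1 + TruncPoly.t k m') hu =
        FDRep.regRep (k := k) (TruncPoly k m) (1 + TruncPoly.t k m)
          (TruncPoly.one_add_t_pow h) := by
    rintro _ rfl _
    rfl
  exact this _ (min_eq_left h) _

lemma jordanInv_eq (h : m ≤ p ^ N) : jordanInv k p N m =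
    FDRep.regRep (k := k) (TruncPoly k m) ((1 + TruncPoly.t k m) ^ (p ^ N - 1)) (by
      rw [pow_right_comm, TruncPoly.one_add_t_pow h, one_pow]) := by
  have : ∀ m' (_ : m' = m) (hu : ((1 + TruncPoly.t k m') ^ (p ^ N - 1)) ^ p ^ N = 1),
      FDRep.regRep (k := k) (TruncPoly k m') ((1 + TruncPoly.t k m') ^ (p ^ N - 1)) hu =
        FDRep.regRep (k := k) (TruncPoly k m) ((1 + TruncPoly.t k m) ^ (p ^ N - 1)) (by
      rw [pow_right_comm, TruncPoly.one_add_t_pow h, one_pow]) := by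
    rintro _ rfl _
    rfl
  exact this _ (min_eq_left h) _

lemma TruncPoly.inv_mul (h : m ≤ p ^ N) :
    (1 + TruncPoly.t k m) ^ (p ^ N - 1) * (1 + TruncPoly.t k m) = 1 := by
  rw [← pow_succ, Nat.sub_add_cancel (Nat.one_le_pow _ _ (Fact.out : p.Prime).pos),
    TruncPoly.one_add_t_pow h]

lemma TruncPoly.finrank_range_mulLeft_t (m c : ℕ) :
    Module.finrank k (LinearMap.range (LinearMap.mulLeft k (TruncPoly.t k m ^ c))) = m - c := by
  have := rank_eq_of_drop_le (S := {m}) (M := m)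
    (r := fun c => Module.finrank k (LinearMap.range (LinearMap.mulLeft k (TruncPoly.t k m ^ c))))
    (by
      rw [pow_zero, LinearMap.mulLeft_one, LinearMap.range_id, finrank_top, TruncPoly.finrank_eq,
        Multiset.sum_singleton])
    (fun c hc => by
      rw [pow_eq_zero_of_le hc (TruncPoly.t_pow k m), LinearMap.mulLeft_zero_eq_zero,
        LinearMap.range_zero, finrank_bot])
    (fun c => ?_) c
  · simpa using this
  refine finrank_range_mulLeft_pow_le (x := TruncPoly.t k m) (fun a => ?_) ?_
  · obtain ⟨f, rfl⟩ := TruncPoly.exists_aeval k m a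
    exact ⟨f, 0, by simp⟩
  · simp only [Multiset.map_singleton, Multiset.sum_singleton]
    split_ifs with h
    · rw [pow_one, ← pow_succ']
    · rw [pow_eq_zero_of_le (not_lt.mp h) (TruncPoly.t_pow k m), mul_zero]
      exact dvd_zero _

lemma rk_jordan (h : m ≤ p ^ N) (c : ℕ) : (jordan k p N m).rk c = m - c := by
  rw [jordan_eq k p h, FDRep.regRep_rk, add_sub_cancel_left, TruncPoly.finrank_range_mulLeft_t]

lemma finrank_jordan (h : m ≤ p ^ N) : Module.finrank k (jordan k p N m) = m := by
  rw [← FDRep.rk_zero, rk_jordan k p h, Nat.sub_zero]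

lemma LinearMap.range_mulLeft_mul_of_isUnit {k A : Type*} [Field k] [CommRing A] [Algebra k A]
    (a : A) {v : A} (hv : IsUnit v) :
    LinearMap.range (LinearMap.mulLeft k (a * v)) = LinearMap.range (LinearMap.mulLeft k a) := by
  obtain ⟨v, rfl⟩ := hv
  ext y
  constructor
  · rintro ⟨w, rfl⟩
    exact ⟨v * w, (mul_assoc ..).symm⟩
  · rintro ⟨w, rfl⟩
    exact ⟨↑v⁻¹ * w, by simp⟩

lemma rk_jordanInv (h : m ≤ p ^ N) (c : ℕ) : (jordanInv k p N m).rk c = m - c := by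
  have h1 := TruncPoly.inv_mul k p h
  set v := (1 + TruncPoly.t k m) ^ (p ^ N - 1) with hv
  have h2 : (v - 1) ^ c = TruncPoly.t k m ^ c * (-v) ^ c := by
    rw [← mul_pow]
    congr 1
    linear_combination h1
  rw [jordanInv_eq k p h, FDRep.regRep_rk, h2, LinearMap.range_mulLeft_mul_of_isUnit,
    TruncPoly.finrank_range_mulLeft_t]
  exact ((IsUnit.of_mul_eq_one _ h1).neg).pow c

/-- The operator `g - 1` on the tensor product of two Jordan blocks, the second written as
`jordanInv`, is up to a unit the multiplication by `x - y` on `k[x, y]/(x^a, y^b)`. -/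
lemma rk_jordan_tensor {a b : ℕ} (ha : a ≤ p ^ N) (hb : b ≤ p ^ N) (c : ℕ) :
    (jordan k p N a ⊗ jordanInv k p N b).rk c = Module.finrank k (LinearMap.range
      (LinearMap.mulLeft k ((TruncPoly.t k a ⊗ₜ[k] (1 : TruncPoly k b) -
        (1 : TruncPoly k a) ⊗ₜ[k] TruncPoly.t k b) ^ c))) := by
  have h1 := TruncPoly.inv_mul k p hb
  rw [jordan_eq k p ha, jordanInv_eq k p hb]
  set v := (1 + TruncPoly.t k b) ^ (p ^ N - 1) with hv
  have h2 : ((1 + TruncPoly.t k a) ⊗ₜ[k] v - 1) = (TruncPoly.t k a ⊗ₜ[k] (1 : TruncPoly k b) -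
        (1 : TruncPoly k a) ⊗ₜ[k] TruncPoly.t k b) * ((1 : TruncPoly k a) ⊗ₜ[k] v) := by
    have h3 : (1 : TruncPoly k a) ⊗ₜ[k] (1 : TruncPoly k b) =
        1 ⊗ₜ[k] v + 1 ⊗ₜ[k] (TruncPoly.t k b * v) := by
      rw [← TensorProduct.tmul_add, ← h1]
      congr 1
      ring
    rw [sub_mul, Algebra.TensorProduct.tmul_mul_tmul, Algebra.TensorProduct.tmul_mul_tmul,
      Algebra.TensorProduct.one_def, h3, TensorProduct.add_tmul, mul_one, mul_one, one_mul]
    abel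
  rw [FDRep.regRep_tensor_rk, h2, mul_pow, LinearMap.range_mulLeft_mul_of_isUnit]
  refine IsUnit.pow c ?_
  exact (IsUnit.of_mul_eq_one _ h1).map
    (Algebra.TensorProduct.includeRight : TruncPoly k b →ₐ[k] TruncPoly k a ⊗[k] TruncPoly k b)

/-- Modulo `x - y`, every element of `k[x, y]/(x^a, y^b)` is a polynomial in `x`. -/
lemma TruncPoly.exists_aeval_tensor {a b : ℕ} (w : TruncPoly k a ⊗[k] TruncPoly k b) :
    ∃ (f : Polynomial k) (w' : TruncPoly k a ⊗[k] TruncPoly k b),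
      w = Polynomial.aeval (TruncPoly.t k a ⊗ₜ[k] (1 : TruncPoly k b)) f +
        (TruncPoly.t k a ⊗ₜ[k] (1 : TruncPoly k b) -
          (1 : TruncPoly k a) ⊗ₜ[k] TruncPoly.t k b) * w' := by
  induction w with
  | zero => exact ⟨0, 0, by simp⟩
  | add x y hx hy =>
    obtain ⟨f, u, rfl⟩ := hx
    obtain ⟨g, v, rfl⟩ := hy
    exact ⟨f + g, u + v, by rw [map_add]; ring⟩
  | tmul x y =>
    obtain ⟨f, rfl⟩ := TruncPoly.exists_aeval k a x
    obtain ⟨g, rfl⟩ := TruncPoly.exists_aeval k b y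
    have h1 : Polynomial.aeval (TruncPoly.t k a) f ⊗ₜ[k] (1 : TruncPoly k b) =
        Polynomial.aeval (TruncPoly.t k a ⊗ₜ[k] (1 : TruncPoly k b)) f :=
      (Polynomial.aeval_algHom_apply (Algebra.TensorProduct.includeLeft :
        TruncPoly k a →ₐ[k] TruncPoly k a ⊗[k] TruncPoly k b) (TruncPoly.t k a) f).symm
    have h2 : (1 : TruncPoly k a) ⊗ₜ[k] Polynomial.aeval (TruncPoly.t k b) g =
        Polynomial.aeval ((1 : TruncPoly k a) ⊗ₜ[k] TruncPoly.t k b) g :=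
      (Polynomial.aeval_algHom_apply (Algebra.TensorProduct.includeRight :
        TruncPoly k b →ₐ[k] TruncPoly k a ⊗[k] TruncPoly k b) (TruncPoly.t k b) g).symm
    have h3 : Polynomial.aeval (TruncPoly.t k a) f ⊗ₜ[k] Polynomial.aeval (TruncPoly.t k b) g =
        Polynomial.aeval (TruncPoly.t k a ⊗ₜ[k] (1 : TruncPoly k b)) f *
          Polynomial.aeval ((1 : TruncPoly k a) ⊗ₜ[k] TruncPoly.t k b) g := by
      rw [← h1, ← h2, Algebra.TensorProduct.tmul_mul_tmul, mul_one, one_mul]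
    obtain ⟨w, hw⟩ := (Polynomial.map (algebraMap k
      (TruncPoly k a ⊗[k] TruncPoly k b)) g).sub_dvd_eval_sub
      (TruncPoly.t k a ⊗ₜ[k] (1 : TruncPoly k b)) ((1 : TruncPoly k a) ⊗ₜ[k] TruncPoly.t k b)
    rw [Polynomial.eval_map_algebraMap, Polynomial.eval_map_algebraMap] at hw
    refine ⟨f * g, -(Polynomial.aeval (TruncPoly.t k a ⊗ₜ[k] (1 : TruncPoly k b)) f * w), ?_⟩
    rw [h3, map_mul]
    linear_combination -Polynomial.aeval (TruncPoly.t k a ⊗ₜ[k] (1 : TruncPoly k b)) f * hw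

end Jordan

/-! ### Decomposition into Jordan blocks -/

section Decomposition

variable {k : Type u} [Field k]

/-- A cyclic vector `v` of maximal order `m` for a nilpotent operator `T` spans a Jordan block,
which is a direct summand: if `φ` is a functional with `φ (T^(m-1) v) = 1`, then up to a unit of
`k[t]/(t^m)` a retraction is `w ↦ ∑ j < m, φ (T^(m-1-j) w) t^j`. -/
lemma exists_retract_of_pow_eq_zero {V : Type*} [AddCommGroup V] [Module k V]
    (T : Module.End k V) {m : ℕ} (h : T ^ (m + 1) = 0) (h' : T ^ m ≠ 0) :
    ∃ (i : TruncPoly k (m + 1) →ₗ[k] V) (r : V →ₗ[k] TruncPoly k (m + 1)),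
      (∀ x, i (TruncPoly.t k _ * x) = T (i x)) ∧ (∀ y, r (T y) = TruncPoly.t k _ * r y) ∧
        ∀ x, r (i x) = x := by
  obtain ⟨v, hv⟩ : ∃ v, (T ^ m) v ≠ 0 := by
    by_contra! hcon
    exact h' (LinearMap.ext hcon)
  obtain ⟨φ, hφ⟩ : ∃ φ : Module.Dual k V, φ ((T ^ m) v) = 1 := by
    obtain ⟨φ, hφ⟩ := not_forall.mp (mt (Module.forall_dual_apply_eq_zero_iff k _).mp hv)
    exact ⟨(φ ((T ^ m) v))⁻¹ • φ, by simp [inv_mul_cancel₀ hφ]⟩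
  set t := TruncPoly.t k (m + 1) with ht
  have htm : t ^ (m + 1) = 0 := TruncPoly.t_pow k (m + 1)
  let i : TruncPoly k (m + 1) →ₗ[k] V :=
    (TruncPoly.basis k (m + 1)).constr k fun j => (T ^ (j : ℕ)) v
  have hi : ∀ j, i (t ^ j) = (T ^ j) v := by
    intro j
    by_cases hj : j < m + 1
    · have := (TruncPoly.basis k (m + 1)).constr_basis k (fun j => (T ^ (j : ℕ)) v) ⟨j, hj⟩
      rwa [TruncPoly.basis_apply] at this
    · rw [pow_eq_zero_of_le (not_lt.mp hj) htm, pow_eq_zero_of_le (not_lt.mp hj) h, map_zero,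
        LinearMap.zero_apply]
  let r : V →ₗ[k] TruncPoly k (m + 1) := ∑ j ∈ Finset.range (m + 1),
    (LinearMap.toSpanSingleton k (TruncPoly k (m + 1)) (t ^ j)) ∘ₗ φ ∘ₗ (T ^ (m - j))
  have hr : ∀ y, r y = ∑ j ∈ Finset.range (m + 1), φ ((T ^ (m - j)) y) • t ^ j := by
    intro y
    simp [r]
  have hrT : ∀ y, r (T y) = t * r y := by
    intro y
    rw [hr, hr, Finset.sum_range_succ', Finset.mul_sum, Finset.sum_range_succ]
    congr 1
    · refine Finset.sum_congr rfl fun j hj => ?_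
      rw [mul_smul_comm, ← pow_succ', ← Module.End.mul_apply, ← pow_succ,
        show m - (j + 1) + 1 = m - j by have := Finset.mem_range.mp hj; omega]
    · rw [mul_smul_comm, ← pow_succ', htm, ← Module.End.mul_apply, ← pow_succ, Nat.sub_zero, h]
      simp
  have hrTj : ∀ j y, r ((T ^ j) y) = t ^ j * r y := by
    intro j y
    induction j with
    | zero => simp
    | succ j ih => rw [pow_succ' T, Module.End.mul_apply, hrT, ih, pow_succ' t, mul_assoc]
  have hu : IsUnit (r v) := by
    rw [hr, Finset.sum_range_succ', pow_zero, Nat.sub_zero, hφ, one_smul]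
    refine IsNilpotent.isUnit_add_one ?_
    rw [Finset.sum_congr rfl fun j _ => show φ ((T ^ (m - (j + 1))) v) • t ^ (j + 1) =
      t * (φ ((T ^ (m - (j + 1))) v) • t ^ j) by rw [mul_smul_comm, pow_succ' t], ← Finset.mul_sum]
    exact (Commute.all _ _).isNilpotent_mul_right ⟨m + 1, htm⟩
  obtain ⟨u, hu⟩ := hu
  refine ⟨i, LinearMap.mulLeft k (↑u⁻¹ : TruncPoly k (m + 1)) ∘ₗ r, ?_, ?_, ?_⟩
  · intro x
    have : i ∘ₗ LinearMap.mulLeft k t = T ∘ₗ i := by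
      refine (TruncPoly.basis k (m + 1)).ext fun j => ?_
      rw [TruncPoly.basis_apply]
      change i (t * t ^ (j : ℕ)) = T (i (t ^ (j : ℕ)))
      rw [← pow_succ', hi, hi, pow_succ', Module.End.mul_apply]
    exact LinearMap.congr_fun this x
  · intro y
    change ↑u⁻¹ * r (T y) = t * (↑u⁻¹ * r y)
    rw [hrT, mul_left_comm]
  · intro x
    have : (LinearMap.mulLeft k (↑u⁻¹ : TruncPoly k (m + 1)) ∘ₗ r) ∘ₗ i = LinearMap.id := by
      refine (TruncPoly.basis k (m + 1)).ext fun j => ?_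
      rw [TruncPoly.basis_apply]
      change ↑u⁻¹ * r (i (t ^ (j : ℕ))) = t ^ (j : ℕ)
      rw [hi, hrTj, ← hu, mul_left_comm, Units.inv_mul, mul_one]
    exact LinearMap.congr_fun this x

/-- A retract is a direct summand. -/
lemma nonempty_iso_biprod_of_retract {C : Type*} [Category C] [Preadditive C] [HasKernels C]
    [HasBinaryBiproducts C] {X Y : C} (i : Y ⟶ X) (r : X ⟶ Y) (h : i ≫ r = 𝟙 Y) :
    ∃ Z : C, Nonempty (X ≅ Y ⊞ Z) := by
  have : IsSplitEpi r := ⟨⟨i, h⟩⟩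
  refine ⟨kernel r, ⟨?_ ≪≫ biprod.braiding _ _⟩⟩
  exact biprod.uniqueUpToIso _ _ (isBilimitBinaryBiconeOfIsSplitEpiOfKernel (kernelIsKernel r))

variable {p N : ℕ} [Fact p.Prime] [CharP k p]

namespace FDRep

/-- A Jordan block whose size is the nilpotency order of `g - 1` splits off. -/
theorem exists_iso_jordan_biprod (V : FDRep k (CyclicGrp p N)) (hV : ¬ IsZero V) :
    ∃ m, 0 < m ∧ m ≤ p ^ N ∧ ∃ W, Nonempty (V ≅ jordan k p N m ⊞ W) := by
  classical
  have hex : ∃ m, V.nilp ^ m = 0 := ⟨_, nilp_pow_eq_zero V⟩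
  obtain ⟨m, hm⟩ : ∃ m, Nat.find hex = m + 1 := by
    refine Nat.exists_eq_succ_of_ne_zero fun h0 => hV ?_
    have h1 := Nat.find_spec hex
    rw [h0, nilp_pow_eq_zero_iff, rk_zero] at h1
    exact isZero_of_finrank_eq_zero h1
  have h1 : V.nilp ^ (m + 1) = 0 := hm ▸ Nat.find_spec hex
  have h2 : V.nilp ^ m ≠ 0 := Nat.find_min hex (by omega)
  have h3 : m + 1 ≤ p ^ N := hm ▸ Nat.find_min' hex (nilp_pow_eq_zero V)
  obtain ⟨i, r, hi, hr, hir⟩ := exists_retract_of_pow_eq_zero V.nilp h1 h2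
  refine ⟨m + 1, m.succ_pos, h3, ?_⟩
  rw [jordan_eq k p h3]
  have h4 := regRep_nilp (k := k) (1 + TruncPoly.t k (m + 1)) (TruncPoly.one_add_t_pow h3)
  set J := regRep (k := k) (TruncPoly k (m + 1)) (1 + TruncPoly.t k (m + 1))
    (TruncPoly.one_add_t_pow h3)
  rw [add_sub_cancel_left] at h4
  refine nonempty_iso_biprod_of_retract (ofNilp (V := J) i fun x => ?_)
    (ofNilp (W := J) r fun y => ?_) (lin_injective (LinearMap.ext hir))
  · rw [h4]
    exact hi x
  · rw [h4]
    exact hr y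

/-- Every representation has a Jordan type `S`; additive invariants of representations, such as
classes in the Green ring, are determined by their values on Jordan blocks. -/
theorem exists_jordanType (V : FDRep k (CyclicGrp p N)) :
    ∃ S : Multiset ℕ, (∀ s ∈ S, 0 < s ∧ s ≤ p ^ N) ∧
      (∀ c, V.rk c = (S.map fun s => s - c).sum) ∧
      ∀ {R : Type w} [AddCommGroup R] (φ : FDRep k (CyclicGrp p N) → R)
        (_ : ∀ {X Y : FDRep k (CyclicGrp p N)}, (X ≅ Y) → φ X = φ Y)
        (_ : ∀ X Y, φ (X ⊞ Y) = φ X + φ Y),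
        φ V = (S.map fun s => φ (jordan k p N s)).sum := by
  induction h : Module.finrank k V using Nat.strong_induction_on generalizing V with
  | _ d ih =>
  by_cases hV : IsZero V
  · refine ⟨0, by simp, fun c => ?_, fun φ hφ hadd => ?_⟩
    · have := finrank_eq_zero_of_isZero hV
      have h2 : V.rk c ≤ Module.finrank k V := Submodule.finrank_le _
      simp only [Multiset.map_zero, Multiset.sum_zero]
      omega
    · have h1 : V ≅ V ⊞ V := hV.iso ((biprod_isZero_iff V V).mpr ⟨hV, hV⟩)
      have h2 := hφ h1
      rw [hadd] at h2
      simpa using h2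
  · obtain ⟨m, hm0, hm, W, ⟨e⟩⟩ := exists_iso_jordan_biprod V hV
    have hrk := fun c => (rk_eq_of_iso e c).trans (rk_biprod _ W c)
    have h0 := hrk 0
    rw [rk_zero, rk_jordan k p hm, rk_zero] at h0
    obtain ⟨S, hS, hS1, hS2⟩ := ih (Module.finrank k W) (by omega) W rfl
    refine ⟨m ::ₘ S, ?_, fun c => ?_, fun φ hφ hadd => ?_⟩
    · intro s hs
      rcases Multiset.mem_cons.mp hs with rfl | hs
      · exact ⟨hm0, hm⟩
      · exact hS s hs
    · rw [hrk, rk_jordan k p hm, hS1, Multiset.map_cons, Multiset.sum_cons]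
    · rw [hφ e, hadd, hS2 φ hφ hadd, Multiset.map_cons, Multiset.sum_cons]

end FDRep

/-- The multiplicity of a block of size `c + 1` is a second difference of ranks. -/
lemma Multiset.sum_map_sub_add (S : Multiset ℕ) (c : ℕ) :
    (S.map fun s => s - c).sum + (S.map fun s => s - (c + 2)).sum =
      2 * (S.map fun s => s - (c + 1)).sum + S.count (c + 1) := by
  induction S using Multiset.induction_on with
  | empty => simp
  | cons s S ih =>
    simp only [Multiset.map_cons, Multiset.sum_cons, Multiset.count_cons]
    split_ifs <;> omega

lemma Multiset.eq_of_sum_map_sub_eq {S S' : Multiset ℕ} (h0 : 0 ∉ S) (h0' : 0 ∉ S')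
    (h : ∀ c, (S.map fun s => s - c).sum = (S'.map fun s => s - c).sum) : S = S' := by
  ext c
  cases c with
  | zero => rw [Multiset.count_eq_zero_of_notMem h0, Multiset.count_eq_zero_of_notMem h0']
  | succ c =>
    have h1 := Multiset.sum_map_sub_add S c
    have h2 := Multiset.sum_map_sub_add S' c
    rw [h, h, h] at h1
    omega

/-- The Jordan type is determined by the ranks. -/
theorem FDRep.additive_eq_of_rk_eq {V : FDRep k (CyclicGrp p N)} {S : Multiset ℕ} (h0 : 0 ∉ S)
    (hS : ∀ c, V.rk c = (S.map fun s => s - c).sum) {R : Type w} [AddCommGroup R]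
    (φ : FDRep k (CyclicGrp p N) → R)
    (hφ : ∀ {X Y : FDRep k (CyclicGrp p N)}, (X ≅ Y) → φ X = φ Y)
    (hadd : ∀ X Y, φ (X ⊞ Y) = φ X + φ Y) :
    φ V = (S.map fun s => φ (jordan k p N s)).sum := by
  obtain ⟨S', h1, h2, h3⟩ := V.exists_jordanType
  obtain rfl : S = S' := Multiset.eq_of_sum_map_sub_eq h0 (fun h => by simpa using (h1 0 h).1)
    fun c => (hS c).symm.trans (h2 c)
  exact h3 φ hφ hadd

end Decomposition

/-! ### Divisibility relations in truncated polynomial rings of characteristic `p` -/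

section Identities

variable {A : Type*} [CommRing A]

lemma sub_pow_mul_of_mul_eq_zero {x y w : A} (h : y * w = 0) (m : ℕ) :
    (x - y) ^ m * w = x ^ m * w := by
  induction m with
  | zero => simp
  | succ m ih => rw [pow_succ', mul_assoc, ih, pow_succ']; linear_combination -x ^ m * h

lemma sub_pow_succ_of_sq_eq_zero {P Q : A} (h : P ^ 2 = 0) (j : ℕ) :
    (P - Q) ^ (j + 1) = (-Q) ^ (j + 1) + (j + 1) * P * (-Q) ^ j := by
  induction j with
  | zero => simp; ring
  | succ j ih =>
    rw [pow_succ, ih]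
    push_cast
    linear_combination (j + 1) * (-Q) ^ j * h

/-- Divisibility of `x^d z^c` by `z^(c+1)` persists when `c` and `d` grow. -/
lemma pow_succ_dvd_of_le {x z : A} {c₀ c d₀ d : ℕ} (h : z ^ (c₀ + 1) ∣ x ^ d₀ * z ^ c₀)
    (hc : c₀ ≤ c) (hd : d₀ ≤ d) : z ^ (c + 1) ∣ x ^ d * z ^ c := by
  obtain ⟨c, rfl⟩ := Nat.exists_eq_add_of_le hc
  obtain ⟨d, rfl⟩ := Nat.exists_eq_add_of_le hd
  obtain ⟨w, hw⟩ := h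
  exact ⟨w * x ^ d, by
    rw [pow_add x, pow_add z c₀ c, show x ^ d₀ * x ^ d * (z ^ c₀ * z ^ c) =
      (x ^ d₀ * z ^ c₀) * x ^ d * z ^ c by ring, hw]; ring⟩

variable {p : ℕ} [Fact p.Prime] [CharP A p]

lemma exists_natCast_mul_eq_one {i : ℕ} (h : ¬ p ∣ i) : ∃ v : A, v * i = 1 := by
  have : IsUnit (i : A) := (CharP.isUnit_natCast_iff (Fact.out : p.Prime)).mpr h
  obtain ⟨v, hv⟩ := this.exists_left_inv
  exact ⟨v, hv⟩

/-- The quotient of `(x - y)^q = x^q - y^q` by `x - y`, where `q = p^n`; the division takes place in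
the domain `𝔽_p[X, Y]`. -/
lemma sub_pow_char_pow_sub_one (x y : A) (n : ℕ) :
    (x - y) ^ (p ^ n - 1) = ∑ e ∈ Finset.range (p ^ n), x ^ e * y ^ (p ^ n - 1 - e) := by
  have hq : p ^ n = p ^ n - 1 + 1 := (Nat.sub_add_cancel (Nat.one_le_pow _ _
    (Fact.out : p.Prime).pos)).symm
  let R := MvPolynomial (Fin 2) (ZMod p)
  have hne : (MvPolynomial.X 0 - MvPolynomial.X 1 : R) ≠ 0 := by
    rw [sub_ne_zero]
    exact fun h => absurd (MvPolynomial.X_injective h) (by decide)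
  have h1 : (MvPolynomial.X 0 - MvPolynomial.X 1 : R) ^ (p ^ n - 1) =
      ∑ e ∈ Finset.range (p ^ n), MvPolynomial.X 0 ^ e * MvPolynomial.X 1 ^ (p ^ n - 1 - e) := by
    refine mul_right_cancel₀ hne ?_
    rw [geom_sum₂_mul, ← pow_succ, ← hq, sub_pow_char_pow]
  have : Algebra (ZMod p) A := ZMod.algebra A p
  have h2 := congrArg (MvPolynomial.aeval ![x, y]) h1
  simpa using h2

variable {x y : A} {n a i j c : ℕ}

/-- The bounds for `J_a ⊗ J_(iq+1)`, where `q = p^n`. -/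
lemma dvd_of_pow_eq_zero_even (ha : 1 ≤ a) (haq : a ≤ p ^ n) (hx : x ^ a = 0)
    (hy : y ^ (i * p ^ n + 1) = 0) :
    (x - y) ^ (c + 1) ∣ x ^ (((i * p ^ n + a) ::ₘ Multiset.replicate (a - 1) (i * p ^ n)).map
      fun s => if c < s then 1 else 0).sum * (x - y) ^ c := by
  rw [Multiset.map_cons, Multiset.sum_cons, Multiset.map_replicate, Multiset.sum_replicate,
    smul_eq_mul]
  set q := p ^ n with hq
  have hxq : x ^ q = 0 := pow_eq_zero_of_le haq hx
  have hz : (x - y) ^ (i * q) = (-y ^ q) ^ i := by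
    rw [mul_comm, pow_mul, hq, sub_pow_char_pow, ← hq, hxq, zero_sub]
  have hyz : y * (x - y) ^ (i * q) = 0 := by
    rw [hz, neg_pow, ← pow_mul, mul_left_comm, ← pow_succ', mul_comm q, hy, mul_zero]
  by_cases h1 : c < i * q
  · rw [if_pos h1, if_pos (by omega), mul_one, Nat.add_sub_cancel' ha, hx, zero_mul]
    exact dvd_zero _
  rw [if_neg h1, mul_zero, add_zero]
  by_cases h2 : c < i * q + a
  · rw [if_pos h2]
    refine pow_succ_dvd_of_le ⟨1, ?_⟩ (not_lt.mp h1) le_rfl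
    rw [pow_succ]
    linear_combination hyz
  · have : (x - y) ^ (i * q + a) = 0 := by
      rw [pow_add, mul_comm, sub_pow_mul_of_mul_eq_zero hyz, hx, zero_mul]
    rw [pow_eq_zero_of_le (not_lt.mp h2) this, mul_zero]
    exact dvd_zero _

/-- The bounds for `J_a ⊗ J_(jq-1)`, where `q = p^n`. -/
lemma dvd_of_pow_eq_zero_odd (ha : 1 ≤ a) (haq : a < p ^ n) (hx : x ^ a = 0)
    (hy : y ^ ((j + 1) * p ^ n - 1) = 0) :
    (x - y) ^ (c + 1) ∣ x ^ ((((j + 1) * p ^ n - a) ::ₘ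
      Multiset.replicate (a - 1) ((j + 1) * p ^ n)).map
      fun s => if c < s then 1 else 0).sum * (x - y) ^ c := by
  rw [Multiset.map_cons, Multiset.sum_cons, Multiset.map_replicate, Multiset.sum_replicate,
    smul_eq_mul]
  have hsum := sub_pow_char_pow_sub_one (p := p) x (x - y) n
  set q := p ^ n with hq
  have hjq : (j + 1) * q = j * q + q := by ring
  have hxq : x ^ q = 0 := pow_eq_zero_of_le haq.le hx
  have hz : (x - y) ^ ((j + 1) * q) = 0 := by
    rw [mul_comm, pow_mul, hq, sub_pow_char_pow, ← hq, hxq, zero_sub, neg_pow, ← pow_mul,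
      pow_eq_zero_of_le (show (j + 1) * q - 1 ≤ q * (j + 1) by rw [mul_comm q]; omega) hy, mul_zero]
  by_cases h1 : c < (j + 1) * q - a
  · rw [if_pos h1, if_pos (by omega), mul_one, Nat.add_sub_cancel' ha, hx, zero_mul]
    exact dvd_zero _
  rw [if_neg h1, zero_add]
  by_cases h2 : c < (j + 1) * q
  · rw [if_pos h2, mul_one]
    refine pow_succ_dvd_of_le ?_ (not_lt.mp h1) le_rfl
    -- `0 = y^(jq) y^(q-1) = ± z^(jq) ∑ x^e z^(q-1-e)`; the term `e = a - 1` has the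
    -- least power of `z`
    have h3 : (x - y) ^ (j * q) * y ^ (q - 1) = 0 := by
      have h4 : y ^ (j * q) = (-(x - y) ^ q) ^ j := by
        rw [hq, sub_pow_char_pow, ← hq, hxq, zero_sub, neg_neg, mul_comm, pow_mul]
      have h5 : y ^ (j * q) * y ^ (q - 1) = 0 := by
        rw [← pow_add, ← hy]
        congr 1
        omega
      rw [h4, neg_pow, ← pow_mul, mul_assoc] at h5
      have h6 : IsUnit ((-1 : A) ^ j) := (isUnit_one.neg).pow j
      rw [mul_comm j q]
      exact h6.mul_right_eq_zero.mp h5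
    rw [sub_sub_cancel] at hsum
    obtain ⟨r, hr⟩ : ∃ r, q = a + r := Nat.exists_eq_add_of_le haq.le
    obtain ⟨a, rfl⟩ : ∃ a', a = a' + 1 := ⟨a - 1, by omega⟩
    rw [hsum, hr, Finset.sum_range_add, Finset.sum_range_succ,
      Finset.sum_eq_zero (s := Finset.range r) fun e _ => by
        rw [pow_eq_zero_of_le (Nat.le_add_right _ _) hx, zero_mul], add_zero, ← hr, mul_add] at h3
    have h7 : (x - y) ^ (j * q) * (x ^ a * (x - y) ^ (q - 1 - a)) =
        x ^ (a + 1 - 1) * (x - y) ^ ((j + 1) * q - (a + 1)) := by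
      rw [show (j + 1) * q - (a + 1) = j * q + (q - 1 - a) by omega, pow_add, Nat.add_sub_cancel]
      ring
    rw [← h7, eq_neg_of_add_eq_zero_right h3, dvd_neg,
      show (j + 1) * q - (a + 1) + 1 = j * q + (q - 1 - a + 1) by omega, pow_add]
    refine mul_dvd_mul_left _ (Finset.dvd_sum fun e he => Dvd.dvd.mul_left (pow_dvd_pow _ ?_) _)
    have := Finset.mem_range.mp he
    omega
  · rw [pow_eq_zero_of_le (not_lt.mp h2) hz, mul_zero]
    exact dvd_zero _

section Generator

variable (hx : x ^ (p ^ n + 1) = 0) (hy : y ^ ((i + 1) * p ^ n + 1) = 0)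

include hx hy

variable (hq : 2 ≤ p ^ n)

include hq

/-- Put `z = x - y`, `P = x^q` and `Q = y^q`, where `q = p^n`. Since `z^q = P - Q` and `P^2 = 0`,
the powers `z^(jq) = (P - Q)^j` have only two terms. -/
lemma sub_pow_generator :
    (x - y) ^ ((i + 1) * p ^ n) = (-y ^ p ^ n) ^ (i + 1) + (i + 1) * x ^ p ^ n * (-y ^ p ^ n) ^ i ∧
    (x - y) ^ (i * p ^ n) * x ^ p ^ n = (-y ^ p ^ n) ^ i * x ^ p ^ n ∧
    (x - y) ^ ((i + 2) * p ^ n) = (i + 2) * x ^ p ^ n * (-y ^ p ^ n) ^ (i + 1) ∧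
    y * (-y ^ p ^ n) ^ (i + 1) = 0 := by
  have hP : (x ^ p ^ n) ^ 2 = 0 := by
    rw [← pow_mul]
    exact pow_eq_zero_of_le (by omega) hx
  have hQ : y * (-y ^ p ^ n) ^ (i + 1) = 0 := by
    rw [neg_pow, ← pow_mul, mul_left_comm, ← pow_succ', mul_comm (p ^ n), hy, mul_zero]
  refine ⟨?_, ?_, ?_, hQ⟩
  · rw [mul_comm, pow_mul, sub_pow_char_pow, sub_pow_succ_of_sq_eq_zero hP]
  · rw [mul_comm i, pow_mul, sub_pow_char_pow]
    cases i with
    | zero => simp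
    | succ i =>
      rw [sub_pow_succ_of_sq_eq_zero hP]
      linear_combination (i + 1) * (-y ^ p ^ n) ^ i * hP
  · have hQ2 : (-y ^ p ^ n) ^ (i + 2) = 0 := by
      obtain ⟨r, hr⟩ : ∃ r, p ^ n = r + 1 := ⟨p ^ n - 1, by omega⟩
      have h6 : y ^ p ^ n = y * y ^ r := by rw [hr, pow_succ']
      rw [pow_succ]
      linear_combination -y ^ r * hQ - (-y ^ p ^ n) ^ (i + 1) * h6
    rw [mul_comm, pow_mul, sub_pow_char_pow, sub_pow_succ_of_sq_eq_zero hP, hQ2]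
    push_cast
    ring

/-- For `c ≥ iq + 1` the relation `x^q z^c ∈ z^(c+1) A` holds because `x^q z^(iq+1)` is, up to the
unit `i + 1`, the multiple `y z^((i+1)q)` of a higher power of `z`. -/
lemma generator_dvd_of_pow_le (hi : ¬ p ∣ i + 1) (hc : i * p ^ n + 1 ≤ c) {d : ℕ} (hd : p ^ n ≤ d) :
    (x - y) ^ (c + 1) ∣ x ^ d * (x - y) ^ c := by
  obtain ⟨h1, h2, -, h4⟩ := sub_pow_generator hx hy hq
  refine pow_succ_dvd_of_le ?_ hc hd
  obtain ⟨v, hv⟩ := exists_natCast_mul_eq_one (A := A) hi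
  push_cast at hv
  have h5 : x ^ p ^ n * (x - y) ^ (i * p ^ n + 1) = -v * y * (x - y) ^ ((i + 1) * p ^ n) := by
    rw [pow_succ] at hx
    rw [h1, pow_succ (x - y)]
    linear_combination (x - y) * h2 + (-y ^ p ^ n) ^ i * hx + v * h4 +
      y * x ^ p ^ n * (-y ^ p ^ n) ^ i * hv
  rw [h5]
  exact Dvd.dvd.mul_left (pow_dvd_pow _ (by rw [add_mul]; omega)) _

/-- For `c ≥ (i+1)q` the relation `x^2 z^c ∈ z^(c+1) A` holds because `x y z^((i+1)q) = 0`. -/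
lemma generator_dvd_of_two_le (hc : (i + 1) * p ^ n ≤ c) {d : ℕ} (hd : 2 ≤ d) :
    (x - y) ^ (c + 1) ∣ x ^ d * (x - y) ^ c := by
  obtain ⟨h1, -, -, h4⟩ := sub_pow_generator hx hy hq
  refine pow_succ_dvd_of_le ⟨x, ?_⟩ hc hd
  have h5 : x * y * (x - y) ^ ((i + 1) * p ^ n) = 0 := by
    rw [h1]
    rw [pow_succ] at hx
    linear_combination x * h4 + (i + 1) * y * (-y ^ p ^ n) ^ i * hx
  rw [pow_succ (x - y)]
  linear_combination h5

/-- For `c ≥ (i+2)q - 1` the relation `x z^c ∈ z^(c+1) A` holds because `x z^((i+2)q-1)` is, up to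
the unit `i + 2`, equal to `z^((i+2)q)`. -/
lemma generator_dvd_of_one_le (hi : ¬ p ∣ i + 2) (hc : (i + 2) * p ^ n - 1 ≤ c) {d : ℕ}
    (hd : 1 ≤ d) :
    (x - y) ^ (c + 1) ∣ x ^ d * (x - y) ^ c := by
  obtain ⟨h1, -, h3, h4⟩ := sub_pow_generator hx hy hq
  obtain ⟨v, hv⟩ := exists_natCast_mul_eq_one (A := A) hi
  push_cast at hv
  refine pow_succ_dvd_of_le (d₀ := 1) ⟨v, ?_⟩ hc hd
  have h5 : x ^ p ^ n = x * x ^ (p ^ n - 1) := by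
    rw [← pow_succ', Nat.sub_add_cancel (by omega)]
  have h6 := sub_pow_mul_of_mul_eq_zero (x := x) h4 (p ^ n - 1)
  have h7 : (x - y) ^ (p ^ n - 1) * (x * ((i + 1) * x ^ p ^ n * (-y ^ p ^ n) ^ i)) = 0 := by
    rw [pow_succ] at hx
    linear_combination (x - y) ^ (p ^ n - 1) * (i + 1) * (-y ^ p ^ n) ^ i * hx
  have h8 : (x - y) ^ ((i + 2) * p ^ n - 1) =
      (x - y) ^ ((i + 1) * p ^ n) * (x - y) ^ (p ^ n - 1) := by
    rw [← pow_add]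
    congr 1
    have : (i + 2) * p ^ n = (i + 1) * p ^ n + p ^ n := by ring
    omega
  rw [h8, Nat.sub_add_cancel (by nlinarith), h3, h1]
  linear_combination h7 + x * h6 - (-y ^ p ^ n) ^ (i + 1) * h5 -
    x ^ p ^ n * (-y ^ p ^ n) ^ (i + 1) * hv

lemma sub_pow_generator_eq_zero (hc : (i + 2) * p ^ n + 1 ≤ c) : (x - y) ^ c = 0 := by
  obtain ⟨-, -, h3, h4⟩ := sub_pow_generator hx hy hq
  refine pow_eq_zero_of_le hc ?_
  rw [pow_succ, h3]
  rw [pow_succ] at hx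
  linear_combination (i + 2) * (-y ^ p ^ n) ^ (i + 1) * hx - (i + 2) * x ^ p ^ n * h4

/-- The bounds for `J_(q+1) ⊗ J_((i+1)q+1)`, where `q = p^n` and `i + 1 ≤ p - 2`. -/
lemma dvd_of_pow_eq_zero_generator (hi : i + 2 < p) :
    (x - y) ^ (c + 1) ∣ x ^ ((((i + 2) * p ^ n + 1) ::ₘ (i * p ^ n + 1) ::ₘ
      ((i + 2) * p ^ n - 1) ::ₘ Multiset.replicate (p ^ n - 2) ((i + 1) * p ^ n)).map
      fun s => if c < s then 1 else 0).sum * (x - y) ^ c := by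
  simp only [Multiset.map_cons, Multiset.sum_cons, Multiset.map_replicate, Multiset.sum_replicate,
    smul_eq_mul]
  have e1 : (i + 1) * p ^ n = i * p ^ n + p ^ n := by ring
  have e2 : (i + 2) * p ^ n = i * p ^ n + p ^ n + p ^ n := by ring
  by_cases h1 : c < i * p ^ n + 1
  · rw [if_pos (by omega), if_pos h1, if_pos (by omega), if_pos (by omega), mul_one,
      show 1 + (1 + (1 + (p ^ n - 2))) = p ^ n + 1 by omega, hx, zero_mul]
    exact dvd_zero _
  by_cases h2 : c < (i + 1) * p ^ n
  · refine generator_dvd_of_pow_le hx hy hq (Nat.not_dvd_of_pos_of_lt (by omega) (by omega))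
      (not_lt.mp h1) ?_
    rw [if_pos (by omega), if_neg h1, if_pos (by omega), if_pos h2]
    omega
  by_cases h3 : c < (i + 2) * p ^ n - 1
  · refine generator_dvd_of_two_le hx hy hq (not_lt.mp h2) ?_
    rw [if_pos (by omega), if_neg h1, if_pos h3]
    omega
  by_cases h4 : c < (i + 2) * p ^ n + 1
  · refine generator_dvd_of_one_le hx hy hq (Nat.not_dvd_of_pos_of_lt (by omega) hi)
      (not_lt.mp h3) ?_
    rw [if_pos h4]
    omega
  · rw [sub_pow_generator_eq_zero hx hy hq (not_lt.mp h4), mul_zero]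
    exact dvd_zero _

/-- The bounds for `J_(q+1) ⊗ J_((p-1)q+1)`, where `q = p^n`. -/
lemma dvd_of_pow_eq_zero_generator_last (hi : i + 2 = p) :
    (x - y) ^ (c + 1) ∣ x ^ ((((i + 2) * p ^ n) ::ₘ (i * p ^ n + 1) ::ₘ
      ((i + 2) * p ^ n) ::ₘ Multiset.replicate (p ^ n - 2) ((i + 1) * p ^ n)).map
      fun s => if c < s then 1 else 0).sum * (x - y) ^ c := by
  simp only [Multiset.map_cons, Multiset.sum_cons, Multiset.map_replicate, Multiset.sum_replicate,
    smul_eq_mul]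
  have e1 : (i + 1) * p ^ n = i * p ^ n + p ^ n := by ring
  have e2 : (i + 2) * p ^ n = i * p ^ n + p ^ n + p ^ n := by ring
  by_cases h1 : c < i * p ^ n + 1
  · rw [if_pos (by omega), if_pos h1, if_pos (by omega), mul_one,
      show 1 + (1 + (1 + (p ^ n - 2))) = p ^ n + 1 by omega, hx, zero_mul]
    exact dvd_zero _
  by_cases h2 : c < (i + 1) * p ^ n
  · refine generator_dvd_of_pow_le hx hy hq (Nat.not_dvd_of_pos_of_lt (by omega) (by omega))
      (not_lt.mp h1) ?_
    rw [if_pos (by omega), if_neg h1, if_pos h2]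
    omega
  by_cases h3 : c < (i + 2) * p ^ n
  · refine generator_dvd_of_two_le hx hy hq (not_lt.mp h2) ?_
    rw [if_pos h3]
    omega
  · have h4 := (sub_pow_generator hx hy hq).2.2.1
    have h5 : (i + 2 : A) = 0 := by
      rw [← CharP.cast_eq_zero A p, ← hi]
      push_cast
      rfl
    rw [h5, zero_mul, zero_mul] at h4
    rw [pow_eq_zero_of_le (not_lt.mp h3) h4, mul_zero]
    exact dvd_zero _

end Generator

end Identities

/-! ### Universal properties of the Green ring -/

namespace GreenRing

variable {C : Type u} [Category.{v} C] [Preadditive C] [MonoidalCategory C] [BraidedCategory C]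
  [HasBinaryBiproducts C]

lemma cls_eq_of_iso {X Y : C} (e : X ≅ Y) : cls X = cls Y := by
  rw [cls, cls, show toSkeleton X = toSkeleton Y from Quotient.sound ⟨e⟩]

lemma cls_biprod (X Y : C) : cls (X ⊞ Y) = cls X + cls Y := by
  have h : MonoidAlgebra.of ℤ (Skeleton C) (toSkeleton (X ⊞ Y)) -
      (MonoidAlgebra.of ℤ (Skeleton C) (toSkeleton X) +
        MonoidAlgebra.of ℤ (Skeleton C) (toSkeleton Y)) ∈ splitRelations C :=
    Ideal.subset_span ⟨X, Y, rfl⟩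
  exact Ideal.Quotient.eq.mpr h

lemma cls_eq_zero_of_isZero {X : C} (h : IsZero X) : cls X = 0 := by
  have h1 : X ≅ X ⊞ X := h.iso ((biprod_isZero_iff X X).mpr ⟨h, h⟩)
  have h2 := cls_eq_of_iso h1
  rw [cls_biprod] at h2
  simpa using h2

lemma cls_tensor (X Y : C) : cls (X ⊗ Y) = cls X * cls Y := by
  rw [cls, Skeleton.toSkeleton_tensorObj, map_mul]
  exact map_mul (Ideal.Quotient.mk (splitRelations C)) _ _

lemma cls_unit : cls (𝟙_ C) = 1 := by
  rw [cls, ← Skeleton.one_eq, map_one]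
  exact map_one (Ideal.Quotient.mk (splitRelations C))

lemma mk_single (X : Skeleton C) (n : ℤ) :
    (Ideal.Quotient.mk (splitRelations C) (MonoidAlgebra.single X n) : GreenRing C) =
      n • cls X.out := by
  have h1 : toSkeleton X.out = X := Quotient.out_eq X
  rw [cls, h1]
  have h2 : MonoidAlgebra.single X n = n • MonoidAlgebra.of ℤ (Skeleton C) X := by
    rw [MonoidAlgebra.of_apply, MonoidAlgebra.smul_single, smul_eq_mul, mul_one]
  rw [h2]
  exact map_zsmul (Ideal.Quotient.mk (splitRelations C)) _ _

/-- The Green ring is spanned by classes of objects. -/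
lemma induction_on {P : GreenRing C → Prop} (x : GreenRing C) (h0 : P 0)
    (hadd : ∀ x y, P x → P y → P (x + y)) (hcls : ∀ (n : ℤ) (X : C), P (n • cls X)) : P x := by
  obtain ⟨x, rfl⟩ := Ideal.Quotient.mk_surjective x
  induction x using MonoidAlgebra.induction_linear with
  | zero => exact h0
  | add f g hf hg => exact hadd _ _ hf hg
  | single X n =>
    have := hcls n X.out
    rwa [← mk_single] at this

/-- The ring homomorphism from the Green ring given by a multiplicative and additive invariant. -/
def lift {R : Type*} [CommRing R] (φ : C → R) (hφ : ∀ X Y : C, (X ≅ Y) → φ X = φ Y)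
    (hone : φ (𝟙_ C) = 1) (hmul : ∀ X Y, φ (X ⊗ Y) = φ X * φ Y)
    (hadd : ∀ X Y, φ (X ⊞ Y) = φ X + φ Y) : GreenRing C →+* R :=
  have hsk (X : C) : φ (toSkeleton X).out = φ X := hφ _ _ (fromSkeletonToSkeletonIso X)
  let f : Skeleton C →* R :=
    { toFun := fun X => φ X.out
      map_one' := by rw [Skeleton.one_eq, hsk, hone]
      map_mul' := fun X Y => by rw [Skeleton.mul_eq, hsk, hmul] }
  Ideal.Quotient.lift (splitRelations C) (MonoidAlgebra.lift ℤ R (Skeleton C) f).toRingHom (by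
    intro a ha
    have hle : splitRelations C ≤
        RingHom.ker (MonoidAlgebra.lift ℤ R (Skeleton C) f).toRingHom := by
      rw [splitRelations, Ideal.span_le]
      rintro _ ⟨X, Y, rfl⟩
      simp only [SetLike.mem_coe, RingHom.mem_ker, AlgHom.toRingHom_eq_coe, RingHom.coe_coe,
        map_sub, map_add, MonoidAlgebra.lift_of]
      change φ _ - (φ _ + φ _) = 0
      rw [hsk, hsk, hsk, hadd, sub_self]
    exact hle ha)

lemma lift_cls {R : Type*} [CommRing R] (φ : C → R) (hφ : ∀ X Y : C, (X ≅ Y) → φ X = φ Y)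
    (hone : φ (𝟙_ C) = 1) (hmul : ∀ X Y, φ (X ⊗ Y) = φ X * φ Y)
    (hadd : ∀ X Y, φ (X ⊞ Y) = φ X + φ Y) (X : C) : lift φ hφ hone hmul hadd (cls X) = φ X := by
  rw [cls, lift]
  refine (Ideal.Quotient.lift_mk _ _ _).trans ?_
  simp only [AlgHom.toRingHom_eq_coe, RingHom.coe_coe, MonoidAlgebra.lift_of]
  exact hφ _ _ (fromSkeletonToSkeletonIso X)

/-- An additive invariant of objects factors through the Green ring. -/
lemma exists_addMonoidHom {M : Type*} [AddCommGroup M] (φ : C → M)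
    (hφ : ∀ {X Y : C}, (X ≅ Y) → φ X = φ Y) (hadd : ∀ X Y, φ (X ⊞ Y) = φ X + φ Y)
    (hdist : ∀ X Y Z : C, Nonempty (Z ⊗ (X ⊞ Y) ≅ (Z ⊗ X) ⊞ (Z ⊗ Y))) :
    ∃ f : GreenRing C →+ M, ∀ X, f (cls X) = φ X := by
  have hsk (X : C) : φ (toSkeleton X).out = φ X := hφ (fromSkeletonToSkeletonIso X)
  let L : MonoidAlgebra ℤ (Skeleton C) →+ M :=
    (Finsupp.liftAddHom fun X : Skeleton C => (zmultiplesHom M (φ X.out))).comp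
      (MonoidAlgebra.coeffAddEquiv).toAddMonoidHom
  have hL (n : ℤ) (X : Skeleton C) : L (MonoidAlgebra.single X n) = n • φ X.out := by
    simp [L]
  have hL' (X : C) : L (MonoidAlgebra.of ℤ (Skeleton C) (toSkeleton X)) = φ X := by
    rw [MonoidAlgebra.of_apply, hL, one_smul, hsk]
  -- the kernel of `L` contains the ideal, not just the additive group, spanned by the relations
  have hker : ∀ a ∈ splitRelations C, ∀ x, L (x * a) = 0 := by
    intro a ha
    induction ha using Submodule.span_induction with
    | zero => simp
    | add a b _ _ ha hb => intro x; rw [mul_add, map_add, ha, hb, add_zero]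
    | smul c a _ ha => intro x; rw [smul_eq_mul, ← mul_assoc, ha]
    | mem a ha =>
      obtain ⟨X, Y, rfl⟩ := ha
      intro x
      induction x using MonoidAlgebra.induction_linear with
      | zero => simp
      | add f g hf hg => rw [add_mul, map_add, hf, hg, add_zero]
      | single Z n =>
        have h1 : toSkeleton Z.out = Z := Quotient.out_eq Z
        have h2 : MonoidAlgebra.single Z n =
            n • MonoidAlgebra.of ℤ (Skeleton C) (toSkeleton Z.out) := by
          rw [h1, MonoidAlgebra.of_apply, MonoidAlgebra.smul_single, smul_eq_mul, mul_one]
        obtain ⟨e⟩ := hdist X Y Z.out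
        rw [h2, smul_mul_assoc, map_zsmul, mul_sub, mul_add, ← map_mul, ← map_mul, ← map_mul,
          ← Skeleton.toSkeleton_tensorObj, ← Skeleton.toSkeleton_tensorObj,
          ← Skeleton.toSkeleton_tensorObj, map_sub, map_add, hL', hL', hL', hφ e, hadd, sub_self,
          smul_zero]
  refine ⟨QuotientAddGroup.lift (splitRelations C).toAddSubgroup L fun a ha => ?_, fun X => hL' X⟩
  have := hker a ha 1
  rwa [one_mul] at this

end GreenRing

/-! ### Products of Jordan blocks -/

section Products

variable {k : Type u} [Field k] {p N : ℕ} [Fact p.Prime] [CharP k p]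

variable (k p N) in
/-- The class of the Jordan block of size `m` in the Green ring. -/
abbrev jordanCls (m : ℕ) : GreenRing (FDRep k (CyclicGrp p N)) := GreenRing.cls (jordan k p N m)

lemma cls_eq_sum_of_rk_eq {V : FDRep k (CyclicGrp p N)} {S : Multiset ℕ} (h0 : 0 ∉ S)
    (hS : ∀ c, V.rk c = (S.map fun s => s - c).sum) :
    GreenRing.cls V = (S.map fun s => GreenRing.cls (jordan k p N s)).sum :=
  FDRep.additive_eq_of_rk_eq h0 hS GreenRing.cls GreenRing.cls_eq_of_iso GreenRing.cls_biprod

lemma cls_jordanInv {m : ℕ} (h0 : m ≠ 0) (h : m ≤ p ^ N) :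
    GreenRing.cls (jordanInv k p N m) = jordanCls k p N m := by
  rw [cls_eq_sum_of_rk_eq (S := {m}) (by simpa using h0.symm)
    (fun c => by rw [rk_jordanInv k p h]; simp)]
  simp

lemma rk_jordan_tensor_eq_sum {a b : ℕ} (ha : a ≤ p ^ N) (hb : b ≤ p ^ N) {S : Multiset ℕ}
    (hsum : S.sum = a * b)
    (hS : ∀ (A : Type u) [CommRing A] [CharP A p] (x y : A), x ^ a = 0 → y ^ b = 0 → ∀ c,
      (x - y) ^ (c + 1) ∣ x ^ (S.map fun s => if c < s then 1 else 0).sum * (x - y) ^ c) (c : ℕ) :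
    (jordan k p N a ⊗ jordanInv k p N b).rk c = (S.map fun s => s - c).sum := by
  have hx : (TruncPoly.t k a ⊗ₜ[k] (1 : TruncPoly k b)) ^ a = 0 := by
    rw [Algebra.TensorProduct.tmul_pow, TruncPoly.t_pow, TensorProduct.zero_tmul]
  have hy : ((1 : TruncPoly k a) ⊗ₜ[k] TruncPoly.t k b) ^ b = 0 := by
    rw [Algebra.TensorProduct.tmul_pow, TruncPoly.t_pow, TensorProduct.tmul_zero]
  refine rank_eq_of_drop_le (M := p ^ N) ?_ (fun c hc => ?_) (fun c => ?_) c
  · rw [rk_jordan_tensor k p ha hb, pow_zero, LinearMap.mulLeft_one, LinearMap.range_id,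
      finrank_top, Module.finrank_tensorProduct, TruncPoly.finrank_eq, TruncPoly.finrank_eq, hsum]
  · rw [← FDRep.nilp_pow_eq_zero_iff]
    exact pow_eq_zero_of_le hc (FDRep.nilp_pow_eq_zero _)
  · rw [rk_jordan_tensor k p ha hb, rk_jordan_tensor k p ha hb]
    refine finrank_range_mulLeft_pow_le (TruncPoly.exists_aeval_tensor k) ?_
    rcases subsingleton_or_nontrivial (TruncPoly k a ⊗[k] TruncPoly k b) with h | h
    · exact ⟨0, Subsingleton.elim _ _⟩
    · have : CharP (TruncPoly k a ⊗[k] TruncPoly k b) p :=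
        charP_of_injective_algebraMap (algebraMap k _).injective p
      exact hS _ _ _ hx hy c

/-- A product of classes of Jordan blocks is determined by upper bounds for the ranks. -/
lemma cls_jordan_mul {a b : ℕ} (ha : a ≤ p ^ N) (hb0 : b ≠ 0) (hb : b ≤ p ^ N) {S : Multiset ℕ}
    (h0 : 0 ∉ S) (hsum : S.sum = a * b)
    (hS : ∀ (A : Type u) [CommRing A] [CharP A p] (x y : A), x ^ a = 0 → y ^ b = 0 → ∀ c,
      (x - y) ^ (c + 1) ∣ x ^ (S.map fun s => if c < s then 1 else 0).sum * (x - y) ^ c) :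
    jordanCls k p N a * jordanCls k p N b = (S.map fun s => jordanCls k p N s).sum := by
  rw [← cls_jordanInv hb0 hb, ← GreenRing.cls_tensor]
  exact cls_eq_sum_of_rk_eq h0 (rk_jordan_tensor_eq_sum ha hb hsum hS)

variable {n a i j : ℕ}

lemma cls_jordan_mul_even (ha : 1 ≤ a) (haq : a ≤ p ^ n) (hi : (i + 2) * p ^ n ≤ p ^ N) :
    jordanCls k p N a * jordanCls k p N ((i + 1) * p ^ n + 1) =
      jordanCls k p N ((i + 1) * p ^ n + a) + (a - 1) • jordanCls k p N ((i + 1) * p ^ n) := by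
  have hq : 0 < p ^ n := ha.trans haq
  have e1 : (i + 2) * p ^ n = (i + 1) * p ^ n + p ^ n := by ring
  have e2 : (i + 1) * p ^ n = i * p ^ n + p ^ n := by ring
  rw [cls_jordan_mul (S := ((i + 1) * p ^ n + a) ::ₘ Multiset.replicate (a - 1) ((i + 1) * p ^ n))
    (by omega) (by omega) (by omega) ?_ ?_ ?_]
  · simp
  · rw [Multiset.mem_cons, Multiset.mem_replicate]
    omega
  · rw [Multiset.sum_cons, Multiset.sum_replicate, smul_eq_mul]
    obtain ⟨a, rfl⟩ : ∃ a', a = a' + 1 := ⟨a - 1, by omega⟩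
    rw [Nat.add_sub_cancel]
    ring
  · intro A _ _ x y hx hy c
    exact dvd_of_pow_eq_zero_even ha haq hx hy

lemma cls_jordan_mul_odd (ha : 1 ≤ a) (haq : a < p ^ n) (hj : (j + 1) * p ^ n ≤ p ^ N) :
    jordanCls k p N a * jordanCls k p N ((j + 1) * p ^ n - 1) =
      jordanCls k p N ((j + 1) * p ^ n - a) + (a - 1) • jordanCls k p N ((j + 1) * p ^ n) := by
  have e2 : (j + 1) * p ^ n = j * p ^ n + p ^ n := by ring
  rw [cls_jordan_mul (S := ((j + 1) * p ^ n - a) ::ₘ Multiset.replicate (a - 1) ((j + 1) * p ^ n))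
    (by omega) (by omega) (by omega) ?_ ?_ ?_]
  · simp
  · rw [Multiset.mem_cons, Multiset.mem_replicate]
    omega
  · rw [Multiset.sum_cons, Multiset.sum_replicate, smul_eq_mul]
    obtain ⟨a, rfl⟩ : ∃ a', a = a' + 1 := ⟨a - 1, by omega⟩
    obtain ⟨r, hr⟩ : ∃ r, (j + 1) * p ^ n = a + 1 + r := Nat.exists_eq_add_of_le (by omega)
    rw [hr, Nat.add_sub_cancel_left, Nat.add_sub_cancel, show a + 1 + r - 1 = a + r by omega]
    ring
  · intro A _ _ x y hx hy c
    exact dvd_of_pow_eq_zero_odd ha haq hx hy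

lemma cls_jordan_mul_generator (hq : 2 ≤ p ^ n) (hN : N = n + 1) (hi : i + 2 < p) :
    jordanCls k p N (p ^ n + 1) * jordanCls k p N ((i + 1) * p ^ n + 1) =
      jordanCls k p N ((i + 2) * p ^ n + 1) + jordanCls k p N (i * p ^ n + 1) +
        jordanCls k p N ((i + 2) * p ^ n - 1) +
        (p ^ n - 2) • jordanCls k p N ((i + 1) * p ^ n) := by
  have e1 : (i + 2) * p ^ n = (i + 1) * p ^ n + p ^ n := by ring
  have e2 : (i + 1) * p ^ n = i * p ^ n + p ^ n := by ring
  have e3 : (i + 3) * p ^ n ≤ p ^ N := by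
    rw [hN, pow_succ']
    exact Nat.mul_le_mul_right _ hi
  have e4 : (i + 3) * p ^ n = (i + 2) * p ^ n + p ^ n := by ring
  rw [cls_jordan_mul (S := ((i + 2) * p ^ n + 1) ::ₘ (i * p ^ n + 1) ::ₘ
      ((i + 2) * p ^ n - 1) ::ₘ Multiset.replicate (p ^ n - 2) ((i + 1) * p ^ n))
    (by omega) (by omega) (by omega) ?_ ?_ ?_]
  · simp [add_assoc]
  · simp only [Multiset.mem_cons, Multiset.mem_replicate]
    omega
  · simp only [Multiset.sum_cons, Multiset.sum_replicate, smul_eq_mul]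
    obtain ⟨r, hr⟩ : ∃ r, p ^ n = 2 + r := Nat.exists_eq_add_of_le hq
    rw [hr, Nat.add_sub_cancel_left, show (i + 2) * (2 + r) - 1 = (i + 1) * (2 + r) + 1 + r by
      rw [show (i + 2) * (2 + r) = (i + 1) * (2 + r) + 1 + r + 1 by ring, Nat.add_sub_cancel]]
    ring
  · intro A _ _ x y hx hy c
    exact dvd_of_pow_eq_zero_generator hx hy hq hi

lemma cls_jordan_mul_generator_last (hq : 2 ≤ p ^ n) (hN : N = n + 1) (hi : i + 2 = p) :
    jordanCls k p N (p ^ n + 1) * jordanCls k p N ((i + 1) * p ^ n + 1) =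
      jordanCls k p N (i * p ^ n + 1) + 2 • jordanCls k p N ((i + 2) * p ^ n) +
        (p ^ n - 2) • jordanCls k p N ((i + 1) * p ^ n) := by
  have e1 : (i + 2) * p ^ n = (i + 1) * p ^ n + p ^ n := by ring
  have e2 : (i + 1) * p ^ n = i * p ^ n + p ^ n := by ring
  have e3 : (i + 2) * p ^ n = p ^ N := by rw [hN, pow_succ', hi]
  rw [cls_jordan_mul (S := ((i + 2) * p ^ n) ::ₘ (i * p ^ n + 1) ::ₘ
      ((i + 2) * p ^ n) ::ₘ Multiset.replicate (p ^ n - 2) ((i + 1) * p ^ n))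
    (by omega) (by omega) (by omega) ?_ ?_ ?_]
  · simp only [Multiset.map_cons, Multiset.sum_cons, Multiset.map_replicate,
      Multiset.sum_replicate]
    abel
  · simp only [Multiset.mem_cons, Multiset.mem_replicate]
    omega
  · simp only [Multiset.sum_cons, Multiset.sum_replicate, smul_eq_mul]
    obtain ⟨r, hr⟩ : ∃ r, p ^ n = 2 + r := Nat.exists_eq_add_of_le hq
    rw [hr, Nat.add_sub_cancel_left]
    ring
  · intro A _ _ x y hx hy c
    exact dvd_of_pow_eq_zero_generator_last hx hy hq hi

end Products

/-! ### Endomorphisms of Jordan blocks -/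

section Endomorphisms

variable {k : Type u} [Field k] {p N : ℕ}

namespace FDRep

lemma trace_eq_of_isNilpotent_sub_smul {V : FDRep k (CyclicGrp p N)} {f : V ⟶ V} {c : k}
    (h : IsNilpotent (lin f - c • LinearMap.id : Module.End k V)) :
    trace f = c * (Module.finrank k V : k) := by
  have h1 := (LinearMap.isNilpotent_trace_of_isNilpotent h).eq_zero
  rw [map_sub, map_smul, LinearMap.trace_id, sub_eq_zero] at h1
  exact h1

lemma isIso_of_bijective {G : Type v} [Monoid G] {V W : FDRep k G} (f : V ⟶ W)
    (h : Function.Bijective (lin f)) : IsIso f := by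
  let e : V ≃ₗ[k] W := LinearEquiv.ofBijective (lin f) h
  have he (x) : lin f x = e x := rfl
  refine ⟨ofLin (e.symm : W →ₗ[k] V) fun g => ?_, lin_injective ?_, lin_injective ?_⟩
  · ext x
    change e.symm (W.ρ g x) = V.ρ g (e.symm x)
    rw [LinearEquiv.symm_apply_eq, ← he, lin_apply_ρ, he, e.apply_symm_apply]
  · ext x
    exact e.symm_apply_apply x
  · ext x
    exact e.apply_symm_apply x

lemma isIso_of_isNilpotent_sub_smul {V : FDRep k (CyclicGrp p N)} {f : V ⟶ V} {c : k} (hc : c ≠ 0)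
    (h : IsNilpotent (lin f - c • LinearMap.id : Module.End k V)) : IsIso f := by
  have h1 : IsUnit (c • LinearMap.id : Module.End k V) :=
    (isUnit_one (M := Module.End k V)).smul (Units.mk0 c hc)
  have h2 : IsUnit (lin f : Module.End k V) := by
    have := h.isUnit_add_left_of_commute h1
      (by rw [commute_iff_eq]; ext; simp)
    rwa [add_sub_cancel] at this
  exact isIso_of_bijective f ((Module.End.isUnit_iff _).mp h2)

variable [Fact p.Prime] [CharP k p]

/-- An endomorphism of a Jordan block is multiplication by an element of the local algebra
`k[t]/(t^m)`, hence a scalar plus a nilpotent map. -/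
lemma exists_isNilpotent_sub_smul {m : ℕ} (hm : m ≤ p ^ N)
    (f : jordan k p N m ⟶ jordan k p N m) :
    ∃ c : k, IsNilpotent (lin f - c • LinearMap.id : Module.End k (jordan k p N m)) := by
  revert f
  rw [jordan_eq k p hm]
  intro f
  have hT := regRep_nilp (k := k) (1 + TruncPoly.t k m) (TruncPoly.one_add_t_pow hm)
  rw [add_sub_cancel_left] at hT
  obtain ⟨φ, hφ⟩ : ∃ φ : TruncPoly k m →ₗ[k] TruncPoly k m, φ = lin f := ⟨_, rfl⟩
  have h1 (x : TruncPoly k m) : φ (TruncPoly.t k m * x) = TruncPoly.t k m * φ x := by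
    have := lin_nilp f x
    rw [hT, ← hφ] at this
    exact this
  have h2 : φ = LinearMap.mulLeft k (φ 1) := by
    refine (TruncPoly.basis k m).ext fun j => ?_
    rw [TruncPoly.basis_apply, LinearMap.mulLeft_apply]
    generalize (j : ℕ) = j
    induction j with
    | zero => simp
    | succ j ih => rw [pow_succ' (TruncPoly.t k m), h1, ih, mul_left_comm]
  obtain ⟨g, hg⟩ := TruncPoly.exists_aeval k m (φ 1)
  refine ⟨g.coeff 0, ?_⟩
  rw [← hφ]
  have h3 : φ - g.coeff 0 • LinearMap.id =
      LinearMap.mulLeft k (TruncPoly.t k m * Polynomial.aeval (TruncPoly.t k m) g.divX) := by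
    have h4 := congrArg (Polynomial.aeval (TruncPoly.t k m)) (Polynomial.X_mul_divX_add g)
    rw [map_add, map_mul, Polynomial.aeval_X, Polynomial.aeval_C] at h4
    rw [h2, hg]
    refine LinearMap.ext fun x => ?_
    rw [LinearMap.sub_apply, LinearMap.mulLeft_apply, LinearMap.smul_apply, LinearMap.id_apply,
      LinearMap.mulLeft_apply, Algebra.smul_def, ← h4]
    ring
  refine (?_ : IsNilpotent (φ - g.coeff 0 • LinearMap.id : Module.End k (TruncPoly k m)))
  rw [h3]
  refine ⟨m, ?_⟩
  rw [LinearMap.pow_mulLeft, mul_pow, TruncPoly.t_pow, zero_mul, LinearMap.mulLeft_zero_eq_zero]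

lemma finrank_jordan_eq_zero_iff {m : ℕ} (hm : m ≤ p ^ N) :
    (Module.finrank k (jordan k p N m) : k) = 0 ↔ p ∣ m := by
  rw [finrank_jordan k p hm, CharP.cast_eq_zero_iff k p]

/-- The trace of a scalar plus a nilpotent map on a space of dimension `m` is a multiple of `m`. -/
lemma isNegligible_id_jordan {m : ℕ} (hm : m ≤ p ^ N) (h : p ∣ m) :
    IsNegligible (𝟙 (jordan k p N m)) := by
  intro g
  obtain ⟨c, hc⟩ := exists_isNilpotent_sub_smul hm (𝟙 _ ≫ g)
  rw [trace_eq_of_isNilpotent_sub_smul hc, (finrank_jordan_eq_zero_iff hm).mpr h, mul_zero]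

/-- Morphisms between Jordan blocks of different sizes are negligible, since an endomorphism
factoring through a smaller block is not invertible. -/
lemma isNegligible_of_ne {a b : ℕ} (ha : a ≤ p ^ N) (hb : b ≤ p ^ N) (hab : a ≠ b)
    (f : jordan k p N a ⟶ jordan k p N b) : IsNegligible f := by
  have key : ∀ {a b : ℕ} (_ : a ≤ p ^ N) (_ : b ≤ p ^ N) (_ : b < a)
      (f : jordan k p N a ⟶ jordan k p N b) (g : jordan k p N b ⟶ jordan k p N a),
      trace (f ≫ g) = 0 := by
    intro a b ha hb hab f g
    obtain ⟨c, hc⟩ := exists_isNilpotent_sub_smul ha (f ≫ g)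
    rw [trace_eq_of_isNilpotent_sub_smul hc]
    by_cases h0 : c = 0
    · rw [h0, zero_mul]
    · have := isIso_of_isNilpotent_sub_smul h0 hc
      have h1 : Function.Injective (lin f) := by
        have h2 : Function.Injective (lin (f ≫ g)) := (linEquiv (asIso (f ≫ g))).injective
        rw [lin_comp, LinearMap.coe_comp] at h2
        exact h2.of_comp
      have h3 := LinearMap.finrank_le_finrank_of_injective h1
      rw [finrank_jordan k p ha, finrank_jordan k p hb] at h3
      omega
  intro g
  rcases Nat.lt_or_gt_of_ne hab with h | h
  · rw [trace_comp_comm]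
    exact key hb ha h g f
  · exact key ha hb h f g

/-- A non-negligible morphism onto a Jordan block of nonzero dimension is split. -/
lemma isSplitEpi_of_not_isNegligible {m : ℕ} (hm : m ≤ p ^ N) {V : FDRep k (CyclicGrp p N)}
    (f : V ⟶ jordan k p N m) (hf : ¬ IsNegligible f) : IsSplitEpi f := by
  obtain ⟨g, hg⟩ := not_forall.mp hf
  rw [trace_comp_comm] at hg
  obtain ⟨c, hc⟩ := exists_isNilpotent_sub_smul hm (g ≫ f)
  have h0 : c ≠ 0 := by
    rintro rfl
    exact hg (by rw [trace_eq_of_isNilpotent_sub_smul hc, zero_mul])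
  have := isIso_of_isNilpotent_sub_smul h0 hc
  exact ⟨⟨inv (g ≫ f) ≫ g, by rw [Category.assoc, IsIso.inv_hom_id]⟩⟩

lemma not_isNegligible_id_jordan {m : ℕ} (hm : m ≤ p ^ N) (h : ¬ p ∣ m) :
    ¬ IsNegligible (𝟙 (jordan k p N m)) := by
  intro h1
  have h2 := h1 (𝟙 _)
  have h3 : trace (𝟙 (jordan k p N m)) = (Module.finrank k (jordan k p N m) : k) :=
    LinearMap.trace_id ..
  rw [Category.comp_id, h3, finrank_jordan_eq_zero_iff hm] at h2
  exact h h2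

lemma indecomposable_jordan {m : ℕ} (h0 : 0 < m) (hm : m ≤ p ^ N) :
    Indecomposable (jordan k p N m) := by
  -- the cokernel of `g - 1` is one-dimensional on a block and nonzero on every nonzero summand
  have hzero : ∀ V : FDRep k (CyclicGrp p N), V.rk 0 = V.rk 1 → IsZero V := by
    intro V hV
    have h1 : ∀ c, V.rk c = V.rk 0 := by
      have h2 : LinearMap.range V.nilp = ⊤ := by
        refine Submodule.eq_top_of_finrank_eq ?_
        rw [rk_zero, rk, pow_one] at hV
        exact hV.symm
      have h3 : Function.Surjective V.nilp := LinearMap.range_eq_top.mp h2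
      intro c
      rw [rk, rk_zero]
      have h4 : LinearMap.range (V.nilp ^ c) = ⊤ := by
        rw [LinearMap.range_eq_top, Module.End.coe_pow]
        exact h3.iterate c
      rw [h4, finrank_top]
    refine isZero_of_finrank_eq_zero ?_
    rw [← rk_zero, ← h1 (p ^ N), ← nilp_pow_eq_zero_iff, nilp_pow_eq_zero]
  refine ⟨fun h => ?_, fun Y Z e => ?_⟩
  · have := finrank_eq_zero_of_isZero h
    rw [finrank_jordan k p hm] at this
    omega
  · have h1 := fun c => (rk_eq_of_iso e c).trans (rk_biprod Y Z c)
    have h2 := h1 0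
    have h3 := h1 1
    rw [rk_jordan k p hm] at h2 h3
    have h4 : Y.rk 1 ≤ Y.rk 0 := by rw [rk_zero]; exact Submodule.finrank_le _
    have h5 : Z.rk 1 ≤ Z.rk 0 := by rw [rk_zero]; exact Submodule.finrank_le _
    by_cases hY : Y.rk 0 = Y.rk 1
    · exact Or.inl (hzero Y hY)
    · exact Or.inr (hzero Z (by omega))

lemma exists_iso_jordan_of_indecomposable {V : FDRep k (CyclicGrp p N)} (h : Indecomposable V) :
    ∃ m, 0 < m ∧ m ≤ p ^ N ∧ Nonempty (V ≅ jordan k p N m) := by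
  obtain ⟨m, h0, hm, W, ⟨e⟩⟩ := exists_iso_jordan_biprod V h.1
  refine ⟨m, h0, hm, ?_⟩
  rcases h.2 _ _ e with h1 | h1
  · exact absurd h1 (indecomposable_jordan h0 hm).1
  · exact ⟨e ≪≫ (isoBiprodZero h1).symm⟩

end FDRep

end Endomorphisms

/-! ### The semisimplification -/

/-- Additive functors preserve binary biproducts. -/
def CategoryTheory.Functor.additiveMapBiprod {C D : Type*} [Category* C] [Category* D]
    [Preadditive C] [Preadditive D] [HasBinaryBiproducts C] [HasBinaryBiproducts D] (F : C ⥤ D)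
    [F.Additive] (X Y : C) : F.obj (X ⊞ Y) ≅ F.obj X ⊞ F.obj Y :=
  have := preservesBinaryBiproducts_of_preservesBiproducts F
  F.mapBiprod X Y

namespace Semisimplification

section General

variable {k : Type u} [Field k] {G : Type v} [Group G]

lemma map_eq_zero_iff {X Y : FDRep k G} (f : X ⟶ Y) :
    (functor k G).map f = 0 ↔ FDRep.IsNegligible f := by
  rw [← (functor k G).map_zero X Y, CategoryTheory.Quotient.functor_map_eq_iff]
  change FDRep.IsNegligible (f - 0) ↔ _
  rw [sub_zero]

lemma isZero_obj_iff {X : FDRep k G} :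
    IsZero ((functor k G).obj X) ↔ FDRep.IsNegligible (𝟙 X) := by
  rw [IsZero.iff_id_eq_zero, ← (functor k G).map_id, map_eq_zero_iff]

lemma negligibleRel_smul (a : k) ⦃X Y : FDRep k G⦄ (f₁ f₂ : X ⟶ Y)
    (h : negligibleRel k G f₁ f₂) : negligibleRel k G (a • f₁) (a • f₂) := by
  change FDRep.IsNegligible (a • f₁ - a • f₂)
  intro g
  rw [← smul_sub, Linear.smul_comp]
  have h1 : FDRep.trace (a • ((f₁ - f₂) ≫ g)) = a • FDRep.trace ((f₁ - f₂) ≫ g) :=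
    map_smul (LinearMap.trace k X) a (FDRep.lin ((f₁ - f₂) ≫ g))
  rw [h1, h g, smul_zero]

instance : Linear k (Semisimplification k G) :=
  CategoryTheory.Quotient.linear k _ negligibleRel_smul

instance : (functor k G).Linear k :=
  CategoryTheory.Quotient.linear_functor _ _ negligibleRel_smul

instance (X Y : Semisimplification k G) : Module.Finite k (X ⟶ Y) :=
  Module.Finite.of_surjective ((functor k G).mapLinearMap k : (X.as ⟶ Y.as) →ₗ[k] _)
    (functor k G).map_surjective

instance : MonoidalPreadditive (Semisimplification k G) where
  whiskerLeft_zero {X Y Z} := by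
    have h := map_whiskerLeft X.as (0 : Y.as ⟶ Z.as)
    rw [MonoidalPreadditive.whiskerLeft_zero, Functor.map_zero] at h
    exact h
  zero_whiskerRight {X Y Z} := by
    have h := map_whiskerRight (0 : Y.as ⟶ Z.as) X.as
    rw [MonoidalPreadditive.zero_whiskerRight, Functor.map_zero] at h
    exact h
  whiskerLeft_add {X Y Z} f g := by
    obtain ⟨f, rfl⟩ := (functor k G).map_surjective f
    obtain ⟨g, rfl⟩ := (functor k G).map_surjective g
    have h := map_whiskerLeft X.as (f + g)
    rw [MonoidalPreadditive.whiskerLeft_add, Functor.map_add, Functor.map_add] at h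
    exact h
  add_whiskerRight {X Y Z} f g := by
    obtain ⟨f, rfl⟩ := (functor k G).map_surjective f
    obtain ⟨g, rfl⟩ := (functor k G).map_surjective g
    have h := map_whiskerRight (f + g) X.as
    rw [MonoidalPreadditive.add_whiskerRight, Functor.map_add, Functor.map_add] at h
    exact h

lemma finrank_hom_biprod (W X Y : Semisimplification k G) : Module.finrank k (W ⟶ X ⊞ Y) =
    Module.finrank k (W ⟶ X) + Module.finrank k (W ⟶ Y) := by
  rw [← Module.finrank_prod]
  exact LinearEquiv.finrank_eq
    { toFun := fun f => (f ≫ biprod.fst, f ≫ biprod.snd)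
      invFun := fun f => biprod.lift f.1 f.2
      left_inv := fun f => by ext <;> simp
      right_inv := fun f => by ext <;> simp
      map_add' := fun f g => by simp
      map_smul' := fun a f => by simp }

/-- The dimension of `Hom(W, -)` as an additive function on the Grothendieck ring. -/
lemma exists_finrank_hom (W : Semisimplification k G) :
    ∃ f : GreenRing (Semisimplification k G) →+ ℤ,
      ∀ X, f (GreenRing.cls X) = Module.finrank k (W ⟶ X) :=
  GreenRing.exists_addMonoidHom (fun X => (Module.finrank k (W ⟶ X) : ℤ))
    (fun e => by rw [(Linear.homCongr k (Iso.refl W) e).finrank_eq])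
    (fun X Y => by rw [finrank_hom_biprod, Nat.cast_add])
    fun X Y Z => ⟨(tensorLeft Z).additiveMapBiprod X Y⟩

lemma cls_obj_biprod (X Y : FDRep k G) : GreenRing.cls ((functor k G).obj (X ⊞ Y)) =
    GreenRing.cls ((functor k G).obj X) + GreenRing.cls ((functor k G).obj Y) := by
  rw [GreenRing.cls_eq_of_iso ((functor k G).additiveMapBiprod X Y), GreenRing.cls_biprod]

end General

section Cyclic

variable {k : Type u} [Field k] {p N : ℕ} [Fact p.Prime] [CharP k p]

lemma isZero_obj_jordan_iff {m : ℕ} (hm : m ≤ p ^ N) :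
    IsZero ((functor k (CyclicGrp p N)).obj (jordan k p N m)) ↔ p ∣ m := by
  rw [isZero_obj_iff]
  exact ⟨fun h => by_contra fun h1 => FDRep.not_isNegligible_id_jordan hm h1 h,
    FDRep.isNegligible_id_jordan hm⟩

lemma finrank_hom_jordan_of_ne {a b : ℕ} (ha : a ≤ p ^ N) (hb : b ≤ p ^ N) (hab : a ≠ b) :
    Module.finrank k ((functor k (CyclicGrp p N)).obj (jordan k p N a) ⟶
      (functor k (CyclicGrp p N)).obj (jordan k p N b)) = 0 := by
  rw [Module.finrank_zero_iff]
  have h : ∀ f : (functor k (CyclicGrp p N)).obj (jordan k p N a) ⟶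
      (functor k (CyclicGrp p N)).obj (jordan k p N b), f = 0 := by
    intro f
    obtain ⟨f, rfl⟩ := (functor k (CyclicGrp p N)).map_surjective f
    rw [map_eq_zero_iff]
    exact FDRep.isNegligible_of_ne ha hb hab f
  exact ⟨fun f g => (h f).trans (h g).symm⟩

lemma finrank_hom_jordan_ne_zero {a : ℕ} (ha : a ≤ p ^ N) (h : ¬ p ∣ a) :
    Module.finrank k ((functor k (CyclicGrp p N)).obj (jordan k p N a) ⟶
      (functor k (CyclicGrp p N)).obj (jordan k p N a)) ≠ 0 := by
  rw [Ne, Module.finrank_zero_iff]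
  intro h1
  refine h ((isZero_obj_jordan_iff (k := k) ha).mp ?_)
  rw [IsZero.iff_id_eq_zero]
  exact Subsingleton.elim _ _

/-- A nonzero morphism to the image of the block comes from a split epimorphism. -/
lemma simple_obj_jordan {m : ℕ} (hm : m ≤ p ^ N) (h : ¬ p ∣ m) :
    Simple ((functor k (CyclicGrp p N)).obj (jordan k p N m)) where
  mono_isIso_iff_nonzero {Y} f _ := by
    constructor
    · rintro h1 rfl
      refine h ((isZero_obj_jordan_iff (k := k) hm).mp ?_)
      rw [IsZero.iff_id_eq_zero, ← IsIso.inv_hom_id (0 : Y ⟶ _), comp_zero]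
    · intro h1
      obtain ⟨g, rfl⟩ := (functor k (CyclicGrp p N)).map_surjective (X := Y.as) f
      have h2 : ¬ FDRep.IsNegligible g := fun h2 => h1 ((map_eq_zero_iff g).mpr h2)
      have := FDRep.isSplitEpi_of_not_isNegligible hm g h2
      have : IsSplitEpi ((functor k (CyclicGrp p N)).map g) := inferInstance
      exact isIso_of_mono_of_isSplitEpi _

/-- Blocks of size divisible by `p` vanish in the semisimplification, and any other block in `V` is
a nonzero direct summand of the image of `V`. -/
lemma exists_iso_jordan_of_simple_obj (V : FDRep k (CyclicGrp p N))
    (hV : Simple ((functor k (CyclicGrp p N)).obj V)) :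
    ∃ m, m ≤ p ^ N ∧ ¬ p ∣ m ∧ Nonempty ((functor k (CyclicGrp p N)).obj V ≅
      (functor k (CyclicGrp p N)).obj (jordan k p N m)) := by
  induction h : Module.finrank k V using Nat.strong_induction_on generalizing V with
  | _ d ih =>
  have h0 : ¬ IsZero V := fun h0 => Simple.not_isZero ((functor k (CyclicGrp p N)).obj V)
    ((functor k (CyclicGrp p N)).map_isZero h0)
  obtain ⟨m, hm0, hm, W, ⟨e⟩⟩ := FDRep.exists_iso_jordan_biprod V h0
  by_cases hp : p ∣ m
  · have e1 : (functor k (CyclicGrp p N)).obj V ≅ (functor k (CyclicGrp p N)).obj W :=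
      (functor k (CyclicGrp p N)).mapIso e ≪≫ (functor k (CyclicGrp p N)).additiveMapBiprod _ _ ≪≫
        (isoZeroBiprod ((isZero_obj_jordan_iff hm).mpr hp)).symm
    have h1 := (FDRep.rk_eq_of_iso e 0).trans (FDRep.rk_biprod _ W 0)
    rw [rk_jordan k p hm, FDRep.rk_zero, FDRep.rk_zero] at h1
    obtain ⟨m', h2, h3, ⟨e2⟩⟩ := ih _ (by omega) W (Simple.of_iso e1.symm) rfl
    exact ⟨m', h2, h3, ⟨e1 ≪≫ e2⟩⟩
  · refine ⟨m, hm, hp, ?_⟩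
    have h1 : IsSplitMono ((functor k (CyclicGrp p N)).map
        (biprod.inl ≫ e.inv : jordan k p N m ⟶ V)) := inferInstance
    have h2 : (functor k (CyclicGrp p N)).map (biprod.inl ≫ e.inv : jordan k p N m ⟶ V) ≠ 0 := by
      intro h2
      refine hp ((isZero_obj_jordan_iff (k := k) hm).mp ?_)
      have h3 : (functor k (CyclicGrp p N)).map (biprod.inl ≫ e.inv : jordan k p N m ⟶ V) ≫
          (functor k (CyclicGrp p N)).map (e.hom ≫ biprod.fst) = 𝟙 _ := by
        rw [← Functor.map_comp, Category.assoc, e.inv_hom_id_assoc, biprod.inl_fst,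
          CategoryTheory.Functor.map_id]
      rw [IsZero.iff_id_eq_zero, ← h3, h2, zero_comp]
    have := isIso_of_mono_of_nonzero h2
    exact ⟨(asIso ((functor k (CyclicGrp p N)).map
      (biprod.inl ≫ e.inv : jordan k p N m ⟶ V))).symm⟩

end Cyclic

end Semisimplification

/-! ### The multiplicity of the trivial representation in a tensor product -/

section Trivial

variable (k : Type u) [Field k]

/-- The second difference of the ranks of `1`, `z`, `z^2` is `dim ker z - dim (ker z ∩ im z)`. -/
lemma finrank_range_sq_add (A : Type*) [CommRing A] [Algebra k A] [Module.Finite k A] (z : A) :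
    Module.finrank k A + Module.finrank k (LinearMap.range (LinearMap.mulLeft k (z ^ 2))) +
        Module.finrank k ↥(LinearMap.ker (LinearMap.mulLeft k z) ⊓
          LinearMap.range (LinearMap.mulLeft k z)) =
      2 * Module.finrank k (LinearMap.range (LinearMap.mulLeft k z)) +
        Module.finrank k (LinearMap.ker (LinearMap.mulLeft k z)) := by
  have h1 := LinearMap.finrank_range_add_finrank_ker (LinearMap.mulLeft k z)
  have h2 := LinearMap.finrank_range_add_finrank_ker
    ((LinearMap.mulLeft k z).domRestrict (LinearMap.range (LinearMap.mulLeft k z)))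
  have h3 : LinearMap.range ((LinearMap.mulLeft k z).domRestrict
      (LinearMap.range (LinearMap.mulLeft k z))) =
        LinearMap.range (LinearMap.mulLeft k (z ^ 2)) := by
    rw [LinearMap.range_domRestrict, ← LinearMap.range_comp]
    congr 1
    ext x
    simp [pow_two]
  have h4 : Module.finrank k (LinearMap.ker ((LinearMap.mulLeft k z).domRestrict
      (LinearMap.range (LinearMap.mulLeft k z)))) =
        Module.finrank k ↥(LinearMap.ker (LinearMap.mulLeft k z) ⊓
          LinearMap.range (LinearMap.mulLeft k z)) := by
    rw [LinearMap.ker_domRestrict, inf_comm, ← Submodule.map_comap_subtype,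
      Submodule.finrank_map_subtype_eq]
  rw [h3, h4] at h2
  omega

namespace TruncPoly

/-- The element `x` of `k[x, y]/(x^a, y^b)`. -/
abbrev left (a b : ℕ) : TruncPoly k a ⊗[k] TruncPoly k b := t k a ⊗ₜ[k] (1 : TruncPoly k b)

/-- The element `y` of `k[x, y]/(x^a, y^b)`. -/
abbrev right (a b : ℕ) : TruncPoly k a ⊗[k] TruncPoly k b := (1 : TruncPoly k a) ⊗ₜ[k] t k b

/-- The sum of all monomials of degree `b - 1` in `k[x, y]/(x^a, y^b)`. For `a ≤ b` it generates the
annihilator of `x - y`. -/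
def socleGen (a b : ℕ) : TruncPoly k a ⊗[k] TruncPoly k b :=
  ∑ e ∈ Finset.range b, (TruncPoly.t k a ^ e) ⊗ₜ[k] (TruncPoly.t k b ^ (b - 1 - e))

/-- Multiplication by `socleGen`. -/
def socleMap (a b : ℕ) : TruncPoly k a →ₗ[k] TruncPoly k a ⊗[k] TruncPoly k b :=
  LinearMap.mulLeft k (socleGen k a b) ∘ₗ
    (Algebra.TensorProduct.includeLeft : TruncPoly k a →ₐ[k] _).toLinearMap

variable {k} {a b : ℕ}

lemma socleMap_apply (f : TruncPoly k a) :
    socleMap k a b f = socleGen k a b * (f ⊗ₜ[k] (1 : TruncPoly k b)) := rfl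

lemma socleGen_eq : socleGen k a b =
    ∑ e ∈ Finset.range b, left k a b ^ e * right k a b ^ (b - 1 - e) := by
  refine Finset.sum_congr rfl fun e _ => ?_
  simp [Algebra.TensorProduct.tmul_pow]

lemma tmul_one_pow_eq_zero {e : ℕ} (h : a ≤ e) : left k a b ^ e = 0 := by
  rw [Algebra.TensorProduct.tmul_pow, pow_eq_zero_of_le h (TruncPoly.t_pow k a),
    TensorProduct.zero_tmul]

lemma one_tmul_pow_eq_zero {e : ℕ} (h : b ≤ e) : right k a b ^ e = 0 := by
  rw [Algebra.TensorProduct.tmul_pow, pow_eq_zero_of_le h (TruncPoly.t_pow k b),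
    TensorProduct.tmul_zero]

lemma sub_mul_socleGen (hab : a ≤ b) : (left k a b - right k a b) * socleGen k a b = 0 := by
  rw [socleGen_eq, mul_comm, geom_sum₂_mul, tmul_one_pow_eq_zero hab, one_tmul_pow_eq_zero le_rfl,
    sub_self]

/-- The coefficient of `y^(b-1)` in `socleGen * f(x)` is `f(x)`. -/
lemma socleMap_injective (hb : 0 < b) : Function.Injective (socleMap k a b) := by
  let φ : TruncPoly k b →ₗ[k] k := (TruncPoly.basis k b).coord ⟨b - 1, by omega⟩
  have hφ : ∀ e < b, φ (TruncPoly.t k b ^ e) = if e = b - 1 then 1 else 0 := by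
    intro e he
    have : TruncPoly.t k b ^ e = TruncPoly.basis k b ⟨e, he⟩ :=
      (TruncPoly.basis_apply k b ⟨e, he⟩).symm
    rw [this, Module.Basis.coord_apply, Module.Basis.repr_self, Finsupp.single_apply]
    simp [Fin.ext_iff]
  refine Function.LeftInverse.injective (g := (TensorProduct.rid k (TruncPoly k a)).toLinearMap ∘ₗ
    TensorProduct.map LinearMap.id φ) fun f => ?_
  rw [socleMap_apply, socleGen, Finset.sum_mul, map_sum, Finset.sum_eq_single 0]
  · rw [Algebra.TensorProduct.tmul_mul_tmul]
    simp [hφ (b - 1) (by omega)]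
  · intro e he h0
    have := Finset.mem_range.mp he
    rw [Algebra.TensorProduct.tmul_mul_tmul]
    simp [hφ (b - 1 - e) (by omega), show ¬ (b - 1 - e = b - 1) by omega]
  · intro h
    exact absurd (Finset.mem_range.mpr hb) h

/-- The range is contained in the annihilator of `x - y`, whose dimension, equal to that of
`A / (x - y) A`, is at most `a` since the latter is spanned by `1, x, …, x^(a-1)`. -/
lemma range_socleMap (hb : 0 < b) (hab : a ≤ b) :
    LinearMap.range (socleMap k a b) =
      LinearMap.ker (LinearMap.mulLeft k (left k a b - right k a b)) := by
  refine Submodule.eq_of_le_of_finrank_le ?_ ?_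
  · rintro _ ⟨f, rfl⟩
    rw [LinearMap.mem_ker, LinearMap.mulLeft_apply, socleMap_apply, ← mul_assoc,
      sub_mul_socleGen hab, zero_mul]
  · rw [LinearMap.finrank_range_of_inj (socleMap_injective hb), TruncPoly.finrank_eq]
    have h1 := LinearMap.finrank_range_add_finrank_ker
      (LinearMap.mulLeft k (left k a b - right k a b))
    have h2 : Module.finrank k (TruncPoly k a ⊗[k] TruncPoly k b) ≤ Module.finrank k
        (LinearMap.range (LinearMap.mulLeft k (left k a b - right k a b))) + a := by
      have h := finrank_range_mulLeft_pow_le (k := k) (c := 0) (d := a)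
        (TruncPoly.exists_aeval_tensor k (a := a) (b := b))
        (by rw [tmul_one_pow_eq_zero le_rfl, zero_mul]; exact dvd_zero _)
      rwa [pow_zero, LinearMap.mulLeft_one, LinearMap.range_id, finrank_top, zero_add,
        pow_one] at h
    omega

lemma sub_dvd_socleGen_sub :
    left k a b - right k a b ∣ socleGen k a b - b * left k a b ^ (b - 1) := by
  rw [socleGen_eq]
  have h1 : (b : TruncPoly k a ⊗[k] TruncPoly k b) * left k a b ^ (b - 1) =
      ∑ e ∈ Finset.range b, left k a b ^ (b - 1) := by
    rw [Finset.sum_const, Finset.card_range, nsmul_eq_mul]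
  rw [h1, ← Finset.sum_sub_distrib]
  refine Finset.dvd_sum fun e he => ?_
  have h2 : b - 1 = e + (b - 1 - e) := by have := Finset.mem_range.mp he; omega
  have h3 : left k a b ^ e * right k a b ^ (b - 1 - e) - left k a b ^ (b - 1) =
      -left k a b ^ e * (left k a b ^ (b - 1 - e) - right k a b ^ (b - 1 - e)) := by
    nth_rewrite 2 [h2]
    rw [pow_add (left k a b)]
    ring
  rw [h3]
  exact (sub_dvd_pow_sub_pow _ _ _).mul_left _

/-- The number of blocks of size one in `J_a ⊗ J_b` is `1` if `a = b` and `0` otherwise: the kernel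
of `x - y` is the free `k[x]/(x^a)`-module on `socleGen`, which lies in the image of `x - y` if
`a < b`, and modulo the image is `a x^(a-1)` if `a = b`. -/
lemma finrank_range_sub_sq (p : ℕ) [Fact p.Prime] [CharP k p] (ha : ¬ p ∣ a) (hab : a ≤ b) :
    Module.finrank k (TruncPoly k a ⊗[k] TruncPoly k b) +
        Module.finrank k (LinearMap.range (LinearMap.mulLeft k ((left k a b - right k a b) ^ 2))) =
      2 * Module.finrank k (LinearMap.range (LinearMap.mulLeft k (left k a b - right k a b))) +
        if a = b then 1 else 0 := by
  have ha0 : 0 < a := Nat.pos_of_ne_zero fun h => ha (h ▸ dvd_zero p)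
  have h1 := finrank_range_sq_add k (TruncPoly k a ⊗[k] TruncPoly k b) (left k a b - right k a b)
  have hker := range_socleMap (k := k) (by omega) hab
  have hdvd : ∀ w, left k a b - right k a b ∣ w →
      w ∈ LinearMap.range (LinearMap.mulLeft k (left k a b - right k a b)) := by
    rintro _ ⟨w, rfl⟩
    exact ⟨w, rfl⟩
  split_ifs with h
  · subst h
    have h2 : LinearMap.ker (LinearMap.mulLeft k (left k a a - right k a a)) ⊓
        LinearMap.range (LinearMap.mulLeft k (left k a a - right k a a)) =
          (LinearMap.range (LinearMap.mulLeft k (TruncPoly.t k a))).map (socleMap k a a) := by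
      apply le_antisymm
      · rintro _ ⟨h2, h3⟩
        rw [← hker] at h2
        obtain ⟨f, rfl⟩ := h2
        refine ⟨f, ?_, rfl⟩
        obtain ⟨g, rfl⟩ := TruncPoly.exists_aeval k a f
        obtain ⟨w, hw⟩ := h3
        obtain ⟨w', hw'⟩ := sub_dvd_socleGen_sub (k := k) (a := a) (b := a)
        -- evaluate at `x = y = t`
        have h4 := congrArg (Algebra.TensorProduct.lmul' k) hw
        have h5 := congrArg (Algebra.TensorProduct.lmul' k) hw'
        rw [LinearMap.mulLeft_apply, socleMap_apply] at h4
        simp only [map_mul, map_sub, map_pow, map_natCast, Algebra.TensorProduct.lmul'_apply_tmul,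
          one_mul, mul_one, sub_self, zero_mul, sub_eq_zero] at h4 h5
        have h6 : g.coeff 0 = 0 := by
          by_contra hg
          have h7 := congrArg (Polynomial.aeval (TruncPoly.t k a)) (Polynomial.X_mul_divX_add g)
          rw [map_add, map_mul, Polynomial.aeval_X, Polynomial.aeval_C] at h7
          rw [h5, ← h7] at h4
          have h8 : TruncPoly.t k a ^ (a - 1) * TruncPoly.t k a = 0 := by
            rw [← pow_succ, Nat.sub_add_cancel ha0, TruncPoly.t_pow]
          have h9 : ((a : k) * g.coeff 0) • TruncPoly.t k a ^ (a - 1) = 0 := by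
            rw [Algebra.smul_def, map_mul, map_natCast]
            linear_combination -h4 -
              a * Polynomial.aeval (TruncPoly.t k a) g.divX * h8
          have h10 : ((a : k) * g.coeff 0) ≠ 0 :=
            mul_ne_zero (fun h => ha ((CharP.cast_eq_zero_iff k p a).mp h)) hg
          have h11 := (smul_eq_zero_iff_right h10).mp h9
          have h12 := TruncPoly.basis_apply k a ⟨a - 1, by omega⟩
          rw [h11] at h12
          exact (TruncPoly.basis k a).ne_zero _ h12
        refine ⟨Polynomial.aeval (TruncPoly.t k a) g.divX, ?_⟩
        rw [LinearMap.mulLeft_apply]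
        nth_rewrite 2 [← Polynomial.X_mul_divX_add g]
        rw [h6, Polynomial.C_0, add_zero, map_mul, Polynomial.aeval_X]
      · rintro _ ⟨_, ⟨f, rfl⟩, rfl⟩
        refine ⟨hker ▸ LinearMap.mem_range_self _ _, hdvd _ ?_⟩
        have h3 : left k a a ^ (a - 1) * (left k a a) = 0 := by
          rw [← pow_succ]
          exact tmul_one_pow_eq_zero (by omega)
        have h4 : socleMap k a a (LinearMap.mulLeft k (TruncPoly.t k a) f) =
            (socleGen k a a - a * left k a a ^ (a - 1)) * (left k a a) *
              (f ⊗ₜ[k] (1 : TruncPoly k a)) := by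
          have h5 : (TruncPoly.t k a * f) ⊗ₜ[k] (1 : TruncPoly k a) =
              (left k a a) * (f ⊗ₜ[k] (1 : TruncPoly k a)) := by
            rw [Algebra.TensorProduct.tmul_mul_tmul, one_mul]
          rw [socleMap_apply, LinearMap.mulLeft_apply, h5]
          linear_combination a * (f ⊗ₜ[k] (1 : TruncPoly k a)) * h3
        rw [h4, mul_assoc]
        exact sub_dvd_socleGen_sub.mul_right _
    have h3 := TruncPoly.finrank_range_mulLeft_t k a 1
    rw [pow_one] at h3
    rw [h2, ← hker, LinearMap.finrank_range_of_inj (socleMap_injective ha0),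
      LinearEquiv.finrank_eq (Submodule.equivMapOfInjective _ (socleMap_injective ha0) _).symm,
      TruncPoly.finrank_eq, h3] at h1
    omega
  · have h2 : LinearMap.ker (LinearMap.mulLeft k (left k a b - right k a b)) ≤
        LinearMap.range (LinearMap.mulLeft k (left k a b - right k a b)) := by
      rw [← hker]
      rintro _ ⟨f, rfl⟩
      refine hdvd _ ?_
      have h3 := sub_dvd_socleGen_sub (k := k) (a := a) (b := b)
      rw [tmul_one_pow_eq_zero (show a ≤ b - 1 by omega), mul_zero, sub_zero] at h3
      exact h3.mul_right _
    rw [inf_eq_left.mpr h2] at h1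
    omega

end TruncPoly

end Trivial

/-! ### Bases of based rings -/

section SelfDual

open Classical in
/-- The basis `b`, with `b i₀ = 1`, makes the ring a based ring in which every basis element is its
own dual. -/
structure IsSelfDualBasis {ι A : Type*} [CommRing A] (b : Module.Basis ι ℤ A) (i₀ : ι) :
    Prop where
  one : b i₀ = 1
  nonneg : ∀ i j l, 0 ≤ b.repr (b i * b j) l
  repr_mul : ∀ i j, b.repr (b i * b j) i₀ = if i = j then 1 else 0

variable {ι ι' A A' : Type*} [CommRing A] [CommRing A']

lemma IsSelfDualBasis.isBasedRing {b : Module.Basis ι ℤ A} {i₀ : ι} (h : IsSelfDualBasis b i₀)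
    {B : Set A} (hB : Set.range b = B) : IsBasedRing B := by
  subst hB
  refine ⟨b.reindexRange, b.reindexRange_apply, ⟨i₀, h.one⟩, ?_, id, fun _ => rfl, ?_, ?_⟩
  · rintro ⟨_, i, rfl⟩ ⟨_, j, rfl⟩ ⟨_, l, rfl⟩
    rw [b.reindexRange_repr]
    exact h.nonneg i j l
  · intro x y z
    rw [id, id, id, mul_comm]
  · rintro ⟨_, i, rfl⟩ ⟨_, j, rfl⟩
    rw [b.reindexRange_repr' _ h.one, h.repr_mul]
    classical
    refine if_congr ⟨?_, fun h' => (b.injective (congrArg Subtype.val h')).symm⟩ rfl rfl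
    rintro rfl
    rfl

lemma repr_eq_repr_map {b : Module.Basis ι ℤ A} {b' : Module.Basis ι' ℤ A'} (f : A →+* A')
    (s : ι ↪ ι') (hf : ∀ i, f (b i) = b' (s i)) (x : A) (i : ι) :
    b.repr x i = b'.repr (f x) (s i) := by
  have h : b.coord i = b'.coord (s i) ∘ₗ f.toIntAlgHom.toLinearMap := by
    refine b.ext fun j => ?_
    classical
    simp [hf, Finsupp.single_apply]
  exact LinearMap.congr_fun h x

lemma bijective_of_map_basis [Module ℤ A] [Module ℤ A'] {b : Module.Basis ι ℤ A}
    {b' : Module.Basis ι' ℤ A'} (f : A →+* A') (s : ι ≃ ι') (hf : ∀ i, f (b i) = b' (s i)) :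
    Function.Bijective f := by
  let f' : A →ₗ[ℤ] A' :=
    { toFun := f
      map_add' := map_add f
      map_smul' := fun n x => map_intCast_smul f ℤ ℤ n x }
  have h : f' = (b.equiv b' s).toLinearMap :=
    b.ext fun i => (hf i).trans (b.equiv_apply i b' s).symm
  have h1 : ⇑f = b.equiv b' s := funext fun x => LinearMap.congr_fun h x
  rw [h1]
  exact LinearEquiv.bijective _

lemma basedIso_of_map_basis [Module ℤ A] [Module ℤ A'] {b : Module.Basis ι ℤ A}
    {b' : Module.Basis ι' ℤ A'} {B : Set A} {B' : Set A'} (hB : Set.range b = B)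
    (hB' : Set.range b' = B') (e : A ≃+* A') (s : ι ≃ ι')
    (hf : ∀ i, e (b i) = b' (s i)) : BasedIso B B' e := by
  rw [BasedIso, ← hB, ← hB', ← Set.range_comp, ← s.surjective.range_comp b']
  exact congrArg Set.range (funext hf)

/-- A based ring structure is inherited by a subring spanned by basis elements. -/
lemma IsSelfDualBasis.of_map {b : Module.Basis ι ℤ A} {b' : Module.Basis ι' ℤ A'} {i₀ : ι}
    (f : A →+* A') (s : ι ↪ ι') (hf : ∀ i, f (b i) = b' (s i))
    (h : IsSelfDualBasis b' (s i₀)) : IsSelfDualBasis b i₀ := by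
  have hinj : Function.Injective f := by
    intro x y hxy
    refine b.repr.injective (Finsupp.ext fun i => ?_)
    rw [repr_eq_repr_map f s hf, repr_eq_repr_map f s hf, hxy]
  refine ⟨hinj ?_, fun i j l => ?_, fun i j => ?_⟩
  · rw [hf, h.one, map_one]
  · rw [repr_eq_repr_map f s hf, map_mul, hf, hf]
    exact h.nonneg _ _ _
  · rw [repr_eq_repr_map f s hf, map_mul, hf, hf, h.repr_mul]
    classical
    exact if_congr s.injective.eq_iff rfl rfl

end SelfDual

/-! ### The non-negligible blocks form a basis -/

namespace GreenBar

section General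

variable {k : Type u} [Field k] {G : Type v} [Monoid G]

variable (k G) in
/-- The quotient map from the Green ring. -/
def mk : GreenRing (FDRep k G) →+* GreenBar k G := Ideal.Quotient.mk (negligibleIdeal k G)

lemma mk_cls (V : FDRep k G) : mk k G (GreenRing.cls V) = cls V := rfl

lemma cls_eq_of_iso {V W : FDRep k G} (e : V ≅ W) : cls V = cls W := by
  rw [← mk_cls, GreenRing.cls_eq_of_iso e, mk_cls]

lemma cls_biprod (V W : FDRep k G) : cls (V ⊞ W) = cls V + cls W := by
  rw [← mk_cls, GreenRing.cls_biprod, map_add, mk_cls, mk_cls]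

lemma cls_tensor (V W : FDRep k G) : cls (V ⊗ W) = cls V * cls W := by
  rw [← mk_cls, GreenRing.cls_tensor, map_mul, mk_cls, mk_cls]

lemma cls_unit : cls (𝟙_ (FDRep k G)) = 1 := by
  rw [← mk_cls, GreenRing.cls_unit, map_one]

lemma cls_eq_zero_of_isZero {V : FDRep k G} (h : IsZero V) : cls V = 0 := by
  rw [← mk_cls, GreenRing.cls_eq_zero_of_isZero h, map_zero]

/-- A ring homomorphism out of the Green ring which kills the negligible indecomposables. -/
def lift {R : Type*} [CommRing R] (f : GreenRing (FDRep k G) →+* R)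
    (hf : ∀ V : FDRep k G, Indecomposable V → (Module.finrank k V : k) = 0 →
      f (GreenRing.cls V) = 0) : GreenBar k G →+* R :=
  Ideal.Quotient.lift (negligibleIdeal k G) f fun a ha => by
    have hle : negligibleIdeal k G ≤ RingHom.ker f := by
      rw [negligibleIdeal, Ideal.span_le]
      rintro _ ⟨V, h1, h2, rfl⟩
      exact hf V h1 h2
    exact hle ha

lemma lift_cls {R : Type*} [CommRing R] (f : GreenRing (FDRep k G) →+* R)
    (hf : ∀ V : FDRep k G, Indecomposable V → (Module.finrank k V : k) = 0 →
      f (GreenRing.cls V) = 0) (V : FDRep k G) : lift f hf (cls V) = f (GreenRing.cls V) :=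
  Ideal.Quotient.lift_mk _ _ _

lemma induction_on {P : GreenBar k G → Prop} (x : GreenBar k G) (h0 : P 0)
    (hadd : ∀ x y, P x → P y → P (x + y)) (hcls : ∀ (n : ℤ) (V : FDRep k G), P (n • cls V)) :
    P x := by
  obtain ⟨x, rfl⟩ := Ideal.Quotient.mk_surjective x
  refine GreenRing.induction_on (P := fun x => P (mk k G x)) x ?_ (fun x y hx hy => ?_)
    (fun n V => ?_)
  · rw [map_zero]
    exact h0
  · rw [map_add]
    exact hadd _ _ hx hy
  · rw [map_zsmul]
    exact hcls n V

end General

section Cyclic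

variable (k : Type u) [Field k] (p N : ℕ) [Fact p.Prime] [CharP k p]

/-- The class of the Jordan block of size `m` modulo the negligible ideal. -/
def block (m : ℕ) : GreenBar k (CyclicGrp p N) := cls (jordan k p N m)

variable {k p N}

lemma block_eq_zero {m : ℕ} (hm : m ≤ p ^ N) (h : p ∣ m) : block k p N m = 0 := by
  rcases Nat.eq_zero_or_pos m with rfl | h0
  · exact cls_eq_zero_of_isZero
      (FDRep.isZero_of_finrank_eq_zero (finrank_jordan k p (Nat.zero_le _)))
  · exact Ideal.Quotient.eq_zero_iff_mem.mpr (Ideal.subset_span ⟨_,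
      FDRep.indecomposable_jordan h0 hm, (FDRep.finrank_jordan_eq_zero_iff hm).mpr h, rfl⟩)

/-- The class of a representation in the Grothendieck ring of the semisimplification, as a
ring homomorphism. -/
def toSemisimplification :
    GreenBar k (CyclicGrp p N) →+* GreenRing (Semisimplification k (CyclicGrp p N)) :=
  lift
    (GreenRing.lift
      (fun V => GreenRing.cls ((Semisimplification.functor k (CyclicGrp p N)).obj V))
      (fun _ _ e => GreenRing.cls_eq_of_iso ((Semisimplification.functor k _).mapIso e))
      GreenRing.cls_unit (fun V W => GreenRing.cls_tensor _ _)
      Semisimplification.cls_obj_biprod)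
    fun V hV h0 => by
      obtain ⟨m, -, hm, ⟨e⟩⟩ := FDRep.exists_iso_jordan_of_indecomposable hV
      refine (GreenRing.lift_cls _ _ _ _ _ V).trans (GreenRing.cls_eq_zero_of_isZero (IsZero.of_iso
        ((Semisimplification.isZero_obj_jordan_iff (k := k) hm).mpr ?_)
        ((Semisimplification.functor k _).mapIso e)))
      rwa [FDRep.finrank_eq_of_iso e, FDRep.finrank_jordan_eq_zero_iff hm] at h0

lemma toSemisimplification_cls (V : FDRep k (CyclicGrp p N)) : toSemisimplification (cls V) =
    GreenRing.cls ((Semisimplification.functor k (CyclicGrp p N)).obj V) := by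
  rw [toSemisimplification, lift_cls]
  exact GreenRing.lift_cls _ _ _ _ _ V

variable (p N) in
/-- The sizes of the non-negligible Jordan blocks. -/
abbrev BlockSize : Type := {m : ℕ // m ≤ p ^ N ∧ ¬ p ∣ m}

/-- Blocks are separated by the dimensions of the spaces of morphisms out of them in the
semisimplification. -/
lemma linearIndependent_obj_jordan : LinearIndependent ℤ fun m : BlockSize p N =>
    GreenRing.cls ((Semisimplification.functor k (CyclicGrp p N)).obj (jordan k p N m)) := by
  rw [linearIndependent_iff']
  intro s g hg i hi
  obtain ⟨f, hf⟩ := Semisimplification.exists_finrank_hom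
    ((Semisimplification.functor k (CyclicGrp p N)).obj (jordan k p N i))
  have h1 := congrArg f hg
  rw [map_sum, map_zero, Finset.sum_eq_single i] at h1
  · rw [map_zsmul, hf, smul_eq_mul, mul_eq_zero, Nat.cast_eq_zero] at h1
    exact h1.resolve_right (Semisimplification.finrank_hom_jordan_ne_zero i.2.1 i.2.2)
  · intro j _ hj
    rw [map_zsmul, hf, Semisimplification.finrank_hom_jordan_of_ne i.2.1 j.2.1
      fun h => hj (Subtype.ext h.symm), Nat.cast_zero, smul_zero]
  · exact fun h => absurd hi h

lemma span_obj_jordan : ⊤ ≤ Submodule.span ℤ (Set.range fun m : BlockSize p N =>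
    GreenRing.cls ((Semisimplification.functor k (CyclicGrp p N)).obj (jordan k p N m))) := by
  rintro x -
  refine GreenRing.induction_on x (zero_mem _) (fun x y => add_mem) fun n X => ?_
  refine zsmul_mem ?_ n
  obtain ⟨S, hS, -, h⟩ := X.as.exists_jordanType
  have h1 := h (fun V => GreenRing.cls ((Semisimplification.functor k (CyclicGrp p N)).obj V))
      (fun e => GreenRing.cls_eq_of_iso ((Semisimplification.functor k _).mapIso e))
      Semisimplification.cls_obj_biprod
  change GreenRing.cls ((Semisimplification.functor k (CyclicGrp p N)).obj X.as) ∈ _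
  rw [h1]
  refine multiset_sum_mem _ fun y hy => ?_
  obtain ⟨m, hm, rfl⟩ := Multiset.mem_map.mp hy
  by_cases hp : p ∣ m
  · rw [GreenRing.cls_eq_zero_of_isZero
      ((Semisimplification.isZero_obj_jordan_iff (k := k) (hS m hm).2).mpr hp)]
    exact zero_mem _
  · exact Submodule.subset_span ⟨⟨m, (hS m hm).2, hp⟩, rfl⟩

lemma linearIndependent_block :
    LinearIndependent ℤ fun m : BlockSize p N => block k p N m := by
  have h : LinearIndependent ℤ fun m : BlockSize p N =>
      toSemisimplification (block k p N m) := by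
    simp only [block, toSemisimplification_cls]
    exact linearIndependent_obj_jordan
  exact LinearIndependent.of_comp
    (toSemisimplification (k := k) (p := p) (N := N)).toAddMonoidHom.toIntLinearMap h

lemma exists_cls_eq_sum (V : FDRep k (CyclicGrp p N)) :
    ∃ S : Multiset ℕ, (∀ s ∈ S, 0 < s ∧ s ≤ p ^ N) ∧
      (∀ c, V.rk c = (S.map fun s => s - c).sum) ∧ cls V = (S.map fun s => block k p N s).sum := by
  obtain ⟨S, h1, h2, h3⟩ := V.exists_jordanType
  exact ⟨S, h1, h2, h3 cls cls_eq_of_iso cls_biprod⟩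

lemma span_block : ⊤ ≤ Submodule.span ℤ (Set.range fun m : BlockSize p N => block k p N m) := by
  rintro x -
  refine induction_on x (zero_mem _) (fun x y => add_mem) fun n V => ?_
  refine zsmul_mem ?_ n
  obtain ⟨S, hS, -, h⟩ := exists_cls_eq_sum V
  rw [h]
  refine multiset_sum_mem _ fun y hy => ?_
  obtain ⟨m, hm, rfl⟩ := Multiset.mem_map.mp hy
  by_cases hp : p ∣ m
  · rw [block_eq_zero (hS m hm).2 hp]
    exact zero_mem _
  · exact Submodule.subset_span ⟨⟨m, (hS m hm).2, hp⟩, rfl⟩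

variable (k p N) in
/-- The basis of the Green ring modulo the negligible ideal given by the non-negligible Jordan
blocks. -/
def blockBasis : Module.Basis (BlockSize p N) ℤ (GreenBar k (CyclicGrp p N)) :=
  Module.Basis.mk linearIndependent_block span_block

lemma blockBasis_apply (m : BlockSize p N) : blockBasis k p N m = block k p N m := by
  rw [blockBasis, Module.Basis.mk_apply]

lemma range_blockBasis : Set.range (blockBasis k p N) = basisSet k (CyclicGrp p N) := by
  ext x
  constructor
  · rintro ⟨⟨m, hm, h⟩, rfl⟩
    refine ⟨jordan k p N m, FDRep.indecomposable_jordan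
      (Nat.pos_of_ne_zero fun h0 => h (h0 ▸ dvd_zero p)) hm, ?_, blockBasis_apply _⟩
    rwa [Ne, FDRep.finrank_jordan_eq_zero_iff hm]
  · rintro ⟨V, hV, h0, rfl⟩
    obtain ⟨m, -, hm, ⟨e⟩⟩ := FDRep.exists_iso_jordan_of_indecomposable hV
    rw [FDRep.finrank_eq_of_iso e, Ne, FDRep.finrank_jordan_eq_zero_iff hm] at h0
    exact ⟨⟨m, hm, h0⟩, by rw [blockBasis_apply, cls_eq_of_iso e, block]⟩

variable (k p N) in
/-- The basis of the Grothendieck ring of the semisimplification given by the images of the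
non-negligible Jordan blocks. -/
def simpleBasis :
    Module.Basis (BlockSize p N) ℤ (GreenRing (Semisimplification k (CyclicGrp p N))) :=
  Module.Basis.mk linearIndependent_obj_jordan span_obj_jordan

lemma simpleBasis_apply (m : BlockSize p N) :
    simpleBasis k p N m = toSemisimplification (blockBasis k p N m) := by
  rw [simpleBasis, Module.Basis.mk_apply, blockBasis_apply, block, toSemisimplification_cls]

lemma range_simpleBasis : Set.range (simpleBasis k p N) =
    {x | ∃ L : Semisimplification k (CyclicGrp p N), Simple L ∧ x = GreenRing.cls L} := by
  ext x
  constructor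
  · rintro ⟨⟨m, hm, h⟩, rfl⟩
    exact ⟨_, Semisimplification.simple_obj_jordan (k := k) hm h, Module.Basis.mk_apply _ _ _⟩
  · rintro ⟨L, hL, rfl⟩
    obtain ⟨m, hm, h, ⟨e⟩⟩ := Semisimplification.exists_iso_jordan_of_simple_obj L.as hL
    refine ⟨⟨m, hm, h⟩, ?_⟩
    rw [simpleBasis, Module.Basis.mk_apply]
    exact (GreenRing.cls_eq_of_iso e).symm

variable (k p N) in
/-- The isomorphism between the Green ring modulo the negligible ideal and the Grothendieck ring of
the semisimplification. -/
def equivSemisimplification :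
    GreenBar k (CyclicGrp p N) ≃+* GreenRing (Semisimplification k (CyclicGrp p N)) :=
  RingEquiv.ofBijective toSemisimplification (bijective_of_map_basis (b := blockBasis k p N)
    (b' := simpleBasis k p N) _ (Equiv.refl _) fun m => (simpleBasis_apply m).symm)

lemma equivSemisimplification_apply (x : GreenBar k (CyclicGrp p N)) :
    equivSemisimplification k p N x = toSemisimplification x := rfl

lemma basedIso_equivSemisimplification :
    BasedIso (basisSet k (CyclicGrp p N))
      {x | ∃ L : Semisimplification k (CyclicGrp p N), Simple L ∧ x = GreenRing.cls L}
      (equivSemisimplification k p N) :=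
  basedIso_of_map_basis range_blockBasis range_simpleBasis _ (Equiv.refl _)
    fun m => (simpleBasis_apply m).symm

/-! ### Structure constants -/

lemma block_one : block k p N 1 = 1 := by
  have h1 := GreenRing.cls_unit (C := FDRep k (CyclicGrp p N))
  have hρ : (𝟙_ (FDRep k (CyclicGrp p N))).nilp = 0 := by
    refine LinearMap.ext fun x => ?_
    change x - x = 0
    exact sub_self _
  have h2 := cls_eq_sum_of_rk_eq (V := 𝟙_ (FDRep k (CyclicGrp p N))) (S := {1}) (by simp)
    (fun c => by
      rcases c with _ | c
      · rw [FDRep.rk_zero]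
        exact Module.finrank_self k
      · rw [FDRep.rk, hρ, zero_pow (Nat.succ_ne_zero c), LinearMap.range_zero, finrank_bot]
        simp)
  rw [h1, Multiset.map_singleton, Multiset.sum_singleton] at h2
  rw [block, ← mk_cls, ← h2, map_one]

lemma repr_sum_block {S : Multiset ℕ} (hS : ∀ s ∈ S, s ≤ p ^ N) (m : BlockSize p N) :
    (blockBasis k p N).repr (S.map fun s => block k p N s).sum m = S.count (m : ℕ) := by
  induction S using Multiset.induction_on with
  | empty => simp
  | cons s S ih =>
    have hs := hS s (Multiset.mem_cons_self s S)
    rw [Multiset.map_cons, Multiset.sum_cons, map_add, Finsupp.add_apply,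
      ih fun s hs => hS s (Multiset.mem_cons_of_mem hs), Multiset.count_cons, Nat.cast_add,
      add_comm, add_right_inj]
    by_cases hp : p ∣ s
    · have h1 : ¬ (m : ℕ) = s := fun h => m.2.2 (h ▸ hp)
      rw [block_eq_zero hs hp]
      simp [h1]
    · rw [← blockBasis_apply ⟨s, hs, hp⟩, Module.Basis.repr_self, Finsupp.single_apply]
      simp [Subtype.ext_iff, eq_comm]

lemma repr_cls_nonneg (V : FDRep k (CyclicGrp p N)) (m : BlockSize p N) :
    0 ≤ (blockBasis k p N).repr (cls V) m := by
  obtain ⟨S, hS, -, h⟩ := exists_cls_eq_sum V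
  rw [h, repr_sum_block fun s hs => (hS s hs).2]
  exact Nat.cast_nonneg _

lemma repr_cls_one (V : FDRep k (CyclicGrp p N)) (h1 : 1 ≤ p ^ N ∧ ¬ p ∣ 1) :
    (V.rk 0 + V.rk 2 : ℤ) = 2 * V.rk 1 + (blockBasis k p N).repr (cls V) ⟨1, h1⟩ := by
  obtain ⟨S, hS, hr, h⟩ := exists_cls_eq_sum V
  rw [h, repr_sum_block fun s hs => (hS s hs).2, hr, hr, hr]
  exact_mod_cast S.sum_map_sub_add 0

variable (p N) in
lemma one_le_and_not_dvd : 1 ≤ p ^ N ∧ ¬ p ∣ 1 :=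
  ⟨Nat.one_le_pow _ _ (Fact.out : p.Prime).pos, (Fact.out : p.Prime).one_lt.not_ge ∘
    Nat.le_of_dvd one_pos⟩

/-- The multiplicity of the trivial representation is the second difference of the ranks of the
powers of `x - y`. -/
lemma repr_block_mul_of_le {a b : BlockSize p N} (hab : (a : ℕ) ≤ b) :
    (blockBasis k p N).repr (block k p N a * block k p N b) ⟨1, one_le_and_not_dvd p N⟩ =
      if (a : ℕ) = b then 1 else 0 := by
  have hb0 : (b : ℕ) ≠ 0 := fun h => b.2.2 (h ▸ dvd_zero p)
  have h1 : block k p N a * block k p N b = cls (jordan k p N a ⊗ jordanInv k p N b) := by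
    rw [cls_tensor, block, block, ← mk_cls (jordanInv k p N b), cls_jordanInv hb0 b.2.1, mk_cls]
  have h2 := repr_cls_one (jordan k p N a ⊗ jordanInv k p N b) (one_le_and_not_dvd p N)
  have h3 := TruncPoly.finrank_range_sub_sq (k := k) p a.2.2 hab
  have h4 := rk_jordan_tensor k p a.2.1 b.2.1 0
  have h5 := rk_jordan_tensor k p a.2.1 b.2.1 1
  have h6 := rk_jordan_tensor k p a.2.1 b.2.1 2
  rw [pow_zero, LinearMap.mulLeft_one, LinearMap.range_id, finrank_top] at h4
  rw [pow_one] at h5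
  rw [← h4, ← h5, ← h6] at h3
  rw [h1]
  have h7 : ((jordan k p N a ⊗ jordanInv k p N b).rk 0 +
    (jordan k p N a ⊗ jordanInv k p N b).rk 2 : ℤ) =
      2 * (jordan k p N a ⊗ jordanInv k p N b).rk 1 + (if (a : ℕ) = b then 1 else 0 : ℕ) := by
    exact_mod_cast h3
  rw [h7, add_right_inj] at h2
  rw [← h2]
  split_ifs <;> rfl

variable (k p N) in
/-- The non-negligible blocks form a basis of a based ring. The involution is the identity, since
blocks are isomorphic to their duals. -/
lemma isSelfDualBasis :
    IsSelfDualBasis (blockBasis k p N) ⟨1, one_le_and_not_dvd p N⟩ where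
  one := by rw [blockBasis_apply, block_one]
  nonneg i j l := by
    rw [blockBasis_apply, blockBasis_apply, block, block, ← cls_tensor]
    exact repr_cls_nonneg _ _
  repr_mul i j := by
    rw [blockBasis_apply, blockBasis_apply]
    rcases le_total (i : ℕ) j with h | h
    · rw [repr_block_mul_of_le h]
      simp [Subtype.ext_iff]
    · rw [mul_comm, repr_block_mul_of_le h]
      simp [Subtype.ext_iff, eq_comm]

end Cyclic

end GreenBar

/-! ### Homomorphisms out of `K_p` -/

namespace KRing

variable {p : ℕ}

variable (p) in
/-- The quotient map from the polynomial ring. -/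
def mk : Polynomial ℤ →+* KRing p := Ideal.Quotient.mk (Ideal.span _)

lemma mk_kPoly (i : ℕ) : mk p (kPoly i) = gen p i := rfl

lemma mk_X : mk p Polynomial.X = gen p 1 := by
  rw [← mk_kPoly, kPoly]

lemma gen_zero : gen p 0 = 1 := by
  rw [← mk_kPoly, kPoly, map_one]

lemma gen_one_mul (i : ℕ) :
    gen p 1 * gen p (i + 1) = gen p i + gen p (i + 1) + gen p (i + 2) := by
  rw [← mk_X, ← mk_kPoly, ← mk_kPoly, ← mk_kPoly, ← map_mul, ← map_add, ← map_add]
  congr 1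
  rw [show kPoly (i + 2) = Polynomial.X * kPoly (i + 1) - kPoly (i + 1) - kPoly i by rw [kPoly]]
  ring

lemma gen_one_mul_last : gen p 1 * gen p (p - 1) = gen p (p - 2) := by
  rw [← mk_X, ← mk_kPoly, ← mk_kPoly, ← map_mul]
  exact Ideal.Quotient.eq.mpr (Ideal.mem_span_singleton_self _)

/-- A sequence which satisfies the relations between the `X_i` defines a homomorphism from `K_p`. -/
lemma exists_lift {R : Type*} [CommRing R] (hp : 2 ≤ p) (Y : ℕ → R) (h0 : Y 0 = 1)
    (h1 : ∀ i, i + 2 < p → Y 1 * Y (i + 1) = Y i + Y (i + 1) + Y (i + 2))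
    (h2 : Y 1 * Y (p - 1) = Y (p - 2)) :
    ∃ f : KRing p →+* R, ∀ i < p, f (gen p i) = Y i := by
  have h3 : ∀ i < p, Polynomial.aeval (Y 1) (kPoly i) = Y i := by
    intro i
    induction i using Nat.strong_induction_on with
    | _ i ih =>
    intro hi
    match i with
    | 0 => rw [kPoly, map_one, h0]
    | 1 => rw [kPoly, Polynomial.aeval_X]
    | i + 2 =>
      rw [kPoly, map_sub, map_sub, map_mul, Polynomial.aeval_X, ih (i + 1) (by omega) (by omega),
        ih i (by omega) (by omega), h1 i hi]
      ring
  have hle : ∀ a ∈ Ideal.span {(Polynomial.X : Polynomial ℤ) * kPoly (p - 1) - kPoly (p - 2)},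
      (Polynomial.aeval (Y 1) : Polynomial ℤ →ₐ[ℤ] R).toRingHom a = 0 := by
    intro a ha
    obtain ⟨c, rfl⟩ := Ideal.mem_span_singleton.mp ha
    simp [h3 (p - 1) (by omega), h3 (p - 2) (by omega), h2]
  exact ⟨Ideal.Quotient.lift _ _ hle, fun i hi => (Ideal.Quotient.lift_mk _ _ _).trans (h3 i hi)⟩

lemma gen_one_mul_mem (hp : 2 ≤ p) {x : KRing p}
    (hx : x ∈ Submodule.span ℤ (Set.range fun i : Fin p => gen p i)) :
    x * gen p 1 ∈ Submodule.span ℤ (Set.range fun i : Fin p => gen p i) := by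
  have hmem : ∀ i < p, gen p i ∈ Submodule.span ℤ (Set.range fun i : Fin p => gen p i) :=
    fun i hi => Submodule.subset_span ⟨⟨i, hi⟩, rfl⟩
  induction hx using Submodule.span_induction with
  | zero => rw [zero_mul]; exact zero_mem _
  | add x y _ _ hx hy => rw [add_mul]; exact add_mem hx hy
  | smul n x _ hx => rw [smul_mul_assoc]; exact Submodule.smul_mem _ _ hx
  | mem x hx =>
    obtain ⟨⟨i, hi⟩, rfl⟩ := hx
    rw [mul_comm]
    change gen p 1 * gen p i ∈ _
    rcases i with _ | i
    · rw [gen_zero, mul_one]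
      exact hmem 1 (by omega)
    · by_cases h : i + 2 < p
      · rw [gen_one_mul]
        exact add_mem (add_mem (hmem _ (by omega)) (hmem _ hi)) (hmem _ h)
      · have h1 := gen_one_mul_last (p := p)
        rw [show p - 1 = i + 1 by omega] at h1
        rw [h1]
        exact hmem _ (by omega)

lemma span_gen (hp : 2 ≤ p) : ⊤ ≤ Submodule.span ℤ (Set.range fun i : Fin p => gen p i) := by
  rintro x -
  obtain ⟨f, rfl⟩ : ∃ f, mk p f = x := Ideal.Quotient.mk_surjective x
  induction f using Polynomial.induction_on with
  | C a =>
    rw [eq_intCast Polynomial.C a, map_intCast, ← zsmul_one, ← gen_zero]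
    have h0 : gen p 0 ∈ Submodule.span ℤ (Set.range fun i : Fin p => gen p i) :=
      Submodule.subset_span ⟨⟨0, by omega⟩, rfl⟩
    exact zsmul_mem h0 a
  | add f g hf hg => rw [map_add]; exact add_mem hf hg
  | monomial n a h =>
    rw [pow_succ, ← mul_assoc, map_mul, mk_X]
    exact gen_one_mul_mem hp h

end KRing

/-! ### Inflation and the image of `K_p` -/

lemma range_basis_tensorProduct {ι ι' A A' : Type*} [CommRing A] [CommRing A']
    (b : Module.Basis ι ℤ A) (b' : Module.Basis ι' ℤ A') :
    Set.range (b.tensorProduct b') = tensorBasisSet (Set.range b) (Set.range b') := by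
  ext x
  constructor
  · rintro ⟨⟨i, j⟩, rfl⟩
    exact ⟨_, ⟨i, rfl⟩, _, ⟨j, rfl⟩, b.tensorProduct_apply b' i j⟩
  · rintro ⟨_, ⟨i, rfl⟩, _, ⟨j, rfl⟩, rfl⟩
    exact ⟨(i, j), b.tensorProduct_apply b' i j⟩

namespace GreenBar

section Inflation

variable {k : Type u} [Field k] {p n : ℕ}

lemma rk_inflate (V : FDRep k (CyclicGrp p n)) (c : ℕ) : (inflate p V).rk c = V.rk c := by
  have h1 : cyclicProj p n (Multiplicative.ofAdd 1) = Multiplicative.ofAdd 1 :=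
    congrArg Multiplicative.ofAdd (map_one (ZMod.castHom (pow_dvd_pow p n.le_succ) (ZMod (p ^ n))))
  have h2 : (inflate p V).nilp = V.nilp := by
    change V.ρ (cyclicProj p n (Multiplicative.ofAdd 1)) - 1 = V.ρ (Multiplicative.ofAdd 1) - 1
    rw [h1]
  exact congrArg (fun f : Module.End k V => Module.finrank k (LinearMap.range (f ^ c))) h2

variable [Fact p.Prime] [CharP k p]

lemma cls_inflate_jordan {m : ℕ} (hm : m ≤ p ^ n) :
    cls (inflate p (jordan k p n m)) = block k p (n + 1) m := by
  have hm' : m ≤ p ^ (n + 1) := hm.trans (Nat.pow_le_pow_right (Fact.out : p.Prime).pos n.le_succ)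
  rcases Nat.eq_zero_or_pos m with rfl | h0
  · rw [block_eq_zero hm' (dvd_zero p)]
    refine cls_eq_zero_of_isZero (FDRep.isZero_of_finrank_eq_zero ?_)
    rw [← FDRep.rk_zero, rk_inflate, rk_jordan k p hm]
  · have h := cls_eq_sum_of_rk_eq (V := inflate p (jordan k p n m)) (S := {m})
      (by simpa using h0.ne)
      (fun c => by
        rw [rk_inflate, rk_jordan k p hm, Multiset.map_singleton, Multiset.sum_singleton])
    rw [← mk_cls, h, Multiset.map_singleton, Multiset.sum_singleton, mk_cls, block]

variable (k p n) in
/-- Inflation as a ring homomorphism. -/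
def inflateHom : GreenBar k (CyclicGrp p n) →+* GreenBar k (CyclicGrp p (n + 1)) :=
  lift
    (GreenRing.lift (fun V => cls (inflate p V))
      (fun _ _ e => cls_eq_of_iso ((Action.res (FGModuleCat k) (cyclicProj p n)).mapIso e))
      ((cls_eq_of_iso (Iso.refl _)).trans cls_unit)
      (fun V W => (cls_eq_of_iso (Iso.refl _)).trans (cls_tensor (inflate p V) (inflate p W)))
      (fun V W => (cls_eq_of_iso
        ((Action.res (FGModuleCat k) (cyclicProj p n)).additiveMapBiprod V W)).trans
          (cls_biprod (inflate p V) (inflate p W))))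
    fun V hV h0 => by
      obtain ⟨m, -, hm, ⟨e⟩⟩ := FDRep.exists_iso_jordan_of_indecomposable hV
      rw [FDRep.finrank_eq_of_iso e, FDRep.finrank_jordan_eq_zero_iff hm] at h0
      refine (GreenRing.lift_cls _ _ _ _ _ V).trans ?_
      refine (cls_eq_of_iso ((Action.res (FGModuleCat k) (cyclicProj p n)).mapIso e)).trans ?_
      exact (cls_inflate_jordan hm).trans (block_eq_zero
        (hm.trans (Nat.pow_le_pow_right (Fact.out : p.Prime).pos n.le_succ)) h0)

lemma inflateHom_cls (V : FDRep k (CyclicGrp p n)) :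
    inflateHom k p n (cls V) = cls (inflate p V) := by
  rw [inflateHom, lift_cls]
  exact GreenRing.lift_cls _ _ _ _ _ V

end Inflation

section Fold

variable (p n : ℕ)

/-- The size of the non-negligible block in the product of the block of size `a`, where `a < p^n`
and `p ∤ a`, with the image of `X_i`. -/
def foldSize (i a : ℕ) : ℕ := i * p ^ n + if Even i then a else p ^ n - a

lemma foldSize_one (i : ℕ) (hq : 1 ≤ p ^ n) :
    foldSize p n i 1 = if Even i then i * p ^ n + 1 else (i + 1) * p ^ n - 1 := by
  rw [foldSize, add_mul, one_mul]
  split_ifs <;> omega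

variable {p n}

lemma lt_pow_of_blockSize (hn : 1 ≤ n) (a : BlockSize p n) : (a : ℕ) < p ^ n :=
  lt_of_le_of_ne a.2.1 fun h => a.2.2 (by rw [h]; exact dvd_pow_self p (by omega))

lemma foldSize_mem (hn : 1 ≤ n) (i : Fin p) (a : BlockSize p n) :
    foldSize p n i a ≤ p ^ (n + 1) ∧ ¬ p ∣ foldSize p n i a := by
  have h1 := lt_pow_of_blockSize hn a
  have h2 : ((i : ℕ) + 1) * p ^ n ≤ p ^ (n + 1) := by
    rw [pow_succ']
    exact Nat.mul_le_mul_right _ i.2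
  have h3 : p ∣ p ^ n := dvd_pow_self p (by omega)
  rw [add_mul, one_mul] at h2
  rw [foldSize]
  refine ⟨by split_ifs <;> omega, ?_⟩
  rw [Nat.dvd_add_right (h3.mul_left _)]
  split_ifs
  · exact a.2.2
  · rw [Nat.dvd_sub_iff_right h1.le h3]
    exact a.2.2

/-- The non-negligible block sizes at level `n + 1` are uniquely of the form `foldSize p n i a`. -/
lemma foldSize_bijective (hn : 1 ≤ n) : Function.Bijective fun x : BlockSize p n × Fin p =>
    (⟨foldSize p n x.2 x.1, foldSize_mem hn x.2 x.1⟩ : BlockSize p (n + 1)) := by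
  constructor
  · rintro ⟨a, i⟩ ⟨b, j⟩ h
    have ha := lt_pow_of_blockSize hn a
    have hb := lt_pow_of_blockSize hn b
    have ha0 : (a : ℕ) ≠ 0 := fun h => a.2.2 (h ▸ dvd_zero p)
    have hb0 : (b : ℕ) ≠ 0 := fun h => b.2.2 (h ▸ dvd_zero p)
    have h1 : foldSize p n i a = foldSize p n j b := congrArg Subtype.val h
    -- the index `i` is the quotient by `p^n`
    have key : ∀ i c : ℕ, c ≠ 0 → c < p ^ n → foldSize p n i c / p ^ n = i := by
      intro i c h0 hc
      rw [foldSize, mul_comm, Nat.mul_add_div (by omega), Nat.div_eq_of_lt, add_zero]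
      split_ifs <;> omega
    have h2 : i = j := Fin.ext (by rw [← key i a ha0 ha, h1, key j b hb0 hb])
    subst h2
    rw [foldSize, foldSize, add_right_inj] at h1
    have h3 : a = b := Subtype.ext (by split_ifs at h1 <;> omega)
    rw [h3]
  · rintro ⟨m, hm, hp⟩
    have hp0 : 0 < p := Nat.pos_of_ne_zero fun h => by
      subst h
      rw [zero_pow (by omega), Nat.le_zero] at hm
      exact hp (hm ▸ dvd_rfl)
    have hq : 0 < p ^ n := pow_pos hp0 n
    have h1 : p ∣ p ^ n := dvd_pow_self p (by omega)
    have h2 := Nat.div_add_mod m (p ^ n)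
    have h3 : ¬ p ∣ m % p ^ n := by rwa [Nat.dvd_mod_iff h1]
    have h4 := Nat.mod_lt m hq
    have h5 : m / p ^ n < p := by
      rw [Nat.div_lt_iff_lt_mul hq, ← pow_succ']
      exact lt_of_le_of_ne hm fun h => hp (h ▸ dvd_pow_self p (by omega))
    by_cases he : Even (m / p ^ n)
    · refine ⟨⟨⟨m % p ^ n, h4.le, h3⟩, ⟨m / p ^ n, h5⟩⟩, Subtype.ext ?_⟩
      change foldSize p n (m / p ^ n) (m % p ^ n) = m
      rw [foldSize, if_pos he, mul_comm, h2]
    · refine ⟨⟨⟨p ^ n - m % p ^ n, Nat.sub_le _ _, ?_⟩, ⟨m / p ^ n, h5⟩⟩, Subtype.ext ?_⟩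
      · rwa [Nat.dvd_sub_iff_right h4.le h1]
      · change foldSize p n (m / p ^ n) (p ^ n - m % p ^ n) = m
        rw [foldSize, if_neg he, Nat.sub_sub_self h4.le, mul_comm, h2]

end Fold

section Relations

variable {k : Type u} [Field k] {p n : ℕ} [Fact p.Prime] [CharP k p]

lemma mk_jordanCls {N : ℕ} (m : ℕ) : mk k _ (jordanCls k p N m) = block k p N m := rfl

lemma block_mul_eq {N a b : ℕ} {x : GreenRing (FDRep k (CyclicGrp p N))}
    (h : jordanCls k p N a * jordanCls k p N b = x) :
    block k p N a * block k p N b = mk k _ x := by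
  rw [← h, map_mul, mk_cls, mk_cls, block, block]

lemma block_mul_even (hn : 1 ≤ n) {a i : ℕ} (ha : 1 ≤ a) (haq : a ≤ p ^ n) (hi : i < p) :
    block k p (n + 1) a * block k p (n + 1) (i * p ^ n + 1) =
      block k p (n + 1) (i * p ^ n + a) := by
  rcases i with _ | i
  · rw [zero_mul, zero_add, zero_add, block_one, mul_one]
  · have h1 : (i + 2) * p ^ n ≤ p ^ (n + 1) := by
      rw [pow_succ']
      exact Nat.mul_le_mul_right _ hi
    have h2 : block k p (n + 1) ((i + 1) * p ^ n) = 0 :=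
      block_eq_zero ((Nat.mul_le_mul_right _ (by omega)).trans h1)
        ((dvd_pow_self p (by omega)).mul_left _)
    rw [block_mul_eq (cls_jordan_mul_even ha haq h1), map_add, map_nsmul, mk_jordanCls,
      mk_jordanCls, h2, smul_zero, add_zero]

lemma block_mul_odd (hn : 1 ≤ n) {a j : ℕ} (ha : 1 ≤ a) (haq : a < p ^ n) (hj : j < p) :
    block k p (n + 1) a * block k p (n + 1) ((j + 1) * p ^ n - 1) =
      block k p (n + 1) ((j + 1) * p ^ n - a) := by
  have h1 : (j + 1) * p ^ n ≤ p ^ (n + 1) := by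
    rw [pow_succ']
    exact Nat.mul_le_mul_right _ hj
  have h2 : block k p (n + 1) ((j + 1) * p ^ n) = 0 :=
    block_eq_zero h1 ((dvd_pow_self p (by omega)).mul_left _)
  rw [block_mul_eq (cls_jordan_mul_odd ha haq h1), map_add, map_nsmul, mk_jordanCls,
    mk_jordanCls, h2, smul_zero, add_zero]

lemma block_mul_foldSize (hn : 1 ≤ n) {a i : ℕ} (ha : 1 ≤ a) (haq : a < p ^ n) (hi : i < p) :
    block k p (n + 1) a * block k p (n + 1) (foldSize p n i 1) =
      block k p (n + 1) (foldSize p n i a) := by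
  by_cases he : Even i
  · rw [foldSize, foldSize, if_pos he, if_pos he, block_mul_even hn ha haq.le hi]
  · have h := block_mul_odd (k := k) hn ha haq hi
    rw [add_mul, one_mul] at h
    rw [foldSize, foldSize, if_neg he, if_neg he, ← Nat.add_sub_assoc (by omega), h,
      Nat.add_sub_assoc haq.le]

lemma two_le_pow (hn : 1 ≤ n) : 2 ≤ p ^ n :=
  (Fact.out : p.Prime).two_le.trans (Nat.le_self_pow (by omega) p)

/-- The block of size `p^n - 1` is invertible of order two. -/
lemma block_sq (hn : 1 ≤ n) : block k p (n + 1) (p ^ n - 1) ^ 2 = 1 := by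
  have hq := two_le_pow (p := p) hn
  have h := block_mul_odd (k := k) (j := 0) hn (a := p ^ n - 1) (by omega) (by omega)
    (Fact.out : p.Prime).pos
  rw [zero_add, one_mul, Nat.sub_sub_self (by omega), block_one] at h
  rw [pow_two, h]

/-- The image of `X_i` is a twist of the block of size `i p^n + 1` by the invertible block of size
`p^n - 1`. -/
lemma block_foldSize_one (hn : 1 ≤ n) {i : ℕ} (hi : i < p) :
    block k p (n + 1) (foldSize p n i 1) =
      block k p (n + 1) (p ^ n - 1) ^ i * block k p (n + 1) (i * p ^ n + 1) := by
  have hq := two_le_pow (p := p) hn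
  rw [foldSize]
  split_ifs with he
  · obtain ⟨j, hj⟩ := he.two_dvd
    have h : block k p (n + 1) (p ^ n - 1) ^ i = 1 := by rw [hj, pow_mul, block_sq hn, one_pow]
    rw [h, one_mul]
  · obtain ⟨j, hj⟩ := Nat.not_even_iff_odd.mp he
    have h : block k p (n + 1) (p ^ n - 1) ^ i = block k p (n + 1) (p ^ n - 1) := by
      rw [hj, pow_succ (block k p (n + 1) (p ^ n - 1)), pow_mul, block_sq hn, one_pow, one_mul]
    rw [h, block_mul_even hn (by omega) (by omega) hi]

lemma block_generator_mul (hn : 1 ≤ n) {i : ℕ} (hi : i + 2 < p) :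
    block k p (n + 1) (p ^ n + 1) * block k p (n + 1) ((i + 1) * p ^ n + 1) =
      block k p (n + 1) ((i + 2) * p ^ n + 1) + block k p (n + 1) (i * p ^ n + 1) +
        block k p (n + 1) (p ^ n - 1) * block k p (n + 1) ((i + 1) * p ^ n + 1) := by
  have hq := two_le_pow (p := p) hn
  have h1 : (i + 1) * p ^ n ≤ p ^ (n + 1) := by
    rw [pow_succ']
    exact Nat.mul_le_mul_right _ (by omega)
  have h2 : block k p (n + 1) ((i + 1) * p ^ n) = 0 :=
    block_eq_zero h1 ((dvd_pow_self p (by omega)).mul_left _)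
  have h3 : (i + 2) * p ^ n - 1 = (i + 1) * p ^ n + (p ^ n - 1) := by
    rw [← Nat.add_sub_assoc (by omega)]
    congr 1
    ring
  rw [block_mul_eq (cls_jordan_mul_generator hq rfl hi), block_mul_even hn (by omega) (by omega)
    (by omega), map_add, map_add, map_add, map_nsmul, h3]
  simp only [mk_jordanCls, h2, smul_zero, add_zero]

lemma block_generator_mul_last (hn : 1 ≤ n) {i : ℕ} (hi : i + 2 = p) :
    block k p (n + 1) (p ^ n + 1) * block k p (n + 1) ((i + 1) * p ^ n + 1) =
      block k p (n + 1) (i * p ^ n + 1) := by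
  have hq := two_le_pow (p := p) hn
  have h0 : ∀ j ≤ p, block k p (n + 1) (j * p ^ n) = 0 := fun j hj =>
    block_eq_zero (by rw [pow_succ']; exact Nat.mul_le_mul_right _ hj)
      ((dvd_pow_self p (by omega)).mul_left _)
  rw [block_mul_eq (cls_jordan_mul_generator_last hq rfl hi), map_add, map_add, map_nsmul,
    map_nsmul]
  simp only [mk_jordanCls, h0 _ hi.le, h0 (i + 1) (by omega), smul_zero, add_zero]

variable (k p n) in
/-- The relations of `K_p` hold for the blocks of sizes `foldSize p n i 1`: they are the products of
`block_generator_mul` and `block_generator_mul_last` with powers of the block of size `p^n - 1`. -/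
lemma exists_kHom (hn : 1 ≤ n) : ∃ f : KRing p →+* GreenBar k (CyclicGrp p (n + 1)),
    ∀ i < p, f (KRing.gen p i) = block k p (n + 1) (foldSize p n i 1) := by
  have hp := (Fact.out : p.Prime).two_le
  have h1 : block k p (n + 1) (foldSize p n 1 1) =
      block k p (n + 1) (p ^ n - 1) * block k p (n + 1) (p ^ n + 1) := by
    rw [block_foldSize_one hn (by omega), pow_one, one_mul]
  have hω := block_sq (k := k) (p := p) hn
  refine KRing.exists_lift hp _ ?_ (fun i hi => ?_) ?_
  · rw [foldSize, if_pos Even.zero, zero_mul, zero_add, block_one]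
  · have h2 := block_generator_mul (k := k) hn hi
    rw [h1, block_foldSize_one hn (by omega), block_foldSize_one hn (by omega),
      block_foldSize_one hn (by omega)]
    set ω := block k p (n + 1) (p ^ n - 1)
    linear_combination ω ^ (i + 2) * h2 +
      (ω ^ i * block k p (n + 1) (i * p ^ n + 1) +
        ω ^ (i + 1) * block k p (n + 1) ((i + 1) * p ^ n + 1)) * hω
  · obtain ⟨i, hi⟩ := Nat.exists_eq_add_of_le' hp
    have h2 := block_generator_mul_last (k := k) hn hi.symm
    rw [h1, show p - 1 = i + 1 by omega, show p - 2 = i by omega,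
      block_foldSize_one hn (by omega), block_foldSize_one hn (by omega)]
    set ω := block k p (n + 1) (p ^ n - 1)
    linear_combination ω ^ (i + 2) * h2 + ω ^ i * block k p (n + 1) (i * p ^ n + 1) * hω

end Relations

end GreenBar

/-! ### The basis of `K_p` and the decomposition of the Green ring -/

namespace GreenBar

section KBasis

variable {p n : ℕ} [Fact p.Prime]

/-- The block sizes which correspond to the elements `X_i`. -/
def kSize (hn : 1 ≤ n) : Fin p ↪ BlockSize p (n + 1) where
  toFun i := ⟨foldSize p n i 1, foldSize_mem hn i ⟨1, one_le_and_not_dvd p n⟩⟩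
  inj' i j h := congrArg Prod.snd
    (@(foldSize_bijective hn).1 (⟨1, one_le_and_not_dvd p n⟩, i) (⟨1, one_le_and_not_dvd p n⟩, j) h)

variable (p) in
/-- The elements `X_0, …, X_{p-1}` are linearly independent, since their images in the Green ring of
`ℤ/p^2` are the classes of distinct blocks. -/
lemma linearIndependent_gen : LinearIndependent ℤ fun i : Fin p => KRing.gen p i := by
  obtain ⟨f, hf⟩ := exists_kHom (ZMod p) p 1 le_rfl
  have h : LinearIndependent ℤ fun i : Fin p => f (KRing.gen p i) := by
    have h1 : (fun i : Fin p => f (KRing.gen p i)) =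
        (fun m : BlockSize p 2 => block (ZMod p) p 2 m) ∘ kSize le_rfl :=
      funext fun i => hf i i.2
    rw [h1]
    exact linearIndependent_block.comp _ (kSize le_rfl).injective
  exact LinearIndependent.of_comp f.toAddMonoidHom.toIntLinearMap h

variable (p) in
/-- The basis `X_0, …, X_{p-1}` of `K_p`. -/
def kBasis : Module.Basis (Fin p) ℤ (KRing p) :=
  Module.Basis.mk (linearIndependent_gen p) (KRing.span_gen (Fact.out : p.Prime).two_le)

lemma kBasis_apply (i : Fin p) : kBasis p i = KRing.gen p i := by
  rw [kBasis, Module.Basis.mk_apply]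

lemma range_kBasis : Set.range (kBasis p) = KRing.basisSet p :=
  congrArg Set.range (funext kBasis_apply)

variable (p) in
lemma isBasedRing_kRing : IsBasedRing (KRing.basisSet p) := by
  obtain ⟨f, hf⟩ := exists_kHom (ZMod p) p 1 le_rfl
  refine IsSelfDualBasis.isBasedRing (b := kBasis p) (i₀ := ⟨0, (Fact.out : p.Prime).pos⟩) ?_
    range_kBasis
  refine IsSelfDualBasis.of_map (b' := blockBasis (ZMod p) p 2) f (kSize le_rfl) (fun i => ?_) ?_
  · rw [kBasis_apply, hf i i.2, blockBasis_apply]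
    rfl
  · have h : kSize le_rfl ⟨0, (Fact.out : p.Prime).pos⟩ =
        (⟨1, one_le_and_not_dvd p 2⟩ : BlockSize p 2) := by
      refine Subtype.ext ?_
      change foldSize p 1 0 1 = 1
      rw [foldSize, if_pos Even.zero, zero_mul]
    rw [h]
    exact isSelfDualBasis (ZMod p) p 2

end KBasis

section Tensor

variable (k : Type u) [Field k] (p : ℕ) {n : ℕ} [Fact p.Prime] [CharP k p]

/-- The homomorphism `K_p → Ḡ_{n+1}` which sends `X_i` to the class of an indecomposable
representation of dimension `i p^n + 1` or `(i + 1) p^n - 1`. -/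
def kHom (hn : 1 ≤ n) : KRing p →+* GreenBar k (CyclicGrp p (n + 1)) :=
  (exists_kHom k p n hn).choose

/-- The homomorphism `Ḡ_n ⊗ K_p → Ḡ_{n+1}`. -/
def tensorHom (hn : 1 ≤ n) :
    GreenBar k (CyclicGrp p n) ⊗[ℤ] KRing p →+* GreenBar k (CyclicGrp p (n + 1)) :=
  (Algebra.TensorProduct.productMap (inflateHom k p n).toIntAlgHom
    (kHom k p hn).toIntAlgHom).toRingHom

variable {k p}

lemma kHom_gen (hn : 1 ≤ n) {i : ℕ} (hi : i < p) :
    kHom k p hn (KRing.gen p i) = block k p (n + 1) (foldSize p n i 1) :=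
  (exists_kHom k p n hn).choose_spec i hi

lemma tensorHom_tmul (hn : 1 ≤ n) (x : GreenBar k (CyclicGrp p n)) (y : KRing p) :
    tensorHom k p hn (x ⊗ₜ y) = inflateHom k p n x * kHom k p hn y :=
  Algebra.TensorProduct.productMap_apply_tmul _ _ x y

lemma tensorHom_basis (hn : 1 ≤ n) (x : BlockSize p n × Fin p) :
    tensorHom k p hn ((blockBasis k p n).tensorProduct (kBasis p) x) =
      blockBasis k p (n + 1) (Equiv.ofBijective _ (foldSize_bijective hn) x) := by
  obtain ⟨a, i⟩ := x
  rw [Module.Basis.tensorProduct_apply, tensorHom_tmul, blockBasis_apply, blockBasis_apply,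
    kBasis_apply, kHom_gen hn i.2, block, inflateHom_cls, cls_inflate_jordan a.2.1]
  exact block_mul_foldSize hn (Nat.pos_of_ne_zero fun h => a.2.2 (h ▸ dvd_zero p))
    (lt_pow_of_blockSize hn a) i.2

variable (k p) in
/-- The isomorphism `Ḡ_n ⊗ K_p ≅ Ḡ_{n+1}`. -/
def tensorEquiv (hn : 1 ≤ n) :
    GreenBar k (CyclicGrp p n) ⊗[ℤ] KRing p ≃+* GreenBar k (CyclicGrp p (n + 1)) :=
  RingEquiv.ofBijective (tensorHom k p hn)
    (bijective_of_map_basis (b := (blockBasis k p n).tensorProduct (kBasis p)) _ _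
      (tensorHom_basis hn))

lemma tensorEquiv_apply (hn : 1 ≤ n) (x : GreenBar k (CyclicGrp p n) ⊗[ℤ] KRing p) :
    tensorEquiv k p hn x = tensorHom k p hn x := rfl

lemma basedIso_tensorEquiv (hn : 1 ≤ n) :
    BasedIso (tensorBasisSet (basisSet k (CyclicGrp p n)) (KRing.basisSet p))
      (basisSet k (CyclicGrp p (n + 1))) (tensorEquiv k p hn) := by
  refine basedIso_of_map_basis (b := (blockBasis k p n).tensorProduct (kBasis p))
    ?_ range_blockBasis _ _ (tensorHom_basis hn)
  exact (range_basis_tensorProduct _ _).trans (by rw [range_blockBasis, range_kBasis])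

end Tensor

end GreenBar

/-! ### Tensor powers of `K_p` -/

namespace KPower

variable {p : ℕ}

/-- The map `(x_1, …, x_m) ↦ 1 ⊗ x_1 ⊗ … ⊗ x_m`. -/
def oneTprod (p m : ℕ) : MultilinearMap ℤ (fun _ : Fin m => KRing p) (KPower p (m + 1)) :=
  (PiTensorProduct.tprod ℤ (s := fun _ : Fin (m + 1) => KRing p)).curryLeft 1

lemma oneTprod_apply {m : ℕ} (x : Fin m → KRing p) : oneTprod p m x =
    PiTensorProduct.tprod ℤ (Fin.cons (1 : KRing p) x : Fin (m + 1) → KRing p) := rfl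

/-- The homomorphism `x ↦ 1 ⊗ x` from the `m`-th to the `(m + 1)`-st tensor power. -/
def tail (p m : ℕ) : KPower p m →ₐ[ℤ] KPower p (m + 1) :=
  PiTensorProduct.liftAlgHom (oneTprod p m)
    (congrArg (PiTensorProduct.tprod ℤ) (Fin.cons_self_tail (1 : Fin (m + 1) → KRing p)))
    fun x y => by
      rw [oneTprod_apply, oneTprod_apply, oneTprod_apply, PiTensorProduct.tprod_mul_tprod]
      congr 1
      funext i
      refine Fin.cases ?_ (fun i => ?_) i <;> simp

lemma tail_tprod {m : ℕ} (x : Fin m → KRing p) :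
    tail p m (PiTensorProduct.tprod ℤ x) =
      PiTensorProduct.tprod ℤ (Fin.cons (1 : KRing p) x : Fin (m + 1) → KRing p) :=
  PiTensorProduct.lift.tprod (φ := oneTprod p m) x

/-- The multiplication homomorphism `K_p^{⊗ m} ⊗ K_p → K_p^{⊗ (m + 1)}`. -/
def consHom (p m : ℕ) : KPower p m ⊗[ℤ] KRing p →+* KPower p (m + 1) :=
  (Algebra.TensorProduct.productMap (tail p m)
    (PiTensorProduct.singleAlgHom (R := ℤ) (A := fun _ : Fin (m + 1) => KRing p) 0)).toRingHom

lemma consHom_tprod_tmul {m : ℕ} (x : Fin m → KRing p) (y : KRing p) :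
    consHom p m (PiTensorProduct.tprod ℤ x ⊗ₜ y) =
      PiTensorProduct.tprod ℤ (Fin.cons y x : Fin (m + 1) → KRing p) := by
  refine (Algebra.TensorProduct.productMap_apply_tmul _ _ _ _).trans ?_
  rw [tail_tprod, PiTensorProduct.singleAlgHom_apply, PiTensorProduct.tprod_mul_tprod]
  congr 1
  funext i
  refine Fin.cases ?_ (fun i => ?_) i <;> simp

variable [Fact p.Prime]

variable (p) in
/-- The basis of `K_p^{⊗ m}` given by the tensors of basis elements. -/
def basis (m : ℕ) : Module.Basis (Fin m → Fin p) ℤ (KPower p m) :=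
  Basis.piTensorProduct fun _ => GreenBar.kBasis p

lemma basis_apply {m : ℕ} (f : Fin m → Fin p) :
    basis p m f = PiTensorProduct.tprod ℤ fun j => GreenBar.kBasis p (f j) :=
  Basis.piTensorProduct_apply _ _

lemma range_basis (m : ℕ) : Set.range (basis p m) = basisSet p m := by
  ext x
  constructor
  · rintro ⟨f, rfl⟩
    refine ⟨_, fun j => ?_, basis_apply f⟩
    rw [← GreenBar.range_kBasis]
    exact ⟨f j, rfl⟩
  · rintro ⟨b, hb, rfl⟩
    choose f hf using fun j => (GreenBar.range_kBasis (p := p)).symm ▸ hb j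
    exact ⟨f, by rw [basis_apply]; exact congrArg _ (funext hf)⟩

lemma consHom_basis {m : ℕ} (x : (Fin m → Fin p) × Fin p) :
    consHom p m ((basis p m).tensorProduct (GreenBar.kBasis p) x) =
      basis p (m + 1) (((Equiv.prodComm _ _).trans (Fin.consEquiv fun _ => Fin p)) x) := by
  obtain ⟨f, i⟩ := x
  rw [Module.Basis.tensorProduct_apply, basis_apply, basis_apply, consHom_tprod_tmul]
  congr 1
  funext j
  refine Fin.cases rfl (fun j => rfl) j

variable (p) in
lemma consHom_bijective (m : ℕ) : Function.Bijective (consHom p m) :=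
  bijective_of_map_basis (A := KPower p m ⊗[ℤ] KRing p) (A' := KPower p (m + 1))
    (b := (basis p m).tensorProduct (GreenBar.kBasis p)) (b' := basis p (m + 1)) (consHom p m)
    ((Equiv.prodComm _ _).trans (Fin.consEquiv fun _ => Fin p)) consHom_basis

variable (p) in
/-- The isomorphism `K_p^{⊗ m} ⊗ K_p ≅ K_p^{⊗ (m + 1)}`. -/
def consEquiv (m : ℕ) : KPower p m ⊗[ℤ] KRing p ≃+* KPower p (m + 1) :=
  RingEquiv.ofBijective (consHom p m) (consHom_bijective p m)

lemma consEquiv_basis {m : ℕ} (f : Fin m → Fin p) (i : Fin p) :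
    consEquiv p m (basis p m f ⊗ₜ GreenBar.kBasis p i) =
      basis p (m + 1) (Fin.cons i f : Fin (m + 1) → Fin p) := by
  have h := consHom_basis (f, i)
  rw [Module.Basis.tensorProduct_apply] at h
  exact h

end KPower

/-! ### The Green ring as a tensor power -/

/-- A ring isomorphism as an isomorphism of `ℤ`-algebras, for any `ℤ`-algebra structures. -/
def intAlgEquiv {A A' : Type*} [Ring A] [Ring A'] [Algebra ℤ A] [Algebra ℤ A'] (e : A ≃+* A') :
    A ≃ₐ[ℤ] A' :=
  AlgEquiv.ofRingEquiv (f := e) fun n => by rw [eq_intCast, eq_intCast, map_intCast]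

namespace GreenBar

variable (k : Type u) [Field k] (p : ℕ) [Fact p.Prime] [CharP k p]

/-- The isomorphism `Ḡ_{m+1} ≅ Gr(Ver_p) ⊗ K_p^{⊗ m}`, with its effect on the distinguished bases:
it is built from `equivSemisimplification` for `m = 0` and repeated use of `tensorEquiv`. -/
lemma exists_equiv_tensorPower (m : ℕ) :
    ∃ (e : GreenBar k (CyclicGrp p (m + 1)) ≃+* GreenRing (Ver k p) ⊗[ℤ] KPower p m)
      (s : BlockSize p (m + 1) ≃ BlockSize p 1 × (Fin m → Fin p)),
      ∀ i, e (blockBasis k p (m + 1) i) =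
        simpleBasis k p 1 (s i).1 ⊗ₜ KPower.basis p m (s i).2 := by
  induction m with
  | zero =>
    have h1 : (1 : KPower p 0) = KPower.basis p 0 default := by
      rw [KPower.basis_apply, PiTensorProduct.one_def]
      exact congrArg _ (Subsingleton.elim _ _)
    let e₀ : ℤ ≃ₐ[ℤ] KPower p 0 := AlgEquiv.ofBijective (Algebra.ofId ℤ (KPower p 0))
      (bijective_of_map_basis (A := ℤ) (A' := KPower p 0) (b := Module.Basis.singleton Unit ℤ)
        (b' := KPower.basis p 0) (Algebra.ofId ℤ (KPower p 0)).toRingHom (Equiv.ofUnique _ _)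
        fun i => by
          rw [Module.Basis.singleton_apply, map_one, h1]
          exact congrArg _ (Subsingleton.elim _ _))
    let e₁ : GreenRing (Ver k p) ≃ₐ[ℤ] GreenRing (Ver k p) ⊗[ℤ] KPower p 0 :=
      (Algebra.TensorProduct.rid ℤ ℤ _).symm.trans (Algebra.TensorProduct.congr AlgEquiv.refl e₀)
    refine ⟨(equivSemisimplification k p 1).trans e₁.toRingEquiv,
      (Equiv.prodUnique _ _).symm, fun i => ?_⟩
    rw [RingEquiv.trans_apply, equivSemisimplification_apply, ← simpleBasis_apply]
    change simpleBasis k p 1 i ⊗ₜ e₀ 1 = _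
    rw [map_one, h1, Subsingleton.elim default ((Equiv.prodUnique _ (Fin 0 → Fin p)).symm i).2]
    rfl
  | succ m ih =>
    obtain ⟨e, s, he⟩ := ih
    have hm : 1 ≤ m + 1 := Nat.le_add_left 1 m
    let e₁ := (tensorEquiv k p hm).symm
    let e₂ := (Algebra.TensorProduct.congr (intAlgEquiv (A := GreenBar k (CyclicGrp p (m + 1)))
        (A' := GreenRing (Ver k p) ⊗[ℤ] KPower p m) e)
      (AlgEquiv.refl : KRing p ≃ₐ[ℤ] KRing p)).toRingEquiv
    let e₃ := (Algebra.TensorProduct.assoc ℤ ℤ ℤ (GreenRing (Ver k p)) (KPower p m)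
      (KRing p)).toRingEquiv
    let e₄ := (Algebra.TensorProduct.congr
      (AlgEquiv.refl : GreenRing (Ver k p) ≃ₐ[ℤ] GreenRing (Ver k p))
      (intAlgEquiv (A := KPower p m ⊗[ℤ] KRing p) (A' := KPower p (m + 1))
        (KPower.consEquiv p m))).toRingEquiv
    let t := Equiv.ofBijective _ (foldSize_bijective (p := p) hm)
    refine ⟨e₁.trans (e₂.trans (e₃.trans e₄)), t.symm.trans ((Equiv.prodCongr s
      (Equiv.refl _)).trans ((Equiv.prodAssoc _ _ _).trans (Equiv.prodCongr (Equiv.refl _)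
        ((Equiv.prodComm _ _).trans (Fin.consEquiv fun _ => Fin p))))), fun i => ?_⟩
    obtain ⟨⟨a, j⟩, rfl⟩ := t.surjective i
    have h1 : e₁ (blockBasis k p (m + 1 + 1) (t (a, j))) =
        blockBasis k p (m + 1) a ⊗ₜ kBasis p j := by
      rw [RingEquiv.symm_apply_eq, tensorEquiv_apply, ← tensorHom_basis,
        Module.Basis.tensorProduct_apply]
    have h2 : e₂ (blockBasis k p (m + 1) a ⊗ₜ kBasis p j) =
        (simpleBasis k p 1 (s a).1 ⊗ₜ KPower.basis p m (s a).2) ⊗ₜ kBasis p j := by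
      rw [← he]
      rfl
    rw [RingEquiv.trans_apply, RingEquiv.trans_apply, RingEquiv.trans_apply, h1, h2,
      Equiv.trans_apply, Equiv.symm_apply_apply]
    exact congrArg (fun y => simpleBasis k p 1 (s a).1 ⊗ₜ y) (KPower.consEquiv_basis (s a).2 j)

lemma exists_basedIso_tensorPower (m : ℕ) :
    ∃ e : GreenBar k (CyclicGrp p (m + 1)) ≃+* GreenRing (Ver k p) ⊗[ℤ] KPower p m,
      BasedIso (basisSet k (CyclicGrp p (m + 1)))
        (tensorBasisSet (Ver.basisSet k p) (KPower.basisSet p m)) e := by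
  obtain ⟨e, s, he⟩ := exists_equiv_tensorPower k p m
  refine ⟨e, basedIso_of_map_basis (A' := GreenRing (Ver k p) ⊗[ℤ] KPower p m)
    (b' := (simpleBasis k p 1).tensorProduct (KPower.basis p m)) range_blockBasis ?_ e s
    fun i => ?_⟩
  · refine (range_basis_tensorProduct _ _).trans ?_
    rw [range_simpleBasis, KPower.range_basis, Ver.basisSet]
  · exact (he i).trans (Module.Basis.tensorProduct_apply _ _ _ _).symm

end GreenBar

end

theorem corollaryG {k : Type*} [Field k] (p : ℕ) [Fact p.Prime] [CharP k p] :
    -- `K_p` is a based ring with basis `X_0, …, X_{p-1}` and the stated multiplication.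
    ((∃ b : Module.Basis (Fin p) ℤ (KRing p), ∀ i : Fin p, b i = KRing.gen p i) ∧
      IsBasedRing (KRing.basisSet p) ∧
      KRing.gen p 0 = 1 ∧
      (∀ i, 1 ≤ i → i ≤ p - 2 → KRing.gen p 1 * KRing.gen p i =
        KRing.gen p (i - 1) + KRing.gen p i + KRing.gen p (i + 1)) ∧
      KRing.gen p 1 * KRing.gen p (p - 1) = KRing.gen p (p - 2)) ∧
    -- `Ḡ_n` is a based ring.
    (∀ n : ℕ, 1 ≤ n → IsBasedRing (GreenBar.basisSet k (CyclicGrp p n))) ∧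
    -- `Ḡ_{n+1} = Ḡ_n ⊗ K_p`, extending the inflation map `Ḡ_n → Ḡ_{n+1}`
    (∀ n : ℕ, 1 ≤ n → ∃ e : GreenBar k (CyclicGrp p n) ⊗[ℤ] KRing p ≃+*
        GreenBar k (CyclicGrp p (n + 1)),
      BasedIso (tensorBasisSet (GreenBar.basisSet k (CyclicGrp p n)) (KRing.basisSet p))
        (GreenBar.basisSet k (CyclicGrp p (n + 1))) e ∧
      (∀ V : FDRep k (CyclicGrp p n),
        e (GreenBar.cls V ⊗ₜ[ℤ] 1) = GreenBar.cls (inflate p V)) ∧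
      ∀ i : ℕ, i < p → ∃ W : FDRep k (CyclicGrp p (n + 1)), Indecomposable W ∧
        Module.finrank k W = (if Even i then i * p ^ n + 1 else (i + 1) * p ^ n - 1) ∧
        e (1 ⊗ₜ[ℤ] KRing.gen p i) = GreenBar.cls W) ∧
    -- `Ḡ_1 = Gr(Ver_p)` is a based ring.
    (IsBasedRing (Ver.basisSet k p) ∧
      ∃ e : GreenBar k (CyclicGrp p 1) ≃+* GreenRing (Ver k p),
        BasedIso (GreenBar.basisSet k (CyclicGrp p 1)) (Ver.basisSet k p) e ∧
        ∀ V : FDRep k (CyclicGrp p 1), e (GreenBar.cls V) =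
          GreenRing.cls ((Semisimplification.functor k (CyclicGrp p 1)).obj V)) ∧
    -- `Ḡ_n ≅ Gr(Ver_p) ⊗ K_p^{⊗ (n-1)}`
    (∀ n : ℕ, 1 ≤ n → ∃ e : GreenBar k (CyclicGrp p n) ≃+*
        GreenRing (Ver k p) ⊗[ℤ] KPower p (n - 1),
      BasedIso (GreenBar.basisSet k (CyclicGrp p n))
        (tensorBasisSet (Ver.basisSet k p) (KPower.basisSet p (n - 1))) e) := by
  have hp := (Fact.out : p.Prime).two_le
  refine ⟨⟨⟨GreenBar.kBasis p, GreenBar.kBasis_apply⟩, GreenBar.isBasedRing_kRing p,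
    KRing.gen_zero, fun i hi _ => ?_, KRing.gen_one_mul_last⟩,
    fun n _ => (GreenBar.isSelfDualBasis k p n).isBasedRing GreenBar.range_blockBasis,
    fun n hn => ⟨GreenBar.tensorEquiv k p hn, GreenBar.basedIso_tensorEquiv hn, fun V => ?_,
      fun i hi => ?_⟩,
    ⟨?_, GreenBar.equivSemisimplification k p 1, GreenBar.basedIso_equivSemisimplification,
      GreenBar.toSemisimplification_cls⟩, fun n hn => ?_⟩
  · obtain ⟨j, rfl⟩ := Nat.exists_eq_add_of_le' hi
    exact KRing.gen_one_mul j
  · rw [GreenBar.tensorEquiv_apply, GreenBar.tensorHom_tmul, map_one, mul_one,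
      GreenBar.inflateHom_cls]
  · have hmem := GreenBar.foldSize_mem hn ⟨i, hi⟩ ⟨1, GreenBar.one_le_and_not_dvd p n⟩
    refine ⟨jordan k p (n + 1) (GreenBar.foldSize p n i 1), FDRep.indecomposable_jordan
      (Nat.pos_of_ne_zero fun h => hmem.2 (h ▸ dvd_zero p)) hmem.1, ?_, ?_⟩
    · rw [finrank_jordan k p hmem.1, GreenBar.foldSize_one p n i (Nat.one_le_pow _ _ (by omega))]
    · rw [GreenBar.tensorEquiv_apply, GreenBar.tensorHom_tmul, map_one, one_mul,
        GreenBar.kHom_gen hn hi]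
      rfl
  · refine IsSelfDualBasis.isBasedRing (b := GreenBar.simpleBasis k p 1)
      (IsSelfDualBasis.of_map (b' := GreenBar.blockBasis k p 1)
        (GreenBar.equivSemisimplification k p 1).symm (Function.Embedding.refl _)
        (fun i => ?_) (GreenBar.isSelfDualBasis k p 1)) GreenBar.range_simpleBasis
    rw [GreenBar.simpleBasis_apply]
    exact (GreenBar.equivSemisimplification k p 1).symm_apply_apply _
  · obtain ⟨m, rfl⟩ := Nat.exists_eq_add_of_le' hn
    exact GreenBar.exists_basedIso_tensorPower k p m
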